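/- Let $(M,g)$ be a connected smooth Riemannian manifold (without boundary, Hausdorff, not necessarily complete) of dimension $m\ge 1$ and let $P\in M$. Let $r_g(Q)$ be the geodesic distance from $P$ to $Q$. Let $\iota_g\in(0,\infty]$ be the injectivity radius at $P$, i.e. the supremum of the $R$ such that $\exp_P$ is defined on the open ball of radius $R$ in $T_PM$ and maps it diffeomorphically onto an open subset of $M$, and let $B_g=\{Q\in M: r_g(Q)<\iota_g\}$. Let $(x^1,\dots,x^m)\mapsto\exp_P(x^1e_1+\dots+x^me_m)$ be geodesic coordinates on $B_g$ given by an orthonormal basis $(e_i)$ of $T_PM$, and let $\tilde\Theta_g=\det\big(g(\partial_{x^i},\partial_{x^j})\big)^{1/2}$ be the volume density function on $B_g$ (it does not depend on the basis). A function $f$ is called radial on $B_g$ if $f=\varphi\circ r_g$ on $B_g$ for some smooth even function $\varphi$ on $(-\iota_g,\iota_g)$; $(M,g)$ is called central harmonic at $P$ if $\tilde\Theta_g$ is radial on $B_g$. Suppose that $(M,g)$ is central harmonic at $P$ and that $\Psi$ is a smooth positive function on $M$ which is radial on $B_g$. Then $(M,\Psi^2g)$ is central harmonic at $P$. Moreover,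 if $g'=\Psi^2g$, if $\Psi=\psi\circ r_g$ on $B_g$ with $\psi$ smooth and even on $(-\iota_g,\iota_g)$, and if $\eta(s)=\int_0^s\psi(t)\,dt$, then $B_{g'}=B_g$; the distance from $P$ in the new metric is $$r_{g'}=\eta\circ r_g\quad\text{on }B_g;$$ and the new volume density function is $$\tilde\Theta_{g'}=(\eta\circ r_g)^{1-m}\,r_g^{\,m-1}\,(\psi\circ r_g)^{m-1}\,\tilde\Theta_g\quad\text{on }B_g\setminus\{P\},\qquad \tilde\Theta_{g'}(P)=\tilde\Theta_g(P).$$ -/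

import Mathlib

open Set Manifold Bundle Bornology
open scoped ContDiff Topology ENNReal

noncomputable section

namespace RiemGeom

variable {m : ℕ} {M : Type*} [TopologicalSpace M]
  [ChartedSpace (EuclideanSpace ℝ (Fin m)) M] [IsManifold (𝓡 m) ∞ M]

/-- Smooth Riemannian metrics on a smooth `m`-dimensional manifold without boundary. -/
abbrev RiemMetric (m : ℕ) (M : Type*) [TopologicalSpace M]
    [ChartedSpace (EuclideanSpace ℝ (Fin m)) M] [IsManifold (𝓡 m) ∞ M] :=
  ContMDiffRiemannianMetric (𝓡 m) ∞ (EuclideanSpace ℝ (Fin m))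
    (fun x : M => TangentSpace (𝓡 m) x)

set_option synthInstance.maxHeartbeats 200000 in
/-- The conformally deformed metric `Ψ² g`, for a smooth positive function `Ψ`. -/
def conformal (g : RiemMetric m M) (Ψ : M → ℝ) (hΨ : ContMDiff (𝓡 m) 𝓘(ℝ, ℝ) ∞ Ψ)
    (hpos : ∀ x, 0 < Ψ x) : RiemMetric m M where
  inner x := (Ψ x ^ 2) • g.inner x
  symm x v w := by simp [g.symm x v w]
  pos x v hv := by
    have h1 := g.pos x v hv
    have h2 := hpos x
    simp only [smul_apply, smul_eq_mul]
    positivity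
  isVonNBounded x := by
    have h := (g.isVonNBounded x).image ((Ψ x)⁻¹ • ContinuousLinearMap.id ℝ
      (TangentSpace (𝓡 m) x))
    refine h.subset ?_
    intro v hv
    have h2 := (hpos x).ne'
    refine ⟨Ψ x • v, ?_, ?_⟩
    · simpa [pow_two, mul_assoc] using hv
    · simp [smul_smul, h2]
  contMDiff := by
    have h := ContMDiff.smul_section (hΨ.pow 2) g.contMDiff
    exact h

/-- The geodesic distance of `(M, g)` as an extended number: the infimum of the `g`-lengths of the
`C¹` paths from `P` to `Q`. -/
def gEDist (g : RiemMetric m M) (P Q : M) : ℝ≥0∞ :=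
  letI : RiemannianBundle (fun x : M => TangentSpace (𝓡 m) x) := ⟨g.toRiemannianMetric⟩
  Manifold.riemannianEDist (𝓡 m) P Q

/-- The geodesic distance `r(Q)` from `P` to `Q`. -/
def gDist (g : RiemMetric m M) (P Q : M) : ℝ := (gEDist g P Q).toReal

/-- The metric in the preferred chart at `x₀`: the value `g(∑ uⁱ ∂ᵢ, ∑ wʲ ∂ⱼ)` at the point
with coordinates `y`. -/
def coordMetric (g : RiemMetric m M) (x₀ : M) (y u w : EuclideanSpace ℝ (Fin m)) : ℝ :=
  g.inner ((extChartAt (𝓡 m) x₀).symm y)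
    (mfderiv (𝓡 m) (𝓡 m) (extChartAt (𝓡 m) x₀).symm y u)
    (mfderiv (𝓡 m) (𝓡 m) (extChartAt (𝓡 m) x₀).symm y w)

/-- The Christoffel symbols of the first kind in the preferred chart at `x₀`, contracted with
vectors: `uⁱ vʲ wᵏ (∂ᵢ gⱼₖ + ∂ⱼ gᵢₖ - ∂ₖ gᵢⱼ) / 2`. -/
def christoffel (g : RiemMetric m M) (x₀ : M) (y u v w : EuclideanSpace ℝ (Fin m)) : ℝ :=
  (fderiv ℝ (fun z => coordMetric g x₀ z v w) y u
    + fderiv ℝ (fun z => coordMetric g x₀ z u w) y v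
    - fderiv ℝ (fun z => coordMetric g x₀ z u v) y w) / 2

/-- `γ` is a geodesic on the open set `s` of times: it is `C²` there and, in the chart at each of
its points, satisfies `gₗₖ γ̈ˡ + Γᵢⱼₖ γ̇ⁱ γ̇ʲ = 0` for all `k`
(the geodesic equation, with the upper index lowered). -/
def IsGeodesicOn (g : RiemMetric m M) (γ : ℝ → M) (s : Set ℝ) : Prop :=
  ContMDiffOn 𝓘(ℝ, ℝ) (𝓡 m) 2 γ s ∧
    ∀ t ∈ s, ∀ w : EuclideanSpace ℝ (Fin m),
      let c : ℝ → EuclideanSpace ℝ (Fin m) := fun τ => extChartAt (𝓡 m) (γ t) (γ τ)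
      coordMetric g (γ t) (c t) (deriv (deriv c) t) w
        + christoffel g (γ t) (c t) (deriv c t) (deriv c t) w = 0

/-- `γ` is a geodesic, defined on an open interval containing `[0,1]`, with `γ(0) = P` and
initial velocity `v`. -/
def IsGeodesicFrom (g : RiemMetric m M) (P : M) (v : TangentSpace (𝓡 m) P) (γ : ℝ → M) : Prop :=
  (∃ ε > 0, IsGeodesicOn g γ (Ioo (-ε) (1 + ε))) ∧ γ 0 = P ∧
    (mfderiv 𝓘(ℝ, ℝ) (𝓡 m) γ 0 (1 : ℝ) : EuclideanSpace ℝ (Fin m)) = v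

/-- The domain of the exponential map at `P`; the tangent space at `P` is, in Mathlib, the model
space `EuclideanSpace ℝ (Fin m)` as a topological vector space. -/
def expDomain (g : RiemMetric m M) (P : M) : Set (EuclideanSpace ℝ (Fin m)) :=
  {v | ∃ γ : ℝ → M, IsGeodesicFrom g P v γ}

open Classical in
/-- The exponential map at `P`: `exp_P(v) = γ(1)` for the geodesic `γ` with `γ(0) = P`, `γ̇(0) = v`
(with the value `P` outside the domain). -/
def expMap (g : RiemMetric m M) (P : M) (v : EuclideanSpace ℝ (Fin m)) : M :=
  if h : v ∈ expDomain g P then h.choose 1 else P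

/-- The open ball of radius `R` in `T_P M`, for the norm given by `g`. -/
def tangentBall (g : RiemMetric m M) (P : M) (R : ℝ≥0∞) : Set (EuclideanSpace ℝ (Fin m)) :=
  {v | ENNReal.ofReal (√(g.inner P v v)) < R}

/-- The injectivity radius at `P`: the supremum of the radii `R` such that `exp_P` is defined on
the open ball of radius `R` in `T_P M` and is a diffeomorphism from it onto an open subset. -/
def injRadius (g : RiemMetric m M) (P : M) : ℝ≥0∞ :=
  sSup {R | tangentBall g P R ⊆ expDomain g P ∧ InjOn (expMap g P) (tangentBall g P R) ∧
    IsLocalDiffeomorphOn (𝓡 m) (𝓡 m) ∞ (expMap g P) (tangentBall g P R)}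

/-- The open ball about `P` whose radius is the injectivity radius. -/
def injBall (g : RiemMetric m M) (P : M) : Set M := {Q | gEDist g P Q < injRadius g P}

/-- Orthonormal bases of `T_P M`. -/
def IsOrthonormalFrame (g : RiemMetric m M) (P : M) (e : Fin m → TangentSpace (𝓡 m) P) : Prop :=
  ∀ i j, g.inner P (e i) (e j) = if i = j then 1 else 0

/-- The parametrization `x ↦ exp_P(x¹ e₁ + ⋯ + xᵐ eₘ)` defining geodesic coordinates. -/
def geodParam (g : RiemMetric m M) (P : M) (e : Fin m → TangentSpace (𝓡 m) P)
    (x : EuclideanSpace ℝ (Fin m)) : M :=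
  expMap g P (∑ i, x i • e i)

/-- The geodesic coordinates of a point `Q` of the injectivity ball. -/
def geodCoord (g : RiemMetric m M) (P : M) (e : Fin m → TangentSpace (𝓡 m) P) (Q : M) :
    EuclideanSpace ℝ (Fin m) :=
  Function.invFunOn (geodParam g P e) {x | ENNReal.ofReal ‖x‖ < injRadius g P} Q

/-- The coefficient `gᵢⱼ = g(∂_{xⁱ}, ∂_{xʲ})` in the geodesic coordinates, at the point with
coordinates `x`. -/
def geodMetric (g : RiemMetric m M) (P : M) (e : Fin m → TangentSpace (𝓡 m) P)
    (x : EuclideanSpace ℝ (Fin m)) : Matrix (Fin m) (Fin m) ℝ :=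
  Matrix.of fun i j => g.inner (geodParam g P e x)
    (mfderiv (𝓡 m) (𝓡 m) (geodParam g P e) x (EuclideanSpace.single i (1 : ℝ)))
    (mfderiv (𝓡 m) (𝓡 m) (geodParam g P e) x (EuclideanSpace.single j (1 : ℝ)))

/-- The volume density function `det(gᵢⱼ)^{1/2}`, as a function on the injectivity ball. It does
not depend on the choice of the orthonormal basis `e`. -/
def volDensity (g : RiemMetric m M) (P : M) (e : Fin m → TangentSpace (𝓡 m) P) (Q : M) : ℝ :=
  √(geodMetric g P e (geodCoord g P e Q)).det

/-- On the injectivity ball of radius `ι`, one has `f = φ ∘ r`, where `φ` is a smooth even function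
of one variable defined on `(-ι, ι)`. -/
def IsRadialProfile (g : RiemMetric m M) (P : M) (f : M → ℝ) (φ : ℝ → ℝ) : Prop :=
  ContDiffOn ℝ ∞ φ {t | ENNReal.ofReal |t| < injRadius g P} ∧
    (∀ t, ENNReal.ofReal |t| < injRadius g P → φ (-t) = φ t) ∧
    ∀ Q ∈ injBall g P, f Q = φ (gDist g P Q)

/-- `f` is a (smooth) radial function on the injectivity ball. -/
def IsRadial (g : RiemMetric m M) (P : M) (f : M → ℝ) : Prop := ∃ φ, IsRadialProfile g P f φ

/-- `(M, g)` is central harmonic at `P`: the volume density function is radial on the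
injectivity ball. -/
def CentralHarmonic (g : RiemMetric m M) (P : M) : Prop :=
  ∀ e : Fin m → TangentSpace (𝓡 m) P, IsOrthonormalFrame g P e → IsRadial g P (volDensity g P e)

end RiemGeom

end

/-! Write `F` for the exponential map of `g` at `P` and `F'` for that of `g' = Ψ² g`. By the Gauss
lemma the gradient of a radial function is radial, so along a ray of `F` the conformal change only
adds a tangential term to the geodesic equation: the rays stay geodesics of `g'` once they are
reparametrized by `g'`-arc length. Hence `F' ∘ T = F`, where `T v = s(v) v` and `s(v) = Ψ(P)⁻¹ ∫₀¹
Ψ(F(tv)) dt` (`stretch`, `confMap`, `expMap_confMap`). The `g'`-norm of `T v` is `η(|v|)`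
(`IsRadialProfile.tnorm_confMap`), and `T` maps the ball of radius `ι_g` diffeomorphically onto the
`g'`-ball of radius `sup η`. So `ι_{g'} ≥ sup η` (`goodRadius_confRadius`).

The reverse inequality is the delicate point (`injRadius_conformal`). Suppose it fails. If `ι_g =
∞`, connectedness makes `F` surjective, and `F'` then takes some value twice inside its own
injectivity ball. If `ι_g < ∞`, the relation `F = F' ∘ T` controls position and velocity of every
ray as it reaches the sphere of radius `ι_g`; so `F` extends smoothly beyond the sphere
(`GoodRadius.exists_extension`), is a local diffeomorphism there, and is injective on the closed
ball. By compactness a larger radius is good for `g`, which contradicts the definition of `ι_g`.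

Since the distance from `P` to `F v` is `|v|` (`GoodRadius.gEDist_expMap`, from the Gauss lemma),
the equality of the balls and the distance formula follow. For the density, `DT = s·id + ds ⊗ v` has
determinant `s^(m-1) (s + ds(v)) = s^(m-1) Ψ(F v)/Ψ(P)`. Comparing determinants in `Ψ² F*g =
T*(F'*g')` gives `Θ' = (Ψ/κ)^(m-1) Θ`, where `κ = η(r)/r` is the mean of `ψ` on `[0, r]`
(`volDensity_conformal_expMap`). As `κ` is smooth and even through `r = 0` and `η` is odd with
smooth inverse, `Θ'` is radial for `g'`.

The smoothness of the exponential map rests on a smooth flow of the geodesic equation, obtained from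
the inverse function theorem in a space of continuous curves (`exists_smooth_flow`). -/

noncomputable section

namespace RiemGeom

set_option linter.unusedSectionVars false

/-! ### Inverse function theorem for smooth maps. -/

section InverseFunction

variable {A B : Type*} [NormedAddCommGroup A] [NormedSpace ℝ A] [CompleteSpace A]
  [NormedAddCommGroup B] [NormedSpace ℝ B]

/-- Inverse function theorem, with smoothness of the inverse on a whole neighbourhood. -/
theorem exists_smooth_local_inverse {f : A → B} {s : Set A} (hs : IsOpen s)
    (hf : ContDiffOn ℝ ∞ f s) {a : A} (ha : a ∈ s) (hinv : (fderiv ℝ f a).IsInvertible) :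
    ∃ e : OpenPartialHomeomorph A B, a ∈ e.source ∧ e.source ⊆ s ∧ (∀ x, e x = f x) ∧
      ContDiffOn ℝ ∞ e.symm e.target := by
  obtain ⟨f', hf'⟩ := hinv
  have hfa : ContDiffAt ℝ ∞ f a := hf.contDiffAt (hs.mem_nhds ha)
  have hda : HasFDerivAt f (f' : A →L[ℝ] B) a := by
    rw [hf']; exact (hfa.differentiableAt (by simp)).hasFDerivAt
  let e := hfa.toOpenPartialHomeomorph f hda (by simp)
  have hcont : ContinuousOn (fderiv ℝ f) s := hf.continuousOn_fderiv_of_isOpen hs (by simp)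
  -- Restricting to points whose derivative lies in the interior of the set of invertible maps makes
  -- the inverse smooth on the whole target, not only at `f a`.
  let O := {x | x ∈ s ∧ fderiv ℝ f x ∈
    interior (range ((↑) : (A ≃L[ℝ] B) → A →L[ℝ] B))}
  have hO : IsOpen O := hcont.isOpen_inter_preimage hs isOpen_interior
  refine ⟨e.restrOpen O hO, ?_, ?_, fun x => rfl, ?_⟩
  · refine ⟨hfa.mem_toOpenPartialHomeomorph_source hda (by simp), ha, ?_⟩
    rw [← hf', mem_interior_iff_mem_nhds]
    exact f'.nhds
  · rintro x ⟨-, hx, -⟩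
    exact hx
  · intro y hy
    have hx := (e.restrOpen O hO).map_target hy
    set x := (e.restrOpen O hO).symm y with hxdef
    obtain ⟨-, hxs, hxi⟩ := hx
    obtain ⟨g', hg'⟩ := interior_subset hxi
    have hfx : ContDiffAt ℝ ∞ f x := hf.contDiffAt (hs.mem_nhds hxs)
    have hdx : HasFDerivAt f (g' : A →L[ℝ] B) x := by
      rw [hg']; exact (hfx.differentiableAt (by simp)).hasFDerivAt
    exact ((e.restrOpen O hO).contDiffAt_symm (f₀' := g') hy hdx hfx).contDiffWithinAt

/-- An injective smooth map with invertible derivative on an open set has an open image and a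
smooth inverse. -/
theorem smooth_inverse_of_injOn {f : A → B} {s : Set A} (hs : IsOpen s)
    (hf : ContDiffOn ℝ ∞ f s) (hinj : InjOn f s)
    (hinv : ∀ a ∈ s, (fderiv ℝ f a).IsInvertible) :
    IsOpen (f '' s) ∧ ContDiffOn ℝ ∞ (Function.invFunOn f s) (f '' s) := by
  have key : ∀ a ∈ s, f '' s ∈ 𝓝 (f a) ∧ ContDiffAt ℝ ∞ (Function.invFunOn f s) (f a) := by
    intro a ha
    obtain ⟨e, hae, hes, hef, hsymm⟩ := exists_smooth_local_inverse hs hf ha (hinv a ha)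
    have ht : e.target ∈ 𝓝 (f a) := by
      rw [← hef]; exact e.open_target.mem_nhds (e.map_source hae)
    have hsub : ∀ y ∈ e.target, e.symm y ∈ s ∧ f (e.symm y) = y := fun y hy =>
      ⟨hes (e.map_target hy), by rw [← hef]; exact e.right_inv hy⟩
    refine ⟨Filter.mem_of_superset ht fun y hy => ⟨_, hsub y hy⟩, ?_⟩
    -- Injectivity on `s` forces the globally chosen inverse to coincide with the local one near `f
    -- a`.
    refine (hsymm.contDiffAt ht).congr_of_eventuallyEq ?_
    filter_upwards [ht] with y hy
    have hy' : ∃ a ∈ s, f a = y := ⟨_, hsub y hy⟩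
    exact hinj (Function.invFunOn_mem hy') (hsub y hy).1
      ((Function.invFunOn_eq hy').trans (hsub y hy).2.symm)
  refine ⟨isOpen_iff_mem_nhds.2 ?_, ?_⟩
  · rintro _ ⟨a, ha, rfl⟩
    exact (key a ha).1
  · rintro _ ⟨a, ha, rfl⟩
    exact (key a ha).2.contDiffWithinAt

end InverseFunction

/-! ### Smoothness of composition operators on spaces of continuous maps. -/

section Nemytskii

universe u v

variable {K : Type v} [TopologicalSpace K] [CompactSpace K] {F G H : Type u}
  [NormedAddCommGroup F] [NormedSpace ℝ F] [NormedAddCommGroup G] [NormedSpace ℝ G]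
  [NormedAddCommGroup H] [NormedSpace ℝ H]

/-- The pointwise application of a continuous family of linear maps, as a bounded bilinear map;
the linear maps are parametrized by a bilinear map `b`. -/
def pointwiseApply (b : H →L[ℝ] F →L[ℝ] G) : C(K, H) →L[ℝ] C(K, F) →L[ℝ] C(K, G) :=
  LinearMap.mkContinuous₂
    (LinearMap.mk₂ ℝ (fun (L : C(K, H)) (h : C(K, F)) =>
      (⟨fun k => b (L k) (h k), by fun_prop⟩ : C(K, G)))
      (fun _ _ _ => by ext; simp) (fun _ _ _ => by ext; simp)
      (fun _ _ _ => by ext; simp) (fun _ _ _ => by ext; simp)) ‖b‖ (by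
    intro L h
    refine (ContinuousMap.norm_le _ (by positivity)).2 fun k => ?_
    exact (b.le_opNorm₂ (L k) (h k)).trans
      (by gcongr; exacts [L.norm_coe_le_norm k, h.norm_coe_le_norm k]))

@[simp] theorem pointwiseApply_apply (b : H →L[ℝ] F →L[ℝ] G) (L : C(K, H)) (h : C(K, F)) (k : K) :
    pointwiseApply b L h k = b (L k) (h k) := rfl

/-- Continuity of `γ ↦ f' ∘ γ` in the sup norm bounds the oscillation of the derivative uniformly in
`k`; the mean value inequality on each segment from `γ k` to `γ k + h k` then gives an error that is
`o(‖h‖)` in the sup norm. -/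
theorem hasFDerivAt_postcomp (b : H →L[ℝ] F →L[ℝ] G) (f : C(F, G))
    (f' : C(F, H)) (hf : ∀ x, HasFDerivAt f (b (f' x)) x) (γ : C(K, F)) :
    HasFDerivAt (fun γ : C(K, F) => f.comp γ) (pointwiseApply b (f'.comp γ)) γ := by
  rw [hasFDerivAt_iff_isLittleO_nhds_zero, Asymptotics.isLittleO_iff]
  intro c hc
  have hc' : 0 < c / (‖b‖ + 1) := by positivity
  have hcont : Continuous (fun γ : C(K, F) => f'.comp γ) := ContinuousMap.continuous_postcomp f'
  obtain ⟨δ, hδ, hball⟩ := Metric.continuousAt_iff.1 (hcont.continuousAt (x := γ)) _ hc'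
  filter_upwards [Metric.ball_mem_nhds (0 : C(K, F)) hδ] with h hh
  rw [mem_ball_zero_iff] at hh
  refine (ContinuousMap.norm_le _ (by positivity)).2 fun k => ?_
  simp only [ContinuousMap.sub_apply, ContinuousMap.comp_apply, ContinuousMap.add_apply,
    pointwiseApply_apply]
  have hd : ∀ s ∈ Icc (0 : ℝ) 1, ‖b (f' (γ k + s • h k)) - b (f' (γ k))‖ ≤ c := by
    intro s hs
    have h1 : dist (γ + s • h) γ < δ := by
      rw [dist_eq_norm, add_sub_cancel_left, norm_smul, Real.norm_of_nonneg hs.1]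
      nlinarith [norm_nonneg h, hs.2]
    have h2 := hball h1
    rw [dist_eq_norm] at h2
    have h3 := ((f'.comp (γ + s • h) - f'.comp γ).norm_coe_le_norm k).trans h2.le
    rw [← map_sub]
    calc ‖b (f' (γ k + s • h k) - f' (γ k))‖ ≤ ‖b‖ * (c / (‖b‖ + 1)) := b.le_opNorm_of_le h3
      _ ≤ (‖b‖ + 1) * (c / (‖b‖ + 1)) := by gcongr; simp
      _ = c := by field_simp
  have hmv := (convex_segment (γ k) (γ k + h k)).norm_image_sub_le_of_norm_hasFDerivWithin_le'
    (f := f) (f' := fun x => b (f' x)) (φ := b (f' (γ k))) (C := c)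
    (fun x _ => (hf x).hasFDerivWithinAt) (by
      rintro x hx
      rw [segment_eq_image'] at hx
      obtain ⟨s, hs, rfl⟩ := hx
      simpa using hd s hs) (left_mem_segment ℝ _ _) (right_mem_segment ℝ _ _)
  rw [add_sub_cancel_left] at hmv
  exact hmv.trans (by gcongr; exact h.norm_coe_le_norm k)

/-- The derivative of composition with `f` is composition with `f'` followed by the bounded linear
operator `pointwiseApply b`, which gains one order of differentiability. -/
theorem contDiff_postcomp_succ (b : H →L[ℝ] F →L[ℝ] G) (f : C(F, G)) (f' : C(F, H))
    (hf : ∀ x, HasFDerivAt f (b (f' x)) x) {n : ℕ}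
    (h : ContDiff ℝ n (fun γ : C(K, F) => f'.comp γ)) :
    ContDiff ℝ (n + 1 : ℕ) (fun γ : C(K, F) => f.comp γ) := by
  have hcast : ((n + 1 : ℕ) : WithTop ℕ∞) = n + 1 := by push_cast; rfl
  rw [hcast, contDiff_succ_iff_hasFDerivAt]
  exact ⟨fun γ => pointwiseApply b (f'.comp γ),
    (ContinuousLinearMap.contDiff (pointwiseApply (K := K) b)).comp h,
    fun γ => hasFDerivAt_postcomp b f f' hf γ⟩

/-- The induction runs over all targets `G` at once, because the derivative of `f` takes values in
`F →L[ℝ] G`. -/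
theorem contDiff_postcomp_nat (n : ℕ) : ∀ {G : Type u} [NormedAddCommGroup G] [NormedSpace ℝ G]
    (f : C(F, G)) (_ : ContDiff ℝ n f), ContDiff ℝ n (fun γ : C(K, F) => f.comp γ) := by
  induction n with
  | zero =>
    intro G _ _ f hf
    exact contDiff_zero.2 (ContinuousMap.continuous_postcomp _)
  | succ n ih =>
    intro G _ _ f hf
    have hf' : ContDiff ℝ n (fderiv ℝ f) := hf.fderiv_right (by norm_cast)
    exact contDiff_postcomp_succ (H := F →L[ℝ] G) (ContinuousLinearMap.id ℝ _) f
      ⟨fderiv ℝ f, hf'.continuous⟩ (fun x => (hf.differentiable (by simp) x).hasFDerivAt) (ih _ hf')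

theorem contDiff_postcomp (f : C(F, G)) (hf : ContDiff ℝ ∞ f) :
    ContDiff ℝ ∞ (fun γ : C(K, F) => f.comp γ) :=
  contDiff_infty.2 fun n => contDiff_postcomp_nat n f (contDiff_infty.1 hf n)

end Nemytskii

/-! ### Smooth dependence of solutions of an ordinary differential equation on the initial data. -/

section Flow

universe u

variable {F : Type u} [NormedAddCommGroup F] [NormedSpace ℝ F]

/-- The primitive vanishing at `0`, as an operator on continuous functions on `[0,1]`. -/
def primitiveCLM : C(Icc (0 : ℝ) 1, F) →L[ℝ] C(Icc (0 : ℝ) 1, F) :=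
  LinearMap.mkContinuous
    { toFun := fun γ => ⟨fun t => ∫ s in (0 : ℝ)..t, γ (projIcc 0 1 zero_le_one s),
        (intervalIntegral.continuous_primitive (fun a b => Continuous.intervalIntegrable
          (γ.continuous.comp continuous_projIcc) a b) 0).comp continuous_subtype_val⟩
      map_add' := fun γ γ' => by
        ext t
        exact intervalIntegral.integral_add
          ((γ.continuous.comp continuous_projIcc).intervalIntegrable _ _)
          ((γ'.continuous.comp continuous_projIcc).intervalIntegrable _ _)
      map_smul' := fun c γ => by
        ext t
        exact intervalIntegral.integral_smul c _ } 1 (by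
    intro γ
    rw [one_mul]
    refine (ContinuousMap.norm_le _ (norm_nonneg _)).2 fun t => ?_
    refine (intervalIntegral.norm_integral_le_of_norm_le_const
      fun s _ => γ.norm_coe_le_norm _).trans ?_
    rw [sub_zero, abs_of_nonneg t.2.1]
    exact mul_le_of_le_one_right (norm_nonneg _) t.2.2)

theorem primitiveCLM_apply (γ : C(Icc (0 : ℝ) 1, F)) (t : Icc (0 : ℝ) 1) :
    primitiveCLM γ t = ∫ s in (0 : ℝ)..t, γ (projIcc 0 1 zero_le_one s) := rfl

/-- The inclusion of the constant functions. -/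
def constCLM : F →L[ℝ] C(Icc (0 : ℝ) 1, F) :=
  LinearMap.mkContinuous
    { toFun := fun x => ContinuousMap.const _ x
      map_add' := fun _ _ => rfl
      map_smul' := fun _ _ => rfl } 1 (by
    intro x
    rw [one_mul]
    exact (ContinuousMap.norm_le _ (norm_nonneg _)).2 fun t => le_rfl)

@[simp] theorem constCLM_apply (x : F) (t : Icc (0 : ℝ) 1) : constCLM x t = x := rfl

/-- The integral equation of the rescaled flow `γ' = τ Y(γ)`, `γ(0) = x`. -/
def flowDefect (Y : C(F, F)) (q : (F × ℝ) × C(Icc (0 : ℝ) 1, F)) :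
    (F × ℝ) × C(Icc (0 : ℝ) 1, F) :=
  (q.1, q.2 - constCLM q.1.1 - q.1.2 • primitiveCLM (Y.comp q.2))

theorem contDiff_flowDefect (Y : C(F, F)) (hY : ContDiff ℝ ∞ Y) :
    ContDiff ℝ ∞ (flowDefect Y) := by
  have h1 : ContDiff ℝ ∞ fun q : (F × ℝ) × C(Icc (0 : ℝ) 1, F) => primitiveCLM (Y.comp q.2) :=
    (ContinuousLinearMap.contDiff (primitiveCLM (F := F))).comp ((contDiff_postcomp Y hY).comp contDiff_snd)
  have h2 : ContDiff ℝ ∞ fun q : (F × ℝ) × C(Icc (0 : ℝ) 1, F) => constCLM (F := F) q.1.1 :=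
    (ContinuousLinearMap.contDiff (constCLM (F := F))).comp (contDiff_fst.comp contDiff_fst)
  exact contDiff_fst.prodMk ((contDiff_snd.sub h2).sub
    ((contDiff_snd.comp contDiff_fst).smul h1))

/-- At time `0` the nonlinear term is multiplied by `0`, so the differential has the triangular form
`(a, w) ↦ (a, w - Λ a)`, with inverse `(a, w) ↦ (a, w + Λ a)`. -/
theorem isInvertible_fderiv_flowDefect (Y : C(F, F)) (hY : ContDiff ℝ ∞ Y) (x : F) :
    (fderiv ℝ (flowDefect Y) ((x, 0), constCLM x)).IsInvertible := by
  set q₀ : (F × ℝ) × C(Icc (0 : ℝ) 1, F) := ((x, 0), constCLM x)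
  let A := (F × ℝ)
  let W := C(Icc (0 : ℝ) 1, F)
  let w₀ : W := primitiveCLM (Y.comp (constCLM x))
  let Λ : A →L[ℝ] W := constCLM.comp (ContinuousLinearMap.fst ℝ F ℝ) +
    (ContinuousLinearMap.snd ℝ F ℝ).smulRight w₀
  let p₁ := ContinuousLinearMap.fst ℝ A W
  let p₂ := ContinuousLinearMap.snd ℝ A W
  have h1 : ContDiff ℝ ∞ fun q : A × W => primitiveCLM (Y.comp q.2) :=
    (ContinuousLinearMap.contDiff (primitiveCLM (F := F))).comp ((contDiff_postcomp Y hY).comp contDiff_snd)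
  have h2 : HasFDerivAt (fun q : A × W => q.1.2 • primitiveCLM (Y.comp q.2))
      (((ContinuousLinearMap.snd ℝ F ℝ).comp p₁).smulRight w₀) q₀ := by
    have hs : HasFDerivAt (fun q : A × W => q.1.2) ((ContinuousLinearMap.snd ℝ F ℝ).comp p₁) q₀ :=
      ((ContinuousLinearMap.snd ℝ F ℝ).comp p₁).hasFDerivAt
    have := hs.smul ((h1.differentiable (by simp)) q₀).hasFDerivAt
    refine this.congr_fderiv ?_
    ext v <;> simp [q₀, w₀]
  have h3 : HasFDerivAt (flowDefect Y) (p₁.prod (p₂ - Λ.comp p₁)) q₀ := by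
    have h4 : HasFDerivAt (fun q : A × W => q.2 - constCLM q.1.1)
        (p₂ - constCLM.comp ((ContinuousLinearMap.fst ℝ F ℝ).comp p₁)) q₀ :=
      (p₂ - constCLM.comp ((ContinuousLinearMap.fst ℝ F ℝ).comp p₁)).hasFDerivAt
    refine (p₁.hasFDerivAt.prodMk (h4.sub h2)).congr_fderiv ?_
    congr 1
    simp only [Λ, ContinuousLinearMap.add_comp, sub_sub]
    congr 1
  rw [h3.fderiv]
  refine ContinuousLinearMap.IsInvertible.of_inverse (g := p₁.prod (p₂ + Λ.comp p₁)) ?_ ?_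
  · refine ContinuousLinearMap.ext fun v => ?_
    simp [p₁, p₂]
  · refine ContinuousLinearMap.ext fun v => ?_
    simp [p₁, p₂]

variable [FiniteDimensional ℝ F]

/-- The smoothness of composition operators is available for maps on the whole space; a cut-off by a
bump function reduces a local vector field to that case. -/
theorem exists_smooth_global_extension {X : F → F} {U : Set F} (hU : IsOpen U)
    (hX : ContDiffOn ℝ ∞ X U) {x₀ : F} (hx₀ : x₀ ∈ U) :
    ∃ Y : F → F, ContDiff ℝ ∞ Y ∧ ∃ r > 0, Metric.ball x₀ r ⊆ U ∧
      EqOn Y X (Metric.ball x₀ r) := by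
  obtain ⟨R, hR, hball⟩ := Metric.isOpen_iff.1 hU x₀ hx₀
  let f : ContDiffBump x₀ := ⟨R / 4, R / 2, by positivity, by linarith⟩
  refine ⟨fun x => f x • X x, ?_, R / 4, by positivity,
    (Metric.ball_subset_ball (by linarith)).trans hball, ?_⟩
  · rw [contDiff_iff_contDiffAt]
    intro x
    by_cases hx : x ∈ U
    · exact f.contDiffAt.smul (hX.contDiffAt (hU.mem_nhds hx))
    · have h0 : (fun x => f x • X x) =ᶠ[𝓝 x] fun _ => 0 := by
        have hmem : (Metric.closedBall x₀ (R / 2))ᶜ ∈ 𝓝 x := by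
          refine Metric.isClosed_closedBall.isOpen_compl.mem_nhds fun h => hx (hball ?_)
          exact Metric.closedBall_subset_ball (by linarith) h
        filter_upwards [hmem] with y hy
        rw [f.zero_of_le_dist, zero_smul]
        simpa [f] using le_of_lt (by simpa using hy)
      exact contDiffAt_const.congr_of_eventuallyEq h0
  · intro x hx
    have : f x = 1 := f.one_of_mem_closedBall (Metric.ball_subset_closedBall hx)
    simp [this]

/-- A smooth vector field has a smooth local flow. -/
theorem exists_smooth_flow {X : F → F} {U : Set F} (hU : IsOpen U)
    (hX : ContDiffOn ℝ ∞ X U) {x₀ : F} (hx₀ : x₀ ∈ U) :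
    ∃ V : Set F, IsOpen V ∧ x₀ ∈ V ∧ ∃ δ > 0, ∃ Φ : F × ℝ → F,
      ContDiffOn ℝ ∞ Φ (V ×ˢ Ioo (-δ) δ) ∧ ∀ x ∈ V, Φ (x, 0) = x ∧
        ∀ t ∈ Ioo (-δ) δ, Φ (x, t) ∈ U ∧ HasDerivAt (fun s => Φ (x, s)) (X (Φ (x, t))) t := by
  have : CompleteSpace F := FiniteDimensional.complete ℝ F
  obtain ⟨Y, hY, r, hr, hrU, hYX⟩ := exists_smooth_global_extension hU hX hx₀
  let Yc : C(F, F) := ⟨Y, hY.continuous⟩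
  obtain ⟨ε, hε, a, b, L, K, hb, hpl⟩ :=
    IsPicardLindelof.of_contDiffAt_one (hY.contDiffAt (x := x₀) |>.of_le (by simp))
  obtain ⟨α, hα, hαc⟩ := (hpl 0).exists_forall_mem_closedBall_eq_hasDerivWithinAt_continuousOn
  simp only [zero_sub, zero_add] at hα hαc
  obtain ⟨e, hae, -, hef, hsymm⟩ := exists_smooth_local_inverse isOpen_univ
    (contDiff_flowDefect Yc hY).contDiffOn (mem_univ ((x₀, 0), constCLM x₀))
    (isInvertible_fderiv_flowDefect Yc hY x₀)
  obtain ⟨ρ, hρ, hρe⟩ := Metric.isOpen_iff.1 e.open_source _ hae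
  have hα0 : α (x₀, 0) = x₀ := (hα x₀ (Metric.mem_closedBall_self b.2)).1
  have hcont : ContinuousWithinAt α (Metric.closedBall x₀ b ×ˢ Icc (-ε) ε) (x₀, 0) :=
    hαc _ ⟨Metric.mem_closedBall_self b.2, by constructor <;> linarith⟩
  obtain ⟨δ₀, hδ₀, hδ₀α⟩ := Metric.continuousWithinAt_iff.1 hcont (min r (ρ / 2)) (by positivity)
  -- `δ₀` keeps the trajectories where `Y = X` and within `ρ / 2` of `x₀`, `ρ` keeps the parameters
  -- in the source of `e`, and `b`, `ε` are the space and time bounds of the Picard–Lindelöf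
  -- solution.
  let δ := min (min δ₀ ρ) (min (b : ℝ) ε)
  have hδ : 0 < δ := by positivity
  have hδ1 : δ ≤ δ₀ := (min_le_left _ _).trans (min_le_left _ _)
  have hδ2 : δ ≤ ρ := (min_le_left _ _).trans (min_le_right _ _)
  have hδ3 : δ ≤ b := (min_le_right _ _).trans (min_le_left _ _)
  have hδ4 : δ ≤ ε := (min_le_right _ _).trans (min_le_right _ _)
  have hmem : ∀ x ∈ Metric.ball x₀ δ, x ∈ Metric.closedBall x₀ b := fun x hx =>
    Metric.ball_subset_closedBall (Metric.ball_subset_ball hδ3 hx)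
  have hsmall : ∀ x ∈ Metric.ball x₀ δ, ∀ t ∈ Ioo (-δ) δ,
      dist (α (x, t)) x₀ < min r (ρ / 2) := by
    intro x hx t ht
    have := @hδ₀α (x, t) ⟨hmem x hx, by constructor <;> linarith [ht.1, ht.2]⟩ (by
      rw [Prod.dist_eq, max_lt_iff, Real.dist_0_eq_abs, abs_lt]
      exact ⟨lt_of_lt_of_le hx hδ1, by linarith [ht.1], by linarith [ht.2]⟩)
    rwa [hα0] at this
  have hder : ∀ x ∈ Metric.ball x₀ δ, ∀ t ∈ Ioo (-δ) δ,
      HasDerivAt (fun s => α (x, s)) (Y (α (x, t))) t := by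
    intro x hx t ht
    exact ((hα x (hmem x hx)).2 t (by constructor <;> linarith [ht.1, ht.2])).hasDerivAt
      (Icc_mem_nhds (by linarith [ht.1]) (by linarith [ht.2]))
  have hscale : ∀ t ∈ Ioo (-δ) δ, ∀ s ∈ Icc (0 : ℝ) 1, t * s ∈ Ioo (-δ) δ := by
    intro t ht s hs
    rw [mem_Ioo, ← abs_lt] at ht ⊢
    rw [abs_mul, abs_of_nonneg hs.1]
    nlinarith [abs_nonneg t, hs.2]
  -- The Picard–Lindelöf solution `α` is only known to be continuous. Its rescaled trajectory `s ↦ α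
  -- (x, t s)` is a zero of the integral equation, hence is produced by the smooth inverse of
  -- `flowDefect`; evaluation at `s = 1` exhibits `α` as smooth.
  have hcurve : ∀ x ∈ Metric.ball x₀ δ, ∀ t ∈ Ioo (-δ) δ, ((x, t), (0 : C(Icc (0 : ℝ) 1, F))) ∈ e.target ∧
      α (x, t) = (e.symm ((x, t), 0)).2 ⟨1, by simp⟩ := by
    intro x hx t ht
    have hd : ∀ s ∈ Icc (0 : ℝ) 1, HasDerivAt (fun s => α (x, t * s)) (t • Y (α (x, t * s))) s := by
      intro s hs
      have h1 := hder x hx _ (hscale t ht s hs)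
      have h2 : HasDerivAt (fun s : ℝ => t * s) t s := by
        simpa using (hasDerivAt_id s).const_mul t
      exact h1.scomp s h2
    have hc : ContinuousOn (fun s => α (x, t * s)) (Icc (0 : ℝ) 1) := fun s hs =>
      (hd s hs).continuousAt.continuousWithinAt
    let β : C(Icc (0 : ℝ) 1, F) := ⟨fun s => α (x, t * s), continuousOn_iff_continuous_domRestrict.1 hc⟩
    have hβ_apply : ∀ s, β s = α (x, t * s) := fun _ => rfl
    have hβ : β = constCLM x + t • primitiveCLM (Yc.comp β) := by
      ext s
      have hint : ∫ u in (0 : ℝ)..s, t • Y (α (x, t * u)) = α (x, t * s) - α (x, t * 0) := by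
        refine intervalIntegral.integral_eq_sub_of_hasDerivAt (fun u hu => hd u ?_) ?_
        · rw [uIcc_of_le s.2.1] at hu
          exact ⟨hu.1, hu.2.trans s.2.2⟩
        · refine ContinuousOn.intervalIntegrable ?_
          rw [uIcc_of_le s.2.1]
          exact (continuousOn_const.smul (hY.continuous.comp_continuousOn hc)).mono
            (Icc_subset_Icc_right s.2.2)
      rw [mul_zero, (hα x (hmem x hx)).1, intervalIntegral.integral_smul] at hint
      have hcongr : ∫ u in (0 : ℝ)..s, Y (α (x, t * u)) =
          ∫ u in (0 : ℝ)..s, (Yc.comp β) (projIcc 0 1 zero_le_one u) := by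
        refine intervalIntegral.integral_congr fun u hu => ?_
        rw [uIcc_of_le s.2.1] at hu
        have hu' : u ∈ Icc (0 : ℝ) 1 := ⟨hu.1, hu.2.trans s.2.2⟩
        rw [projIcc_of_mem zero_le_one hu']
        rfl
      rw [hcongr] at hint
      simp only [ContinuousMap.add_apply, constCLM_apply, ContinuousMap.smul_apply,
        primitiveCLM_apply, hint]
      rw [hβ_apply, add_sub_cancel]
    have hsrc : ((x, t), β) ∈ e.source := by
      refine hρe ?_
      rw [Metric.mem_ball, Prod.dist_eq, max_lt_iff, Prod.dist_eq, max_lt_iff, Real.dist_0_eq_abs,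
        abs_lt]
      refine ⟨⟨lt_of_lt_of_le hx hδ2, by linarith [ht.1], by linarith [ht.2]⟩, ?_⟩
      refine lt_of_le_of_lt ((ContinuousMap.dist_le (by positivity : 0 ≤ ρ / 2)).2 fun s => ?_)
        (half_lt_self hρ)
      exact (hsmall x hx _ (hscale t ht s s.2)).le.trans (min_le_right _ _)
    have himg : e ((x, t), β) = ((x, t), 0) := by
      rw [hef, flowDefect]
      refine Prod.ext rfl ?_
      change β - constCLM x - t • primitiveCLM (Yc.comp β) = 0
      rw [sub_sub, ← hβ, sub_self]
    refine ⟨himg ▸ e.map_source hsrc, ?_⟩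
    rw [← himg, e.left_inv hsrc]
    change _ = α (x, t * 1)
    rw [mul_one]
  refine ⟨Metric.ball x₀ δ, Metric.isOpen_ball, Metric.mem_ball_self hδ, δ, hδ, α, ?_, ?_⟩
  · have hev : ContDiff ℝ ∞ fun q : (F × ℝ) × C(Icc (0 : ℝ) 1, F) =>
        q.2 (⟨1, by simp⟩ : Icc (0 : ℝ) 1) :=
      (ContinuousLinearMap.contDiff
        (ContinuousMap.evalCLM (M := F) ℝ (⟨1, by simp⟩ : Icc (0 : ℝ) 1))).comp contDiff_snd
    have hin : ContDiff ℝ ∞ fun p : F × ℝ => (p, (0 : C(Icc (0 : ℝ) 1, F))) :=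
      contDiff_id.prodMk contDiff_const
    refine (hev.comp_contDiffOn (hsymm.comp hin.contDiffOn
      fun p hp => (hcurve p.1 hp.1 p.2 hp.2).1)).congr ?_
    rintro ⟨x, t⟩ hp
    exact (hcurve x hp.1 t hp.2).2
  · intro x hx
    refine ⟨(hα x (hmem x hx)).1, fun t ht => ?_⟩
    have hball : α (x, t) ∈ Metric.ball x₀ r := (hsmall x hx t ht).trans_le (min_le_left _ _)
    refine ⟨hrU hball, ?_⟩
    rw [← hYX hball]
    exact hder x hx t ht

end Flow

/-! ### The geodesic equation under a change of coordinates. -/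

section MetricCalculus

set_option synthInstance.maxHeartbeats 200000

variable {V : Type*} [NormedAddCommGroup V] [NormedSpace ℝ V]

/-- Christoffel symbols of the first kind of a field of bilinear forms. -/
def chr (B : V → V →L[ℝ] V →L[ℝ] ℝ) (y u v w : V) : ℝ :=
  (fderiv ℝ B y u v w + fderiv ℝ B y v u w - fderiv ℝ B y w u v) / 2

/-- The left-hand side of the geodesic equation, with the index lowered. -/
def geodExpr (B : V → V →L[ℝ] V →L[ℝ] ℝ) (c : ℝ → V) (t : ℝ) (w : V) : ℝ :=
  B (c t) (deriv (deriv c) t) w + chr B (c t) (deriv c t) (deriv c t) w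

/-- The pull-back of a field of bilinear forms. -/
def pullForm (B : V → V →L[ℝ] V →L[ℝ] ℝ) (φ : V → V) (x : V) : V →L[ℝ] V →L[ℝ] ℝ :=
  (B (φ x)).bilinearComp (fderiv ℝ φ x) (fderiv ℝ φ x)

@[simp] theorem pullForm_apply (B : V → V →L[ℝ] V →L[ℝ] ℝ) (φ : V → V) (x u w : V) :
    pullForm B φ x u w = B (φ x) (fderiv ℝ φ x u) (fderiv ℝ φ x w) := rfl

variable {B B₁ : V → V →L[ℝ] V →L[ℝ] ℝ} {φ : V → V}

theorem fderiv_apply₂ {x : V} (hB : DifferentiableAt ℝ B x) (a u w : V) :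
    fderiv ℝ (fun z => B z u w) x a = fderiv ℝ B x a u w := by
  have h := ((hB.hasFDerivAt.clm_apply (hasFDerivAt_const u x)).clm_apply
    (hasFDerivAt_const w x))
  rw [h.fderiv]
  simp

theorem fderiv_pullForm {x : V} (hB : DifferentiableAt ℝ B (φ x)) (hφ : ContDiffAt ℝ 2 φ x)
    (hB₁ : DifferentiableAt ℝ B₁ x) (hpull : B₁ =ᶠ[𝓝 x] pullForm B φ) (a u w : V) :
    fderiv ℝ B₁ x a u w =
      fderiv ℝ B (φ x) (fderiv ℝ φ x a) (fderiv ℝ φ x u) (fderiv ℝ φ x w)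
        + B (φ x) (fderiv ℝ (fderiv ℝ φ) x a u) (fderiv ℝ φ x w)
        + B (φ x) (fderiv ℝ φ x u) (fderiv ℝ (fderiv ℝ φ) x a w) := by
  have hd : HasFDerivAt φ (fderiv ℝ φ x) x := (hφ.differentiableAt (by simp)).hasFDerivAt
  have hdd : HasFDerivAt (fderiv ℝ φ) (fderiv ℝ (fderiv ℝ φ) x) x :=
    ((hφ.fderiv_right (m := 1) (by norm_num)).differentiableAt (by simp)).hasFDerivAt
  have hev : (fun z => B₁ z u w) =ᶠ[𝓝 x] fun z => B (φ z) (fderiv ℝ φ z u) (fderiv ℝ φ z w) := by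
    filter_upwards [hpull] with z hz
    rw [hz, pullForm_apply]
  rw [← fderiv_apply₂ hB₁, hev.fderiv_eq]
  have h0 : HasFDerivAt (fun z => B (φ z)) ((fderiv ℝ B (φ x)).comp (fderiv ℝ φ x)) x :=
    HasFDerivAt.comp (G := V →L[ℝ] V →L[ℝ] ℝ) (g := B) x hB.hasFDerivAt hd
  have hu : HasFDerivAt (fun z => fderiv ℝ φ z u) _ x := hdd.clm_apply (hasFDerivAt_const u x)
  have hw : HasFDerivAt (fun z => fderiv ℝ φ z w) _ x := hdd.clm_apply (hasFDerivAt_const w x)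
  have h1 : HasFDerivAt (fun z => B (φ z) (fderiv ℝ φ z u)) _ x := h0.clm_apply hu
  have h2 : HasFDerivAt (fun z => B (φ z) (fderiv ℝ φ z u) (fderiv ℝ φ z w)) _ x := h1.clm_apply hw
  rw [h2.fderiv]
  simp
  ring

/-- Of the six terms containing second derivatives of `φ`, four cancel in pairs and the other two
are equal, by symmetry of `B` and of the second derivative. -/
theorem chr_pullForm {x : V} (hB : DifferentiableAt ℝ B (φ x)) (hφ : ContDiffAt ℝ 2 φ x)
    (hB₁ : DifferentiableAt ℝ B₁ x) (hpull : B₁ =ᶠ[𝓝 x] pullForm B φ)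
    (hsymm : ∀ u w, B (φ x) u w = B (φ x) w u) (u v w : V) :
    chr B₁ x u v w = chr B (φ x) (fderiv ℝ φ x u) (fderiv ℝ φ x v) (fderiv ℝ φ x w)
      + B (φ x) (fderiv ℝ (fderiv ℝ φ) x u v) (fderiv ℝ φ x w) := by
  have hs : ∀ a b, fderiv ℝ (fderiv ℝ φ) x a b = fderiv ℝ (fderiv ℝ φ) x b a := fun a b =>
    (hφ.isSymmSndFDerivAt (by simp)).eq a b
  simp only [chr, fderiv_pullForm hB hφ hB₁ hpull]
  rw [hs v u, hs w u, hs w v, hsymm (fderiv ℝ φ x u) (fderiv ℝ (fderiv ℝ φ) x v w),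
    hsymm (fderiv ℝ φ x v) (fderiv ℝ (fderiv ℝ φ) x u w)]
  ring

theorem deriv_comp_curve {c : ℝ → V} {t : ℝ} (hφ : ContDiffAt ℝ 2 φ (c t))
    (hc : ContDiffAt ℝ 2 c t) :
    (deriv fun s => φ (c s)) =ᶠ[𝓝 t] fun s => fderiv ℝ φ (c s) (deriv c s) := by
  have h1 : ∀ᶠ s in 𝓝 t, ContDiffAt ℝ 2 φ (c s) :=
    hc.continuousAt.eventually (hφ.eventually (by simp))
  filter_upwards [h1, hc.eventually (by simp)] with s hs hs'
  exact ((hs.differentiableAt (by simp)).hasFDerivAt.comp_hasDerivAt s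
    (hs'.differentiableAt (by simp)).hasDerivAt).deriv

/-- The inhomogeneous term of `chr_pullForm` is exactly the second-order term that the chain rule
produces in the acceleration of `φ ∘ c`; the geodesic equation is therefore tensorial. -/
theorem geodExpr_pullForm {c : ℝ → V} {t : ℝ} (hB : DifferentiableAt ℝ B (φ (c t)))
    (hφ : ContDiffAt ℝ 2 φ (c t)) (hB₁ : DifferentiableAt ℝ B₁ (c t))
    (hpull : B₁ =ᶠ[𝓝 (c t)] pullForm B φ) (hsymm : ∀ u w, B (φ (c t)) u w = B (φ (c t)) w u)
    (hc : ContDiffAt ℝ 2 c t) (w : V) :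
    geodExpr B₁ c t w = geodExpr B (fun s => φ (c s)) t (fderiv ℝ φ (c t) w) := by
  have h1 := deriv_comp_curve hφ hc
  have hdd : HasFDerivAt (fderiv ℝ φ) (fderiv ℝ (fderiv ℝ φ) (c t)) (c t) :=
    ((hφ.fderiv_right (m := 1) (by norm_num)).differentiableAt (by simp)).hasFDerivAt
  have hcd : HasDerivAt c (deriv c t) t := (hc.differentiableAt (by simp)).hasDerivAt
  have hcdd : HasDerivAt (deriv c) (deriv (deriv c) t) t := by
    have h : ContDiffAt ℝ 1 (fderiv ℝ c) t := hc.fderiv_right (m := 1) (by norm_num)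
    have h' : DifferentiableAt ℝ (fun s => fderiv ℝ c s 1) t :=
      (h.differentiableAt (by simp)).clm_apply (differentiableAt_const _)
    exact DifferentiableAt.hasDerivAt h'
  have h2 : deriv (deriv fun s => φ (c s)) t =
      fderiv ℝ (fderiv ℝ φ) (c t) (deriv c t) (deriv c t)
        + fderiv ℝ φ (c t) (deriv (deriv c) t) := by
    rw [h1.deriv_eq]
    exact ((hdd.comp_hasDerivAt t hcd).clm_apply hcdd).deriv
  simp only [geodExpr]
  rw [h2, h1.eq_of_nhds, chr_pullForm hB hφ hB₁ hpull hsymm, hpull.eq_of_nhds]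
  simp
  ring

theorem geodExpr_congr {c c' : ℝ → V} {t : ℝ} (h : c =ᶠ[𝓝 t] c') (w : V) :
    geodExpr B c t w = geodExpr B c' t w := by
  simp only [geodExpr]
  rw [h.deriv.deriv_eq, h.deriv_eq, h.eq_of_nhds]

end MetricCalculus

/-! ### Metrics pulled back by parametrizations. -/

section Pull

variable {m : ℕ} {M : Type*} [TopologicalSpace M]
  [ChartedSpace (EuclideanSpace ℝ (Fin m)) M] [IsManifold (𝓡 m) ∞ M]

local notation "𝔼" m => EuclideanSpace ℝ (Fin m)

/-- The bilinear form at a point, with the tangent space identified with the model space. -/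
def form (g : RiemMetric m M) (Q : M) : (𝔼 m) →L[ℝ] (𝔼 m) →L[ℝ] ℝ := g.inner Q

/-- The differential of a parametrization. -/
def dpar (f : (𝔼 m) → M) (x : 𝔼 m) : (𝔼 m) →L[ℝ] (𝔼 m) := mfderiv (𝓡 m) (𝓡 m) f x

/-- The metric pulled back by a parametrization. -/
def pull (g : RiemMetric m M) (f : (𝔼 m) → M) (x : 𝔼 m) : (𝔼 m) →L[ℝ] (𝔼 m) →L[ℝ] ℝ :=
  (form g (f x)).bilinearComp (dpar f x) (dpar f x)

theorem pull_apply (g : RiemMetric m M) (f : (𝔼 m) → M) (x u w : 𝔼 m) :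
    pull g f x u w = form g (f x) (dpar f x u) (dpar f x w) := rfl

theorem form_symm (g : RiemMetric m M) (Q : M) (u w : 𝔼 m) : form g Q u w = form g Q w u :=
  g.symm Q u w

theorem form_pos (g : RiemMetric m M) (Q : M) {u : 𝔼 m} (hu : u ≠ 0) : 0 < form g Q u u :=
  g.pos Q u hu

theorem pull_symm (g : RiemMetric m M) (f : (𝔼 m) → M) (x u w : 𝔼 m) :
    pull g f x u w = pull g f x w u := form_symm g _ _ _

theorem contDiffAt_pull_apply (g : RiemMetric m M) {f : (𝔼 m) → M} {x : 𝔼 m}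
    (hf : ContMDiffAt (𝓡 m) (𝓡 m) ∞ f x) (u w : 𝔼 m) :
    ContDiffAt ℝ ∞ (fun x => pull g f x u w) x := by
  have hv : ∀ v : 𝔼 m, ContMDiffAt (𝓡 m) (𝓡 m).tangent ∞
      (fun x => (TotalSpace.mk' (𝔼 m) (f x) (mfderiv (𝓡 m) (𝓡 m) f x v) :
        TangentBundle (𝓡 m) M)) x := by
    intro v
    have hϕ := ContMDiffAt.mfderiv_const (m := ∞) hf (by simp)
    have hv : ContMDiffAt (𝓡 m) (𝓡 m).tangent ∞
        (fun x : 𝔼 m => (TotalSpace.mk' (𝔼 m) x v : TangentBundle (𝓡 m) (𝔼 m))) x :=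
      contMDiffAt_vectorSpace_iff_contDiffAt.2 contDiffAt_const
    exact ContMDiffAt.clm_apply_of_inCoordinates hϕ hv hf
  have hg : ContMDiffAt (𝓡 m) ((𝓡 m).prod 𝓘(ℝ, (𝔼 m) →L[ℝ] (𝔼 m) →L[ℝ] ℝ)) ∞
      (fun x => TotalSpace.mk' ((𝔼 m) →L[ℝ] (𝔼 m) →L[ℝ] ℝ)
        (E := fun Q : M => TangentSpace (𝓡 m) Q →L[ℝ] TangentSpace (𝓡 m) Q →L[ℝ] ℝ)
        (f x) (g.inner (f x))) x := ContMDiffAt.comp x g.contMDiff.contMDiffAt hf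
  have h : ContMDiffAt (𝓡 m) ((𝓡 m).prod 𝓘(ℝ, ℝ)) ∞
      (fun x => TotalSpace.mk' ℝ (E := Bundle.Trivial M ℝ) (f x)
        (g.inner (f x) (mfderiv (𝓡 m) (𝓡 m) f x u) (mfderiv (𝓡 m) (𝓡 m) f x w))) x := by
    apply ContMDiffAt.clm_bundle_apply₂ (F₁ := 𝔼 m) (F₂ := 𝔼 m)
    · exact hg
    · exact hv u
    · exact hv w
  rw [contMDiffAt_totalSpace] at h
  exact contMDiffAt_iff_contDiffAt.1 h.2

end Pull

theorem two_le_infty : (2 : WithTop ℕ∞) ≤ ((⊤ : ℕ∞) : WithTop ℕ∞) := by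
  have h : ((2 : ℕ∞) : WithTop ℕ∞) ≤ ((⊤ : ℕ∞) : WithTop ℕ∞) := WithTop.coe_le_coe.2 le_top
  exact h

/-! ### Independence of the geodesic equation from the chart. -/

section Param

variable {m : ℕ} {M : Type*} [TopologicalSpace M]
  [ChartedSpace (EuclideanSpace ℝ (Fin m)) M] [IsManifold (𝓡 m) ∞ M]

local notation "𝔼" m => EuclideanSpace ℝ (Fin m)

theorem contDiffOn_pull (g : RiemMetric m M) {f : (𝔼 m) → M} {U : Set (𝔼 m)} (hU : IsOpen U)
    (hf : ContMDiffOn (𝓡 m) (𝓡 m) ∞ f U) : ContDiffOn ℝ ∞ (pull g f) U := by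
  rw [contDiffOn_clm_apply]
  intro u
  rw [contDiffOn_clm_apply]
  intro w x hx
  exact (contDiffAt_pull_apply g (hf.contMDiffAt (hU.mem_nhds hx)) u w).contDiffWithinAt

theorem dpar_congr {f f' : (𝔼 m) → M} {x : 𝔼 m} (h : f =ᶠ[𝓝 x] f') : dpar f x = dpar f' x :=
  h.mfderiv_eq

theorem pull_congr (g : RiemMetric m M) {f f' : (𝔼 m) → M} {x : 𝔼 m} (h : f =ᶠ[𝓝 x] f') :
    pull g f x = pull g f' x := by
  rw [pull, pull, dpar_congr h, h.eq_of_nhds]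

theorem dpar_comp {f : (𝔼 m) → M} {φ : (𝔼 m) → 𝔼 m} {x : 𝔼 m}
    (hf : MDifferentiableAt (𝓡 m) (𝓡 m) f (φ x)) (hφ : DifferentiableAt ℝ φ x) :
    dpar (f ∘ φ) x = (dpar f (φ x)).comp (fderiv ℝ φ x) := by
  have h := mfderiv_comp x hf hφ.mdifferentiableAt
  rw [mfderiv_eq_fderiv] at h
  exact h

theorem pull_comp (g : RiemMetric m M) {f : (𝔼 m) → M} {φ : (𝔼 m) → 𝔼 m} {x : 𝔼 m}
    (hf : MDifferentiableAt (𝓡 m) (𝓡 m) f (φ x)) (hφ : DifferentiableAt ℝ φ x) :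
    pull g (f ∘ φ) x = pullForm (pull g f) φ x := by
  ext u w
  rw [pull_apply, dpar_comp hf hφ]
  rfl

/-- A smooth parametrization of `M` on the open set `U`, with injective differential. -/
structure IsParam (f : (𝔼 m) → M) (U : Set (𝔼 m)) : Prop where
  isOpen : IsOpen U
  contMDiffOn : ContMDiffOn (𝓡 m) (𝓡 m) ∞ f U
  injective : ∀ x ∈ U, Function.Injective (dpar f x)

namespace IsParam

variable {f : (𝔼 m) → M} {U : Set (𝔼 m)}

theorem mdifferentiableAt (h : IsParam f U) {x : 𝔼 m} (hx : x ∈ U) :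
    MDifferentiableAt (𝓡 m) (𝓡 m) f x :=
  (h.contMDiffOn.contMDiffAt (h.isOpen.mem_nhds hx)).mdifferentiableAt (by simp)

theorem continuousAt (h : IsParam f U) {x : 𝔼 m} (hx : x ∈ U) : ContinuousAt f x :=
  (h.mdifferentiableAt hx).continuousAt

theorem pull_pos (h : IsParam f U) (g : RiemMetric m M) {x : 𝔼 m} (hx : x ∈ U) {u : 𝔼 m}
    (hu : u ≠ 0) : 0 < pull g f x u u :=
  form_pos g _ fun h0 => hu (h.injective x hx (h0.trans (map_zero _).symm))

theorem differentiableAt_pull (h : IsParam f U) (g : RiemMetric m M) {x : 𝔼 m} (hx : x ∈ U) :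
    DifferentiableAt ℝ (pull g f) x :=
  ((contDiffOn_pull g h.isOpen h.contMDiffOn).contDiffAt (h.isOpen.mem_nhds hx)).differentiableAt
    (by simp)

end IsParam

/-- The coordinate map of the preferred chart at `p`. -/
abbrev coord (m : ℕ) {M : Type*} [TopologicalSpace M]
    [ChartedSpace (EuclideanSpace ℝ (Fin m)) M] (p : M) : M → 𝔼 m := extChartAt (𝓡 m) p

/-- The inverse of the coordinate map of the preferred chart at `p`. -/
abbrev coordInv (m : ℕ) {M : Type*} [TopologicalSpace M]
    [ChartedSpace (EuclideanSpace ℝ (Fin m)) M] (p : M) : (𝔼 m) → M := (extChartAt (𝓡 m) p).symm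

theorem contMDiffOn_coord (p : M) :
    ContMDiffOn (𝓡 m) (𝓡 m) ∞ (coord m p) (chartAt (𝔼 m) p).source :=
  contMDiffOn_extChartAt

theorem isOpen_coord_target (p : M) : IsOpen (extChartAt (𝓡 m) p).target :=
  isOpen_extChartAt_target p

theorem isParam_coordInv (p : M) : IsParam (coordInv m p) (extChartAt (𝓡 m) p).target := by
  refine ⟨isOpen_coord_target p, contMDiffOn_extChartAt_symm p, fun y hy => ?_⟩
  have h := isInvertible_mfderivWithin_extChartAt_symm (I := 𝓡 m) hy
  rw [ModelWithCorners.range_eq_univ, mfderivWithin_univ] at h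
  exact h.injective

/-- The geodesic equation at time `t`, in the chart at the point `γ t`. -/
def GeodAt (g : RiemMetric m M) (γ : ℝ → M) (t : ℝ) : Prop :=
  ∀ w : 𝔼 m, geodExpr (pull g (coordInv m (γ t))) (fun τ => coord m (γ t) (γ τ)) t w = 0

theorem fderiv_coord_comp_injective {f : (𝔼 m) → M} {U : Set (𝔼 m)} (h : IsParam f U)
    {x : 𝔼 m} (hx : x ∈ U) {φ : (𝔼 m) → 𝔼 m} {f' : (𝔼 m) → M} (hφ : DifferentiableAt ℝ φ x)
    (hf' : MDifferentiableAt (𝓡 m) (𝓡 m) f' (φ x)) (heq : f =ᶠ[𝓝 x] f' ∘ φ) :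
    Function.Injective (fderiv ℝ φ x) := by
  intro u v huv
  refine h.injective x hx ?_
  rw [dpar_congr heq, dpar_comp hf' hφ]
  exact congrArg (dpar f' (φ x)) huv

/-- A parametrization read in a chart. -/
theorem exists_coord_comp {f : (𝔼 m) → M} {U : Set (𝔼 m)} (h : IsParam f U) {x : 𝔼 m}
    (hx : x ∈ U) {p : M} (hp : f x ∈ (chartAt (𝔼 m) p).source) :
    ∃ U' ⊆ U, x ∈ U' ∧ IsOpen U' ∧ MapsTo f U' (chartAt (𝔼 m) p).source ∧
      ContDiffOn ℝ ∞ (coord m p ∘ f) U' ∧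
      (∀ z ∈ U', (coord m p ∘ f) z ∈ (extChartAt (𝓡 m) p).target) ∧
      (∀ z ∈ U', f =ᶠ[𝓝 z] coordInv m p ∘ (coord m p ∘ f)) ∧
      ∀ z ∈ U', Function.Bijective (fderiv ℝ (coord m p ∘ f) z) := by
  let U' := U ∩ f ⁻¹' (chartAt (𝔼 m) p).source
  have hU' : IsOpen U' := h.contMDiffOn.continuousOn.isOpen_inter_preimage h.isOpen
    (chartAt (𝔼 m) p).open_source
  have hmaps : MapsTo f U' (chartAt (𝔼 m) p).source := fun z hz => hz.2
  have hsm : ContDiffOn ℝ ∞ (coord m p ∘ f) U' := by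
    rw [← contMDiffOn_iff_contDiffOn]
    exact (contMDiffOn_coord p).comp (h.contMDiffOn.mono inter_subset_left) hmaps
  have htar : ∀ z ∈ U', (coord m p ∘ f) z ∈ (extChartAt (𝓡 m) p).target := fun z hz =>
    (extChartAt (𝓡 m) p).map_source (by rw [extChartAt_source]; exact hz.2)
  have hev : ∀ z ∈ U', f =ᶠ[𝓝 z] coordInv m p ∘ (coord m p ∘ f) := by
    intro z hz
    filter_upwards [hU'.mem_nhds hz] with y hy
    exact ((extChartAt (𝓡 m) p).left_inv (by rw [extChartAt_source]; exact hy.2)).symm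
  refine ⟨U', inter_subset_left, ⟨hx, hp⟩, hU', hmaps, hsm, htar, hev, fun z hz => ?_⟩
  have hinj := fderiv_coord_comp_injective h hz.1
    ((hsm.contDiffAt (hU'.mem_nhds hz)).differentiableAt (by simp))
    ((isParam_coordInv p).mdifferentiableAt (htar z hz)) (hev z hz)
  exact ⟨hinj, LinearMap.injective_iff_surjective.1 hinj⟩

/-- The geodesic equation can be checked in any parametrization. -/
theorem geodAt_iff (g : RiemMetric m M) {f : (𝔼 m) → M} {U : Set (𝔼 m)} (h : IsParam f U)
    {c : ℝ → 𝔼 m} {t : ℝ} (hct : c t ∈ U) (hc : ContDiffAt ℝ 2 c t) {γ : ℝ → M}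
    (hγ : γ =ᶠ[𝓝 t] fun s => f (c s)) :
    GeodAt g γ t ↔ ∀ w, geodExpr (pull g f) c t w = 0 := by
  have hγt : γ t = f (c t) := hγ.eq_of_nhds
  obtain ⟨U', hU'U, hxU', hU', hmaps, hsm, htar, hev, hbij⟩ :=
    exists_coord_comp h hct (p := γ t) (by rw [hγt]; exact mem_chart_source _ _)
  set φ : (𝔼 m) → 𝔼 m := coord m (γ t) ∘ f with hφdef
  have hφ : ContDiffAt ℝ 2 φ (c t) := (hsm.contDiffAt (hU'.mem_nhds hxU')).of_le two_le_infty
  have hB := (isParam_coordInv (γ t)).differentiableAt_pull g (htar _ hxU')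
  -- Near `c t` the parametrization is the inverse chart composed with `φ`, so the two coordinate
  -- expressions of the metric are related by pull-back along `φ`.
  have hpull : pull g f =ᶠ[𝓝 (c t)] pullForm (pull g (coordInv m (γ t))) φ := by
    filter_upwards [hU'.mem_nhds hxU'] with z hz
    rw [pull_congr g (hev z hz)]
    exact pull_comp g ((isParam_coordInv (γ t)).mdifferentiableAt (htar z hz))
      ((hsm.contDiffAt (hU'.mem_nhds hz)).differentiableAt (by simp))
  have key : ∀ w, geodExpr (pull g f) c t w =
      geodExpr (pull g (coordInv m (γ t))) (fun τ => coord m (γ t) (γ τ)) t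
        (fderiv ℝ φ (c t) w) := by
    intro w
    rw [geodExpr_pullForm hB hφ (h.differentiableAt_pull g hct) hpull
      (fun u v => pull_symm g _ _ u v) hc]
    refine geodExpr_congr ?_ _
    filter_upwards [hγ] with s hs
    rw [hs]
    rfl
  constructor
  · intro hg w
    rw [key]
    exact hg _
  · intro hw w
    obtain ⟨w, rfl⟩ := (hbij _ hxU').2 w
    rw [← key]
    exact hw w

theorem christoffel_eq_chr (g : RiemMetric m M) (p : M) {y : 𝔼 m}
    (hy : y ∈ (extChartAt (𝓡 m) p).target) (u v w : 𝔼 m) :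
    christoffel g p y u v w = chr (pull g (coordInv m p)) y u v w := by
  have h := (isParam_coordInv p).differentiableAt_pull g hy
  rw [chr, ← fderiv_apply₂ h, ← fderiv_apply₂ h, ← fderiv_apply₂ h]
  rfl

theorem isGeodesicOn_iff (g : RiemMetric m M) (γ : ℝ → M) (s : Set ℝ) :
    IsGeodesicOn g γ s ↔ ContMDiffOn 𝓘(ℝ, ℝ) (𝓡 m) 2 γ s ∧ ∀ t ∈ s, GeodAt g γ t := by
  refine and_congr_right fun _ => forall₂_congr fun t _ => forall_congr' fun w => ?_
  have hy : coord m (γ t) (γ t) ∈ (extChartAt (𝓡 m) (γ t)).target := mem_extChartAt_target _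
  simp only [geodExpr]
  rw [← christoffel_eq_chr g (γ t) hy]
  rfl

theorem contMDiffAt_param_comp {f : (𝔼 m) → M} {U : Set (𝔼 m)} (h : IsParam f U)
    {c : ℝ → 𝔼 m} {t : ℝ} (hct : c t ∈ U) (hc : ContDiffAt ℝ 2 c t) :
    ContMDiffAt 𝓘(ℝ, ℝ) (𝓡 m) 2 (fun s => f (c s)) t :=
  ((h.contMDiffOn.contMDiffAt (h.isOpen.mem_nhds hct)).of_le two_le_infty).comp t
    (contMDiffAt_iff_contDiffAt.2 hc)

/-- A curve with the geodesic equation in a parametrization is a geodesic. -/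
theorem isGeodesicOn_of_param (g : RiemMetric m M) {γ : ℝ → M} {s : Set ℝ}
    (hloc : ∀ t ∈ s, ∃ f U, ∃ c : ℝ → 𝔼 m, IsParam f U ∧ c t ∈ U ∧ ContDiffAt ℝ 2 c t ∧
      (γ =ᶠ[𝓝 t] fun s => f (c s)) ∧ ∀ w, geodExpr (pull g f) c t w = 0) :
    IsGeodesicOn g γ s := by
  rw [isGeodesicOn_iff]
  refine ⟨fun t ht => ?_, fun t ht => ?_⟩
  · obtain ⟨f, U, c, hf, hct, hc, hγ, -⟩ := hloc t ht
    exact ((contMDiffAt_param_comp hf hct hc).congr_of_eventuallyEq hγ).contMDiffWithinAt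
  · obtain ⟨f, U, c, hf, hct, hc, hγ, hw⟩ := hloc t ht
    exact (geodAt_iff g hf hct hc hγ).2 hw

theorem IsGeodesicOn.contDiffAt_coord {g : RiemMetric m M} {γ : ℝ → M} {s : Set ℝ}
    (h : IsGeodesicOn g γ s) (hs : IsOpen s) {t : ℝ} (ht : t ∈ s) {p : M}
    (hp : γ t ∈ (chartAt (𝔼 m) p).source) : ContDiffAt ℝ 2 (fun τ => coord m p (γ τ)) t := by
  rw [← contMDiffAt_iff_contDiffAt]
  exact (((contMDiffOn_coord p).contMDiffAt
    ((chartAt (𝔼 m) p).open_source.mem_nhds hp)).of_le two_le_infty).comp t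
    (h.1.contMDiffAt (hs.mem_nhds ht))

theorem IsGeodesicOn.continuousAt {g : RiemMetric m M} {γ : ℝ → M} {s : Set ℝ}
    (h : IsGeodesicOn g γ s) (hs : IsOpen s) {t : ℝ} (ht : t ∈ s) : ContinuousAt γ t :=
  (h.1.contMDiffAt (hs.mem_nhds ht)).continuousAt

theorem IsGeodesicOn.geodExpr_coord {g : RiemMetric m M} {γ : ℝ → M} {s : Set ℝ}
    (h : IsGeodesicOn g γ s) (hs : IsOpen s) {t : ℝ} (ht : t ∈ s) {p : M}
    (hp : γ t ∈ (chartAt (𝔼 m) p).source) (w : 𝔼 m) :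
    geodExpr (pull g (coordInv m p)) (fun τ => coord m p (γ τ)) t w = 0 := by
  have hev : γ =ᶠ[𝓝 t] fun τ => coordInv m p (coord m p (γ τ)) := by
    filter_upwards [(h.continuousAt hs ht).preimage_mem_nhds
      ((chartAt (𝔼 m) p).open_source.mem_nhds hp)] with τ hτ
    exact ((extChartAt (𝓡 m) p).left_inv (by rw [extChartAt_source]; exact hτ)).symm
  refine (geodAt_iff g (isParam_coordInv p) ((extChartAt (𝓡 m) p).map_source
    (by rw [extChartAt_source]; exact hp)) (h.contDiffAt_coord hs ht hp) hev).1 ?_ w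
  exact ((isGeodesicOn_iff g γ s).1 h).2 t ht

end Param

/-! ### The geodesic equation as a first-order system, and local uniqueness. -/

section Spray

set_option synthInstance.maxHeartbeats 200000

variable {V : Type*} [NormedAddCommGroup V] [NormedSpace ℝ V] [FiniteDimensional ℝ V]
  {B : V → V →L[ℝ] V →L[ℝ] ℝ}

theorem isInvertible_of_posDef {b : V →L[ℝ] V →L[ℝ] ℝ} (hb : ∀ u, u ≠ 0 → 0 < b u u) :
    b.IsInvertible := by
  have hinj : Function.Injective (b : V →ₗ[ℝ] V →L[ℝ] ℝ) := by
    rw [injective_iff_map_eq_zero]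
    intro u hu
    by_contra h
    have h1 := hb u h
    have h2 : b u = 0 := hu
    rw [h2] at h1
    simp at h1
  have hdim : Module.finrank ℝ V = Module.finrank ℝ (V →L[ℝ] ℝ) := by
    rw [← (LinearMap.toContinuousLinearMap (𝕜 := ℝ) (E := V) (F' := ℝ)).finrank_eq]
    exact Subspace.dual_finrank_eq.symm
  refine ⟨((b : V →ₗ[ℝ] V →L[ℝ] ℝ).linearEquivOfInjective hinj hdim).toContinuousLinearEquiv, ?_⟩
  ext u w
  rfl

/-- The quadratic Christoffel term as a linear form. -/
def chrForm (B : V → V →L[ℝ] V →L[ℝ] ℝ) (y v : V) : V →L[ℝ] ℝ :=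
  fderiv ℝ B y v v - (2⁻¹ : ℝ) • ((fderiv ℝ B y).flip v).flip v

theorem chrForm_apply (y v w : V) : chrForm B y v w = chr B y v v w := by
  simp only [chrForm, chr, sub_apply, smul_apply,
    ContinuousLinearMap.flip_apply, smul_eq_mul]
  ring

/-- The acceleration prescribed by the geodesic equation. -/
def acc (B : V → V →L[ℝ] V →L[ℝ] ℝ) (z : V × V) : V :=
  -(B z.1).inverse (chrForm B z.1 z.2)

/-- Raising the index with the inverse of the form turns the lowered equation into an explicit
formula for the acceleration. -/
theorem geodExpr_eq_zero_iff {c : ℝ → V} {t : ℝ} (hB : (B (c t)).IsInvertible) :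
    (∀ w, geodExpr B c t w = 0) ↔ deriv (deriv c) t = acc B (c t, deriv c t) := by
  have h1 : (∀ w, geodExpr B c t w = 0) ↔
      B (c t) (deriv (deriv c) t) = -chrForm B (c t) (deriv c t) := by
    rw [ContinuousLinearMap.ext_iff]
    refine forall_congr' fun w => ?_
    rw [neg_apply, chrForm_apply, geodExpr, eq_neg_iff_add_eq_zero]
  obtain ⟨e, he⟩ := hB
  rw [h1, acc, ← he, ContinuousLinearMap.inverse_equiv, ← map_neg]
  exact e.eq_symm_apply.symm

theorem contDiffOn_acc {U : Set V} (hU : IsOpen U) (hB : ContDiffOn ℝ ∞ B U)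
    (hinv : ∀ y ∈ U, (B y).IsInvertible) : ContDiffOn ℝ ∞ (acc B) (U ×ˢ univ) := by
  have hfst : ContDiffOn ℝ ∞ (Prod.fst : V × V → V) (U ×ˢ univ) := contDiff_fst.contDiffOn
  have hsnd : ContDiffOn ℝ ∞ (Prod.snd : V × V → V) (U ×ˢ univ) := contDiff_snd.contDiffOn
  have hmaps : MapsTo (Prod.fst : V × V → V) (U ×ˢ univ) U := fun z hz => hz.1
  have h1 : ContDiffOn ℝ ∞ (fun z : V × V => (B z.1).inverse) (U ×ˢ univ) := by
    have : ContDiffOn ℝ ∞ (fun y => (B y).inverse) U := by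
      intro y hy
      obtain ⟨e, he⟩ := hinv y hy
      have h2 : ContDiffAt ℝ ∞ ContinuousLinearMap.inverse (B y) := by
        rw [← he]; exact contDiffAt_map_inverse e
      exact (h2.comp y (hB.contDiffAt (hU.mem_nhds hy))).contDiffWithinAt
    exact this.comp hfst hmaps
  have h2 := (hB.fderiv_of_isOpen (m := ∞) hU (by simp)).comp hfst hmaps
  have h3 : ContDiffOn ℝ ∞ (fun z : V × V => chrForm B z.1 z.2) (U ×ˢ univ) := by
    rw [contDiffOn_clm_apply]
    intro w
    have h4 : ∀ a b c : V × V → V, ContDiffOn ℝ ∞ a (U ×ˢ univ) → ContDiffOn ℝ ∞ b (U ×ˢ univ) →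
        ContDiffOn ℝ ∞ c (U ×ˢ univ) →
        ContDiffOn ℝ ∞ (fun z => fderiv ℝ B z.1 (a z) (b z) (c z)) (U ×ˢ univ) :=
      fun a b c ha hb hc => ((h2.clm_apply ha).clm_apply hb).clm_apply hc
    have h5 := ((h4 _ _ _ hsnd hsnd (contDiffOn_const (c := w))).add
      (h4 _ _ _ hsnd hsnd (contDiffOn_const (c := w)))).sub
      (h4 _ _ _ (contDiffOn_const (c := w)) hsnd hsnd)
    refine (h5.div_const 2).congr fun z _ => ?_
    rw [chrForm_apply, chr]
  exact (h1.clm_apply h3).neg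

/-- The second-order equation as a vector field. -/
def spray (B : V → V →L[ℝ] V →L[ℝ] ℝ) (z : V × V) : V × V := (z.2, acc B z)

theorem contDiffOn_spray {U : Set V} (hU : IsOpen U) (hB : ContDiffOn ℝ ∞ B U)
    (hinv : ∀ y ∈ U, (B y).IsInvertible) : ContDiffOn ℝ ∞ (spray B) (U ×ˢ univ) :=
  contDiff_snd.contDiffOn.prodMk (contDiffOn_acc hU hB hinv)

theorem ContDiffAt.hasDerivAt_deriv {c : ℝ → V} {t : ℝ} (hc : ContDiffAt ℝ 2 c t) :
    HasDerivAt (deriv c) (deriv (deriv c) t) t := by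
  have h : ContDiffAt ℝ 1 (fderiv ℝ c) t := hc.fderiv_right (m := 1) (by norm_num)
  have h' : DifferentiableAt ℝ (fun s => fderiv ℝ c s 1) t :=
    (h.differentiableAt (by simp)).clm_apply (differentiableAt_const _)
  exact DifferentiableAt.hasDerivAt h'

theorem hasDerivAt_spray {U : Set V} (hinv : ∀ y ∈ U, (B y).IsInvertible) {c : ℝ → V} {t : ℝ}
    (hct : c t ∈ U) (hc : ContDiffAt ℝ 2 c t) (hg : ∀ w, geodExpr B c t w = 0) :
    HasDerivAt (fun s => (c s, deriv c s)) (spray B (c t, deriv c t)) t := by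
  have h := (hc.differentiableAt (by simp)).hasDerivAt.prodMk (ContDiffAt.hasDerivAt_deriv hc)
  rw [(geodExpr_eq_zero_iff (hinv _ hct)).1 hg] at h
  exact h

/-- Local uniqueness of solutions of the geodesic equation. -/
theorem eventuallyEq_of_geodExpr {U : Set V} (hU : IsOpen U) (hB : ContDiffOn ℝ ∞ B U)
    (hinv : ∀ y ∈ U, (B y).IsInvertible) {c₁ c₂ : ℝ → V} {t : ℝ} (hct : c₁ t ∈ U)
    (h₁ : ∀ᶠ s in 𝓝 t, ContDiffAt ℝ 2 c₁ s ∧ ∀ w, geodExpr B c₁ s w = 0)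
    (h₂ : ∀ᶠ s in 𝓝 t, ContDiffAt ℝ 2 c₂ s ∧ ∀ w, geodExpr B c₂ s w = 0)
    (h0 : c₁ t = c₂ t) (h0' : deriv c₁ t = deriv c₂ t) : c₁ =ᶠ[𝓝 t] c₂ := by
  have hX : ContDiffAt ℝ 1 (spray B) (c₁ t, deriv c₁ t) :=
    ((contDiffOn_spray hU hB hinv).contDiffAt
      ((hU.prod isOpen_univ).mem_nhds ⟨hct, mem_univ _⟩)).of_le (by simp)
  obtain ⟨K, s, hs, hl⟩ := hX.exists_lipschitzOnWith
  have key : ∀ c : ℝ → V, c t = c₁ t → deriv c t = deriv c₁ t →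
      (∀ᶠ s in 𝓝 t, ContDiffAt ℝ 2 c s ∧ ∀ w, geodExpr B c s w = 0) →
      ∀ᶠ τ in 𝓝 t, HasDerivAt (fun s => (c s, deriv c s)) (spray B (c τ, deriv c τ)) τ ∧
        (c τ, deriv c τ) ∈ s := by
    intro c hc hc' h
    have hd := h.self_of_nhds
    have hcont : ContinuousAt (fun τ => (c τ, deriv c τ)) t :=
      hd.1.continuousAt.prodMk (ContDiffAt.hasDerivAt_deriv hd.1).continuousAt
    have hin : ∀ᶠ τ in 𝓝 t, c τ ∈ U := hd.1.continuousAt.preimage_mem_nhds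
      (hU.mem_nhds (by rw [hc]; exact hct))
    filter_upwards [h, hin, hcont.preimage_mem_nhds (by rw [hc, hc']; exact hs)]
      with τ h1 h2 h3
    exact ⟨hasDerivAt_spray hinv h2 h1.1 h1.2, h3⟩
  have h := ODE_solution_unique_of_eventually (v := fun _ => spray B) (s := fun _ => s) (K := K)
    (t₀ := t) (Filter.Eventually.of_forall fun _ => hl) (key c₁ rfl rfl h₁)
    (key c₂ h0.symm h0'.symm h₂) (by rw [h0, h0'])
  filter_upwards [h] with τ hτ
  exact congrArg Prod.fst hτ

end Spray

/-! ### Uniqueness of geodesics and the local geodesic flow. -/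

section GeodesicFlow

variable {m : ℕ} {M : Type*} [TopologicalSpace M]
  [ChartedSpace (EuclideanSpace ℝ (Fin m)) M] [IsManifold (𝓡 m) ∞ M]

local notation "𝔼" m => EuclideanSpace ℝ (Fin m)

theorem IsParam.isInvertible_pull {f : (𝔼 m) → M} {U : Set (𝔼 m)} (h : IsParam f U)
    (g : RiemMetric m M) : ∀ x ∈ U, (pull g f x).IsInvertible := fun _ hx =>
  isInvertible_of_posDef fun _ hu => h.pull_pos g hx hu

theorem IsGeodesicOn.mono {g : RiemMetric m M} {γ : ℝ → M} {s s' : Set ℝ}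
    (h : IsGeodesicOn g γ s) (hs : s' ⊆ s) : IsGeodesicOn g γ s' :=
  ⟨h.1.mono hs, fun t ht => h.2 t (hs ht)⟩

theorem IsGeodesicOn.congr {g : RiemMetric m M} {γ γ' : ℝ → M} {s : Set ℝ}
    (h : IsGeodesicOn g γ s) (hs : IsOpen s) (heq : EqOn γ' γ s) : IsGeodesicOn g γ' s := by
  rw [isGeodesicOn_iff] at h ⊢
  refine ⟨h.1.congr heq, fun t ht w => ?_⟩
  have h1 := h.2 t ht w
  rw [← heq ht] at h1
  rw [← h1]
  refine geodExpr_congr ?_ w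
  filter_upwards [hs.mem_nhds ht] with τ hτ
  rw [heq hτ]

theorem IsGeodesicOn.union {g : RiemMetric m M} {γ : ℝ → M} {s s' : Set ℝ}
    (h : IsGeodesicOn g γ s) (h' : IsGeodesicOn g γ s') (hs : IsOpen s) (hs' : IsOpen s') :
    IsGeodesicOn g γ (s ∪ s') := by
  refine ⟨fun t ht => ?_, fun t ht => ht.elim (h.2 t) (h'.2 t)⟩
  rcases ht with ht | ht
  · exact (h.1.contMDiffAt (hs.mem_nhds ht)).contMDiffWithinAt
  · exact (h'.1.contMDiffAt (hs'.mem_nhds ht)).contMDiffWithinAt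

theorem eventuallyEq_of_eventuallyEq_coord {γ₁ γ₂ : ℝ → M} {t : ℝ} {p : M}
    (h₁ : ContinuousAt γ₁ t) (h₂ : ContinuousAt γ₂ t)
    (hp₁ : γ₁ t ∈ (chartAt (𝔼 m) p).source) (hp₂ : γ₂ t ∈ (chartAt (𝔼 m) p).source)
    (h : (fun s => coord m p (γ₁ s)) =ᶠ[𝓝 t] fun s => coord m p (γ₂ s)) : γ₁ =ᶠ[𝓝 t] γ₂ := by
  have ho := (chartAt (𝔼 m) p).open_source
  filter_upwards [h, h₁.preimage_mem_nhds (ho.mem_nhds hp₁),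
    h₂.preimage_mem_nhds (ho.mem_nhds hp₂)] with s hs h1 h2
  refine (extChartAt (𝓡 m) p).injOn ?_ ?_ hs
  · rw [extChartAt_source]; exact h1
  · rw [extChartAt_source]; exact h2

theorem IsGeodesicOn.eventually_coord {g : RiemMetric m M} {γ : ℝ → M} {s : Set ℝ}
    (h : IsGeodesicOn g γ s) (hs : IsOpen s) {t : ℝ} (ht : t ∈ s) {p : M}
    (hp : γ t ∈ (chartAt (𝔼 m) p).source) :
    ∀ᶠ τ in 𝓝 t, ContDiffAt ℝ 2 (fun τ => coord m p (γ τ)) τ ∧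
      ∀ w, geodExpr (pull g (coordInv m p)) (fun τ => coord m p (γ τ)) τ w = 0 := by
  filter_upwards [hs.mem_nhds ht, (h.continuousAt hs ht).preimage_mem_nhds
    ((chartAt (𝔼 m) p).open_source.mem_nhds hp)] with τ hτ hτp
  exact ⟨h.contDiffAt_coord hs hτ hτp, h.geodExpr_coord hs hτ hτp⟩

/-- Geodesics with the same position and velocity at one time agree near that time. -/
theorem IsGeodesicOn.eventuallyEq {g : RiemMetric m M} {γ₁ γ₂ : ℝ → M} {s : Set ℝ}
    (h₁ : IsGeodesicOn g γ₁ s) (h₂ : IsGeodesicOn g γ₂ s) (hs : IsOpen s) {t : ℝ} (ht : t ∈ s)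
    {p : M} (hp : γ₁ t ∈ (chartAt (𝔼 m) p).source) (h0 : γ₁ t = γ₂ t)
    (h0' : deriv (fun τ => coord m p (γ₁ τ)) t = deriv (fun τ => coord m p (γ₂ τ)) t) :
    γ₁ =ᶠ[𝓝 t] γ₂ := by
  have hpar := isParam_coordInv (m := m) p
  refine eventuallyEq_of_eventuallyEq_coord (h₁.continuousAt hs ht) (h₂.continuousAt hs ht) hp
    (h0 ▸ hp) ?_
  refine eventuallyEq_of_geodExpr hpar.isOpen (contDiffOn_pull g hpar.isOpen hpar.contMDiffOn)
    (hpar.isInvertible_pull g) ?_ (h₁.eventually_coord hs ht hp)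
    (h₂.eventually_coord hs ht (h0 ▸ hp)) (by rw [h0]) h0'
  exact (extChartAt (𝓡 m) p).map_source (by rw [extChartAt_source]; exact hp)

/-- Geodesics on an interval with the same position and velocity at one time agree. -/
theorem IsGeodesicOn.eqOn [T2Space M] {g : RiemMetric m M} {γ₁ γ₂ : ℝ → M} {s : Set ℝ}
    (h₁ : IsGeodesicOn g γ₁ s) (h₂ : IsGeodesicOn g γ₂ s) (hs : IsOpen s)
    (hconn : IsPreconnected s) {t : ℝ} (ht : t ∈ s)
    {p : M} (hp : γ₁ t ∈ (chartAt (𝔼 m) p).source) (h0 : γ₁ t = γ₂ t)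
    (h0' : deriv (fun τ => coord m p (γ₁ τ)) t = deriv (fun τ => coord m p (γ₂ τ)) t) :
    EqOn γ₁ γ₂ s := by
  -- The times at which the germs agree form an open set. It is closed relative to `s`, since
  -- position (by the Hausdorff property) and velocity agree in the limit and local uniqueness
  -- applies there.
  let u := {t | γ₁ =ᶠ[𝓝 t] γ₂}
  have hu : IsOpen u := isOpen_setOfPred_eventually_nhds
  suffices hsu : s ⊆ u from fun τ hτ => (hsu hτ).eq_of_nhds
  refine hconn.subset_of_closure_inter_subset hu
    ⟨t, ht, h₁.eventuallyEq h₂ hs ht hp h0 h0'⟩ ?_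
  rintro τ ⟨hτu, hτs⟩
  rw [mem_closure_iff_frequently] at hτu
  have hτ0 : γ₁ τ = γ₂ τ := by
    by_contra hne
    have hev := ((h₁.continuousAt hs hτs).ne_iff_eventually_ne (h₂.continuousAt hs hτs)).1 hne
    obtain ⟨x, hx1, hx2⟩ := (hτu.and_eventually hev).exists
    exact hx2 hx1.eq_of_nhds
  refine h₁.eventuallyEq h₂ hs hτs (mem_chart_source _ (γ₁ τ)) hτ0 ?_
  by_contra hne
  have hd₁ := (ContDiffAt.hasDerivAt_deriv (h₁.contDiffAt_coord hs hτs
    (mem_chart_source (𝔼 m) (γ₁ τ)))).continuousAt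
  have hd₂ := (ContDiffAt.hasDerivAt_deriv (h₂.contDiffAt_coord hs hτs (p := γ₁ τ)
    (by rw [← hτ0]; exact mem_chart_source (𝔼 m) (γ₁ τ)))).continuousAt
  have hev := (hd₁.ne_iff_eventually_ne hd₂).1 hne
  obtain ⟨x, hx1, hx2⟩ := (hτu.and_eventually hev).exists
  refine hx2 (Filter.EventuallyEq.deriv_eq ?_)
  filter_upwards [hx1] with y hy
  rw [hy]

/-- The local geodesic flow in a chart, depending smoothly on the initial data. -/
theorem exists_geodesic_flow (g : RiemMetric m M) (p : M) {z₀ : (𝔼 m) × (𝔼 m)}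
    (hz₀ : z₀.1 ∈ (extChartAt (𝓡 m) p).target) :
    ∃ W : Set ((𝔼 m) × (𝔼 m)), IsOpen W ∧ z₀ ∈ W ∧ ∃ δ > 0, ∃ Φ : ((𝔼 m) × (𝔼 m)) × ℝ → 𝔼 m,
      ContDiffOn ℝ ∞ Φ (W ×ˢ Ioo (-δ) δ) ∧ ∀ z ∈ W, Φ (z, 0) = z.1 ∧
        HasDerivAt (fun t => Φ (z, t)) z.2 0 ∧
        (∀ t ∈ Ioo (-δ) δ, Φ (z, t) ∈ (extChartAt (𝓡 m) p).target) ∧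
        IsGeodesicOn g (fun t => coordInv m p (Φ (z, t))) (Ioo (-δ) δ) := by
  have hpar := isParam_coordInv (m := m) p
  have hX := contDiffOn_spray hpar.isOpen (contDiffOn_pull g hpar.isOpen hpar.contMDiffOn)
    (hpar.isInvertible_pull g)
  obtain ⟨W, hW, hzW, δ, hδ, Φ, hΦ, hflow⟩ := exists_smooth_flow (hpar.isOpen.prod isOpen_univ)
    hX (x₀ := z₀) ⟨hz₀, mem_univ _⟩
  refine ⟨W, hW, hzW, δ, hδ, fun q => (Φ q).1, contDiff_fst.comp_contDiffOn hΦ, fun z hz => ?_⟩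
  obtain ⟨h0, h⟩ := hflow z hz
  have hd1 : ∀ t ∈ Ioo (-δ) δ, HasDerivAt (fun t => (Φ (z, t)).1) (Φ (z, t)).2 t := fun t ht =>
    (ContinuousLinearMap.fst ℝ (𝔼 m) (𝔼 m)).hasFDerivAt.comp_hasDerivAt t (h t ht).2
  have hd2 : ∀ t ∈ Ioo (-δ) δ, HasDerivAt (fun t => (Φ (z, t)).2)
      (acc (pull g (coordInv m p)) (Φ (z, t))) t := fun t ht =>
    (ContinuousLinearMap.snd ℝ (𝔼 m) (𝔼 m)).hasFDerivAt.comp_hasDerivAt t (h t ht).2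
  refine ⟨congrArg Prod.fst h0, ?_, fun t ht => (h t ht).1.1, isGeodesicOn_of_param g fun t ht =>
    ⟨coordInv m p, _, fun t => (Φ (z, t)).1, hpar, (h t ht).1.1, ?_, Filter.EventuallyEq.rfl, ?_⟩⟩
  · have := hd1 0 ⟨by linarith, hδ⟩
    rwa [h0] at this
  · have hin : ContDiff ℝ ∞ fun t : ℝ => (z, t) := contDiff_const.prodMk contDiff_id
    have := (contDiff_fst.comp_contDiffOn hΦ).comp (hin.contDiffOn (s := Ioo (-δ) δ))
      fun t ht => ⟨hz, ht⟩
    exact (this.contDiffAt (isOpen_Ioo.mem_nhds ht)).of_le two_le_infty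
  · rw [geodExpr_eq_zero_iff (hpar.isInvertible_pull g _ (h t ht).1.1)]
    have hev : deriv (fun t => (Φ (z, t)).1) =ᶠ[𝓝 t] fun t => (Φ (z, t)).2 := by
      filter_upwards [isOpen_Ioo.mem_nhds ht] with τ hτ
      exact (hd1 τ hτ).deriv
    rw [hev.deriv_eq, hev.eq_of_nhds]
    exact (hd2 t ht).deriv

end GeodesicFlow

/-! ### The norm of the tangent space at a point and its balls. -/

section TangentNorm

variable {m : ℕ} {M : Type*} [TopologicalSpace M]
  [ChartedSpace (EuclideanSpace ℝ (Fin m)) M] [IsManifold (𝓡 m) ∞ M]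

local notation "𝔼" m => EuclideanSpace ℝ (Fin m)

/-- The norm on the tangent space at `P`. -/
def tnorm (g : RiemMetric m M) (P : M) (v : 𝔼 m) : ℝ := √(form g P v v)

theorem mem_tangentBall {g : RiemMetric m M} {P : M} {R : ℝ≥0∞} {v : 𝔼 m} :
    v ∈ tangentBall g P R ↔ ENNReal.ofReal (tnorm g P v) < R := Iff.rfl

theorem form_self_nonneg (g : RiemMetric m M) (P : M) (v : 𝔼 m) : 0 ≤ form g P v v := by
  by_cases h : v = 0
  · simp [h]
  · exact (form_pos g P h).le

theorem tnorm_sq (g : RiemMetric m M) (P : M) (v : 𝔼 m) : tnorm g P v ^ 2 = form g P v v :=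
  Real.sq_sqrt (form_self_nonneg g P v)

theorem tnorm_nonneg (g : RiemMetric m M) (P : M) (v : 𝔼 m) : 0 ≤ tnorm g P v := Real.sqrt_nonneg _

@[simp] theorem tnorm_zero (g : RiemMetric m M) (P : M) : tnorm g P (0 : 𝔼 m) = 0 := by
  simp [tnorm]

theorem tnorm_pos (g : RiemMetric m M) (P : M) {v : 𝔼 m} (hv : v ≠ 0) : 0 < tnorm g P v :=
  Real.sqrt_pos.2 (form_pos g P hv)

theorem tnorm_smul (g : RiemMetric m M) (P : M) (a : ℝ) (v : 𝔼 m) :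
    tnorm g P (a • v) = |a| * tnorm g P v := by
  have : form g P (a • v) (a • v) = a ^ 2 * form g P v v := by
    simp only [map_smul, smul_apply, smul_eq_mul]; ring
  rw [tnorm, this, Real.sqrt_mul (sq_nonneg a), Real.sqrt_sq_eq_abs, tnorm]

theorem continuous_tnorm (g : RiemMetric m M) (P : M) : Continuous (tnorm g P) := by
  refine Continuous.sqrt ?_
  exact ((form g P).continuous.clm_apply continuous_id)

theorem isOpen_tangentBall (g : RiemMetric m M) (P : M) (R : ℝ≥0∞) :
    IsOpen (tangentBall g P R) :=
  isOpen_lt (ENNReal.continuous_ofReal.comp (continuous_tnorm g P)) continuous_const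

theorem exists_norm_le_tnorm (g : RiemMetric m M) (P : M) :
    ∃ C > 0, ∀ v : 𝔼 m, ‖v‖ ≤ C * tnorm g P v := by
  have hb : IsVonNBounded ℝ {v : 𝔼 m | form g P v v < 1} := g.isVonNBounded P
  rw [NormedSpace.isVonNBounded_iff'] at hb
  obtain ⟨r, hr⟩ := hb
  have hr0 : 0 ≤ r := (norm_nonneg (0 : 𝔼 m)).trans (hr 0 (by simp))
  -- `r` bounds the open unit ball of the form. The vector `v / (2 |v|)` has norm `1 / 2` and lies
  -- in it, which gives `‖v‖ ≤ 2 r |v|`; the summand `1` keeps the constant positive.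
  refine ⟨2 * r + 1, by positivity, fun v => ?_⟩
  by_cases hv : v = 0
  · simp [hv]
  have hN := tnorm_pos g P hv
  have h1 := hr ((2 * tnorm g P v)⁻¹ • v) (by
    change form g P _ _ < 1
    rw [← tnorm_sq, tnorm_smul, abs_of_pos (by positivity)]
    have : (2 * tnorm g P v)⁻¹ * tnorm g P v = 1 / 2 := by field_simp
    rw [this]; norm_num)
  rw [norm_smul, Real.norm_of_nonneg (by positivity), inv_mul_le_iff₀ (by positivity)] at h1
  nlinarith

theorem isCompact_tnorm_le (g : RiemMetric m M) (P : M) (s : ℝ) :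
    IsCompact {v : 𝔼 m | tnorm g P v ≤ s} := by
  obtain ⟨C, hC, hle⟩ := exists_norm_le_tnorm g P
  refine (isCompact_closedBall (0 : 𝔼 m) (C * s)).of_isClosed_subset
    (isClosed_le (continuous_tnorm g P) continuous_const) fun v hv => ?_
  rw [mem_closedBall_zero_iff]
  exact (hle v).trans (by gcongr; exact hv)

theorem tangentBall_mono (g : RiemMetric m M) (P : M) {R R' : ℝ≥0∞} (h : R ≤ R') :
    tangentBall g P R ⊆ tangentBall g P R' := fun _ hv => lt_of_lt_of_le hv h

/-- If no larger ball fits, choose by compactness a vector outside `O` of least norm among those of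
norm at most `s + 1`. Its norm exceeds `s`, and the open ball of that radius again contains a vector
outside `O`, of smaller norm. -/
theorem exists_tangentBall_subset (g : RiemMetric m M) (P : M) {O : Set (𝔼 m)}
    (hO : IsOpen O) {s : ℝ} (hs : 0 ≤ s) (hsub : {v : 𝔼 m | tnorm g P v ≤ s} ⊆ O) :
    ∃ R > s, tangentBall g P (ENNReal.ofReal R) ⊆ O := by
  by_contra! hne
  have hK : IsCompact ({v : 𝔼 m | tnorm g P v ≤ s + 1} \ O) := (isCompact_tnorm_le g P _).diff hO
  obtain ⟨v₀, hv₀⟩ : ({v : 𝔼 m | tnorm g P v ≤ s + 1} \ O).Nonempty := by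
    obtain ⟨v, hv, hvO⟩ := not_subset.1 (hne (s + 1) (by linarith))
    exact ⟨v, ((ENNReal.ofReal_lt_ofReal_iff (by linarith)).1 hv).le, hvO⟩
  obtain ⟨v, ⟨hv1, hvO⟩, hmin⟩ := hK.exists_isMinOn ⟨v₀, hv₀⟩ (continuous_tnorm g P).continuousOn
  have hvs : s < tnorm g P v := by
    by_contra! h
    exact hvO (hsub h)
  obtain ⟨w, hw, hwO⟩ := not_subset.1 (hne _ hvs)
  have hw' : tnorm g P w < tnorm g P v := (ENNReal.ofReal_lt_ofReal_iff (by linarith)).1 hw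
  exact absurd (hmin ⟨hw'.le.trans hv1, hwO⟩) (not_le.2 hw')

end TangentNorm

/-! ### Local diffeomorphisms from the model space. -/

section LocalDiffeo

variable {m : ℕ} {M : Type*} [TopologicalSpace M]
  [ChartedSpace (EuclideanSpace ℝ (Fin m)) M] [IsManifold (𝓡 m) ∞ M]

local notation "𝔼" m => EuclideanSpace ℝ (Fin m)

/-- Source and target have the same dimension, so the differential is invertible and the inverse
function theorem applies in the chart at `f x`. -/
theorem isLocalDiffeomorphAt_of_injective {f : (𝔼 m) → M} {U : Set (𝔼 m)} (hU : IsOpen U)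
    (hf : ContMDiffOn (𝓡 m) (𝓡 m) ∞ f U) {x : 𝔼 m} (hx : x ∈ U)
    (hinj : Function.Injective (dpar f x)) : IsLocalDiffeomorphAt (𝓡 m) (𝓡 m) ∞ f x := by
  set p := f x
  let U' := U ∩ f ⁻¹' (chartAt (𝔼 m) p).source
  have hU' : IsOpen U' := hf.continuousOn.isOpen_inter_preimage hU (chartAt (𝔼 m) p).open_source
  have hxU' : x ∈ U' := ⟨hx, mem_chart_source _ _⟩
  have hsm : ContDiffOn ℝ ∞ (coord m p ∘ f) U' := by
    rw [← contMDiffOn_iff_contDiffOn]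
    exact (contMDiffOn_coord p).comp (hf.mono inter_subset_left) fun z hz => hz.2
  have hsrc : ∀ z ∈ U', f z ∈ (extChartAt (𝓡 m) p).source := fun z hz => by
    rw [extChartAt_source]; exact hz.2
  have hev : f =ᶠ[𝓝 x] coordInv m p ∘ (coord m p ∘ f) := by
    filter_upwards [hU'.mem_nhds hxU'] with y hy
    exact ((extChartAt (𝓡 m) p).left_inv (hsrc y hy)).symm
  have hinj' : Function.Injective (fderiv ℝ (coord m p ∘ f) x) := by
    intro u v huv
    refine hinj ?_
    rw [dpar_congr hev, dpar_comp ((isParam_coordInv p).mdifferentiableAt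
      ((extChartAt (𝓡 m) p).map_source (hsrc x hxU')))
      ((hsm.contDiffAt (hU'.mem_nhds hxU')).differentiableAt (by simp))]
    exact congrArg (dpar (coordInv m p) ((coord m p ∘ f) x)) huv
  have hinv : (fderiv ℝ (coord m p ∘ f) x).IsInvertible :=
    ⟨(LinearEquiv.ofInjectiveEndo _ hinj').toContinuousLinearEquiv, by ext; rfl⟩
  obtain ⟨e, hxe, heU', hef, hsymm⟩ := exists_smooth_local_inverse hU' hsm hxU' hinv
  have hco : ContinuousOn (coord m p) (chartAt (𝔼 m) p).source :=
    (contMDiffOn_coord p).continuousOn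
  let Φ : PartialDiffeomorph (𝓡 m) (𝓡 m) (𝔼 m) M ∞ :=
    { toFun := f
      invFun := fun q => e.symm (coord m p q)
      source := e.source
      target := (chartAt (𝔼 m) p).source ∩ coord m p ⁻¹' e.target
      map_source' := fun z hz => ⟨(heU' hz).2, by
        have := e.map_source hz
        rwa [hef] at this⟩
      map_target' := fun q hq => e.map_target hq.2
      left_inv' := fun z hz => by
        have := e.left_inv hz
        rwa [hef] at this
      right_inv' := fun q hq => by
        have h1 := e.right_inv hq.2
        rw [hef] at h1
        refine (extChartAt (𝓡 m) p).injOn (hsrc _ (heU' (e.map_target hq.2))) ?_ h1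
        rw [extChartAt_source]; exact hq.1
      open_source := e.open_source
      open_target := hco.isOpen_inter_preimage (chartAt (𝔼 m) p).open_source e.open_target
      contMDiffOn_toFun := hf.mono fun z hz => (heU' hz).1
      contMDiffOn_invFun := (contMDiffOn_iff_contDiffOn.2 hsymm).comp
        ((contMDiffOn_coord p).mono inter_subset_left) fun q hq => hq.2 }
  exact ⟨Φ, hxe, fun z _ => rfl⟩

theorem isOpen_isLocalDiffeomorphAt (f : (𝔼 m) → M) :
    IsOpen {x | IsLocalDiffeomorphAt (𝓡 m) (𝓡 m) ∞ f x} := by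
  rw [isOpen_iff_mem_nhds]
  rintro x ⟨Φ, hx, heq⟩
  filter_upwards [Φ.open_source.mem_nhds hx] with y hy
  exact ⟨Φ, hy, heq⟩

theorem exists_injOn_of_isLocalDiffeomorphAt {f : (𝔼 m) → M} {x : 𝔼 m}
    (h : IsLocalDiffeomorphAt (𝓡 m) (𝓡 m) ∞ f x) : ∃ u ∈ 𝓝 x, InjOn f u := by
  obtain ⟨Φ, hx, heq⟩ := h
  exact ⟨_, Φ.open_source.mem_nhds hx, Φ.injOn.congr heq.symm⟩

theorem isParam_of_isLocalDiffeomorphOn {f : (𝔼 m) → M} {U : Set (𝔼 m)} (hU : IsOpen U)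
    (h : IsLocalDiffeomorphOn (𝓡 m) (𝓡 m) ∞ f U) : IsParam f U := by
  refine ⟨hU, h.contMDiffOn, fun x hx => ?_⟩
  exact ((h ⟨x, hx⟩).mfderivToContinuousLinearEquiv (by simp)).injective

end LocalDiffeo

/-! ### The exponential map and positivity of the injectivity radius. -/

section Exp

variable {m : ℕ} {M : Type*} [TopologicalSpace M]
  [ChartedSpace (EuclideanSpace ℝ (Fin m)) M] [IsManifold (𝓡 m) ∞ M]

local notation "𝔼" m => EuclideanSpace ℝ (Fin m)

-- Both terms of the equation are quadratic in the time scale; translation of time has no effect.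
set_option synthInstance.maxHeartbeats 200000 in
theorem geodExpr_comp_affine {V : Type*} [NormedAddCommGroup V] [NormedSpace ℝ V]
    (B : V → V →L[ℝ] V →L[ℝ] ℝ) (c : ℝ → V) (a b t : ℝ) (w : V) :
    geodExpr B (fun s => c (a * s + b)) t w = a ^ 2 * geodExpr B c (a * t + b) w := by
  have h1 : ∀ k : ℝ → V, deriv (fun s => k (a * s + b)) = fun s => a • deriv k (a * s + b) := by
    intro k
    funext s
    rw [deriv_comp_mul_left a (fun y => k (y + b)) s, deriv_comp_add_const]
  have h2 : deriv (deriv fun s => c (a * s + b)) t = a • a • deriv (deriv c) (a * t + b) := by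
    rw [h1, deriv_fun_const_smul_field, h1]
  simp only [geodExpr, h2, chr]
  rw [h1]
  simp only [map_smul, smul_apply, smul_eq_mul]
  ring

theorem IsGeodesicOn.comp_affine {g : RiemMetric m M} {γ : ℝ → M} {s : Set ℝ}
    (h : IsGeodesicOn g γ s) (hs : IsOpen s) (a b : ℝ) :
    IsGeodesicOn g (fun t => γ (a * t + b)) ((fun t => a * t + b) ⁻¹' s) := by
  refine isGeodesicOn_of_param g fun t ht => ?_
  let p := γ (a * t + b)
  have hp : γ (a * t + b) ∈ (chartAt (𝔼 m) p).source := mem_chart_source _ _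
  have haff : ContinuousAt (fun t : ℝ => a * t + b) t := by fun_prop
  have haff2 : ContDiffAt ℝ 2 (fun t : ℝ => a * t + b) t := by fun_prop
  refine ⟨coordInv m p, _, fun t => coord m p (γ (a * t + b)), isParam_coordInv p, ?_, ?_, ?_, ?_⟩
  · exact mem_extChartAt_target _
  · exact ContDiffAt.comp (g := fun τ => coord m p (γ τ)) (f := fun t => a * t + b) t (h.contDiffAt_coord hs ht hp) haff2
  · have hc : ContinuousAt (fun t => γ (a * t + b)) t :=
      ContinuousAt.comp (f := fun t : ℝ => a * t + b) (h.continuousAt hs ht) haff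
    filter_upwards [hc.preimage_mem_nhds ((chartAt (𝔼 m) p).open_source.mem_nhds hp)] with τ hτ
    exact ((extChartAt (𝓡 m) p).left_inv (by rw [extChartAt_source]; exact hτ)).symm
  · intro w
    rw [geodExpr_comp_affine _ (fun s => coord m p (γ s)), h.geodExpr_coord hs ht hp, mul_zero]

theorem mfderiv_curve {γ : ℝ → M} {t : ℝ} (h : MDifferentiableAt 𝓘(ℝ, ℝ) (𝓡 m) γ t) :
    (mfderiv 𝓘(ℝ, ℝ) (𝓡 m) γ t (1 : ℝ) : 𝔼 m) = deriv (fun s => coord m (γ t) (γ s)) t := by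
  have := h.mfderiv
  simp only [writtenInExtChartAt, extChartAt_model_space_eq_id, PartialEquiv.refl_symm,
    PartialEquiv.refl_coe, ModelWithCorners.range_eq_univ, fderivWithin_univ] at this
  exact congrArg (fun L : ℝ →L[ℝ] (𝔼 m) => L 1) this

/-- `γ` is a geodesic on `J` with the initial position `P` and the initial velocity `v`. -/
structure IsGeodesicStart (g : RiemMetric m M) (P : M) (v : 𝔼 m) (γ : ℝ → M) (J : Set ℝ) :
    Prop where
  isGeodesicOn : IsGeodesicOn g γ J
  map_zero : γ 0 = P
  velocity : deriv (fun s => coord m P (γ s)) 0 = v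

theorem isGeodesicFrom_iff (g : RiemMetric m M) (P : M) (v : 𝔼 m) (γ : ℝ → M) :
    IsGeodesicFrom g P v γ ↔ ∃ ε > 0, IsGeodesicStart g P v γ (Ioo (-ε) (1 + ε)) := by
  have key : ∀ ε > 0, IsGeodesicOn g γ (Ioo (-ε) (1 + ε)) → γ 0 = P →
      (mfderiv 𝓘(ℝ, ℝ) (𝓡 m) γ 0 (1 : ℝ) : 𝔼 m) = deriv (fun s => coord m P (γ s)) 0 := by
    intro ε hε h h0
    have := mfderiv_curve ((h.1.contMDiffAt (Ioo_mem_nhds (by linarith : -ε < 0)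
      (by linarith))).mdifferentiableAt (by simp))
    rw [this, h0]
  constructor
  · rintro ⟨⟨ε, hε, h⟩, h0, hv⟩
    exact ⟨ε, hε, h, h0, by rw [← key ε hε h h0]; exact hv⟩
  · rintro ⟨ε, hε, h, h0, hv⟩
    exact ⟨⟨ε, hε, h⟩, h0, (key ε hε h h0).trans hv⟩

theorem IsGeodesicStart.eqOn [T2Space M] {g : RiemMetric m M} {P : M} {v : 𝔼 m} {γ₁ γ₂ : ℝ → M}
    {J : Set ℝ} (h₁ : IsGeodesicStart g P v γ₁ J) (h₂ : IsGeodesicStart g P v γ₂ J)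
    (hJ : IsOpen J) (hconn : J.OrdConnected) (h0 : (0 : ℝ) ∈ J) : EqOn γ₁ γ₂ J :=
  h₁.1.eqOn h₂.1 hJ hconn.isPreconnected h0 (p := P)
    (by rw [h₁.map_zero]; exact mem_chart_source _ _) (by rw [h₁.map_zero, h₂.map_zero])
    (by rw [h₁.velocity, h₂.velocity])

theorem IsGeodesicStart.mono {g : RiemMetric m M} {P : M} {v : 𝔼 m} {γ : ℝ → M}
    {J J' : Set ℝ} (h : IsGeodesicStart g P v γ J) (hJ : J' ⊆ J) : IsGeodesicStart g P v γ J' :=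
  ⟨h.1.mono hJ, h.2, h.3⟩

theorem exists_Ioo_subset {J : Set ℝ} (hJ : IsOpen J) (hconn : J.OrdConnected)
    (h0 : (0 : ℝ) ∈ J) (h1 : (1 : ℝ) ∈ J) : ∃ ε > 0, Ioo (-ε) (1 + ε) ⊆ J := by
  obtain ⟨ε₀, hε₀, hb₀⟩ := Metric.isOpen_iff.1 hJ 0 h0
  obtain ⟨ε₁, hε₁, hb₁⟩ := Metric.isOpen_iff.1 hJ 1 h1
  refine ⟨min ε₀ ε₁ / 2, by positivity, fun t ht => ?_⟩
  have h2 : min ε₀ ε₁ / 2 < ε₀ := by linarith [min_le_left ε₀ ε₁]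
  have h3 : min ε₀ ε₁ / 2 < ε₁ := by linarith [min_le_right ε₀ ε₁]
  have hm : 0 < min ε₀ ε₁ / 2 := by positivity
  refine hconn.out (@hb₀ (-(min ε₀ ε₁ / 2)) ?_) (@hb₁ (1 + min ε₀ ε₁ / 2) ?_)
    (Ioo_subset_Icc_self ht)
  · rw [Metric.mem_ball, Real.dist_0_eq_abs, abs_neg, abs_of_pos hm]; exact h2
  · rw [Metric.mem_ball, Real.dist_eq, add_sub_cancel_left, abs_of_pos hm]; exact h3

/-- The exponential map is computed by any geodesic. -/
theorem IsGeodesicStart.expMap_smul [T2Space M] {g : RiemMetric m M} {P : M} {v : 𝔼 m}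
    {γ : ℝ → M} {J : Set ℝ} (h : IsGeodesicStart g P v γ J) (hJ : IsOpen J)
    (hconn : J.OrdConnected) (h0 : (0 : ℝ) ∈ J) {t : ℝ} (ht : t ∈ J) :
    t • v ∈ expDomain g P ∧ expMap g P (t • v) = γ t := by
  set J' := (fun s : ℝ => t * s + 0) ⁻¹' J with hJ'
  have hJ'o : IsOpen J' := hJ.preimage (by fun_prop)
  have hJ'c : J'.OrdConnected := by
    constructor
    intro x hx y hy z hz
    have hx' : t * x + 0 ∈ J := hx
    have hy' : t * y + 0 ∈ J := hy
    change t * z + 0 ∈ J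
    rcases le_total 0 t with h | h
    · exact hconn.out hx' hy' ⟨by nlinarith [hz.1], by nlinarith [hz.2]⟩
    · exact hconn.out hy' hx' ⟨by nlinarith [hz.2], by nlinarith [hz.1]⟩
  obtain ⟨ε, hε, hsub⟩ := exists_Ioo_subset hJ'o hJ'c (by simpa [hJ'] using h0)
    (by simpa [hJ'] using ht)
  have hst : IsGeodesicStart g P (t • v) (fun s => γ (t * s + 0)) (Ioo (-ε) (1 + ε)) := by
    refine ⟨(h.1.comp_affine hJ t 0).mono hsub, by simp [h.map_zero], ?_⟩
    have := deriv_comp_mul_left t (fun s => coord m P (γ s)) 0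
    simp only [add_zero]
    rw [this, mul_zero, h.velocity]
  have hfrom := (isGeodesicFrom_iff g P (t • v) _).2 ⟨ε, hε, hst⟩
  have hdom : t • v ∈ expDomain g P := ⟨_, hfrom⟩
  refine ⟨hdom, ?_⟩
  rw [expMap, dif_pos hdom]
  -- `expMap` evaluates an arbitrarily chosen geodesic; uniqueness on the common interval identifies
  -- it with the rescaled `γ`.
  obtain ⟨ε', hε', hst'⟩ := (isGeodesicFrom_iff g P (t • v) _).1 hdom.choose_spec
  have hmin : 0 < min ε ε' := lt_min hε hε'
  have hle := min_le_left ε ε'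
  have hle' := min_le_right ε ε'
  have hJ0 : (0 : ℝ) ∈ Ioo (-(min ε ε')) (1 + min ε ε') := by constructor <;> linarith
  have hJ1 : (1 : ℝ) ∈ Ioo (-(min ε ε')) (1 + min ε ε') := by constructor <;> linarith
  have := (hst'.mono (Ioo_subset_Ioo (neg_le_neg hle') (by linarith))).eqOn
    (hst.mono (Ioo_subset_Ioo (neg_le_neg hle) (by linarith))) isOpen_Ioo ordConnected_Ioo
    hJ0 hJ1
  rw [this]
  simp

/-- The rays of the exponential map are geodesics. -/
theorem exists_ray [T2Space M] {g : RiemMetric m M} {P : M} {v : 𝔼 m}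
    (hv : v ∈ expDomain g P) : ∃ ε > 0,
      IsGeodesicStart g P v (fun t => expMap g P (t • v)) (Ioo (-ε) (1 + ε)) ∧
      ∀ t ∈ Ioo (-ε) (1 + ε), t • v ∈ expDomain g P := by
  obtain ⟨γ, hγ⟩ := hv
  obtain ⟨ε, hε, hst⟩ := (isGeodesicFrom_iff g P v γ).1 hγ
  have h0 : (0 : ℝ) ∈ Ioo (-ε) (1 + ε) := by constructor <;> linarith
  have hexp := fun t ht => hst.expMap_smul isOpen_Ioo ordConnected_Ioo h0 (t := t) ht
  refine ⟨ε, hε, ⟨hst.1.congr isOpen_Ioo fun t ht => (hexp t ht).2, ?_, ?_⟩,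
    fun t ht => (hexp t ht).1⟩
  · rw [(hexp 0 h0).2, hst.map_zero]
  · refine Eq.trans ?_ hst.velocity
    refine Filter.EventuallyEq.deriv_eq ?_
    filter_upwards [isOpen_Ioo.mem_nhds h0] with t ht
    rw [(hexp t ht).2]

/-- The conditions on the radii in the definition of the injectivity radius. -/
structure GoodRadius (g : RiemMetric m M) (P : M) (R : ℝ≥0∞) : Prop where
  subset : tangentBall g P R ⊆ expDomain g P
  injOn : InjOn (expMap g P) (tangentBall g P R)
  isLocalDiffeomorphOn : IsLocalDiffeomorphOn (𝓡 m) (𝓡 m) ∞ (expMap g P) (tangentBall g P R)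

theorem GoodRadius.le {g : RiemMetric m M} {P : M} {R : ℝ≥0∞} (h : GoodRadius g P R) :
    R ≤ injRadius g P := le_sSup ⟨h.1, h.2, h.3⟩

/-- The supremum is attained: each condition involves at most two vectors, and these already lie in
the ball of some good radius, since balls are nested. -/
theorem goodRadius_injRadius (g : RiemMetric m M) (P : M) : GoodRadius g P (injRadius g P) := by
  have key : ∀ v ∈ tangentBall g P (injRadius g P), ∃ R, GoodRadius g P R ∧
      v ∈ tangentBall g P R := by
    intro v hv
    obtain ⟨R, hR, hlt⟩ := lt_sSup_iff.1 (show ENNReal.ofReal (tnorm g P v) < sSup _ from hv)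
    exact ⟨R, ⟨hR.1, hR.2.1, hR.2.2⟩, hlt⟩
  refine ⟨fun v hv => ?_, fun v hv w hw hvw => ?_, fun v => ?_⟩
  · obtain ⟨R, hR, hvR⟩ := key v hv
    exact hR.1 hvR
  · obtain ⟨R, hR, hvR⟩ := key v hv
    obtain ⟨R', hR', hwR'⟩ := key w hw
    rcases le_total R R' with h | h
    · exact hR'.2 (tangentBall_mono g P h hvR) hwR' hvw
    · exact hR.2 hvR (tangentBall_mono g P h hwR') hvw
  · obtain ⟨R, hR, hvR⟩ := key v v.2
    exact hR.3 ⟨v, hvR⟩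

theorem GoodRadius.isParam {g : RiemMetric m M} {P : M} {R : ℝ≥0∞} (h : GoodRadius g P R) :
    IsParam (expMap g P) (tangentBall g P R) :=
  isParam_of_isLocalDiffeomorphOn (isOpen_tangentBall g P R) h.isLocalDiffeomorphOn

theorem expMap_zero [T2Space M] {g : RiemMetric m M} {P : M}
    (h0 : (0 : 𝔼 m) ∈ expDomain g P) : expMap g P (0 : 𝔼 m) = P := by
  obtain ⟨ε, hε, hst, -⟩ := exists_ray h0
  simpa using hst.map_zero

/-- The differential of the exponential map at the origin, in the chart at `P`. -/
theorem fderiv_coord_expMap_zero [T2Space M] {g : RiemMetric m M} {P : M} {O : Set (𝔼 m)}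
    (hO : IsOpen O) (h0 : (0 : 𝔼 m) ∈ O) (hsub : O ⊆ expDomain g P)
    (hd : DifferentiableAt ℝ (coord m P ∘ expMap g P) 0) :
    fderiv ℝ (coord m P ∘ expMap g P) 0 = ContinuousLinearMap.id ℝ (𝔼 m) := by
  have key : ∀ v ∈ O, fderiv ℝ (coord m P ∘ expMap g P) 0 v = v := by
    intro v hv
    obtain ⟨ε, hε, hst, -⟩ := exists_ray (hsub hv)
    have h1 : HasDerivAt (fun t : ℝ => t • v) v 0 := by
      simpa using (hasDerivAt_id (0 : ℝ)).smul_const v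
    have h2 : HasFDerivAt (coord m P ∘ expMap g P) (fderiv ℝ (coord m P ∘ expMap g P) 0)
        ((0 : ℝ) • v) := by rw [zero_smul]; exact hd.hasFDerivAt
    have h3 := (h2.comp_hasDerivAt (0 : ℝ) h1).deriv
    exact h3.symm.trans hst.velocity
  refine ContinuousLinearMap.ext fun v => ?_
  -- The rays only treat directions in `O`; an arbitrary vector is scaled into `O` and linearity
  -- does the rest.
  have hc : Filter.Tendsto (fun t : ℝ => t • v) (𝓝[≠] 0) (𝓝 0) := by
    have : ContinuousAt (fun t : ℝ => t • v) 0 := by fun_prop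
    rw [ContinuousAt, zero_smul] at this
    exact this.mono_left nhdsWithin_le_nhds
  obtain ⟨t, htO, ht0⟩ := ((hc.eventually (hO.mem_nhds h0)).and self_mem_nhdsWithin).exists
  have := key _ htO
  rw [map_smul] at this
  exact smul_right_injective _ ht0 this

/-- Near the origin `exp_P v` is the time `1/k` value of the geodesic flow with initial velocity `k
v`, hence smooth in `v`. Its differential at `0` is the identity, so it is injective and a local
diffeomorphism on a small ball. -/
theorem injRadius_pos [T2Space M] (g : RiemMetric m M) (P : M) : 0 < injRadius g P := by
  set x₀ := coord m P P
  have hx₀ : x₀ ∈ (extChartAt (𝓡 m) P).target := mem_extChartAt_target _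
  obtain ⟨W, hW, hzW, δ, hδ, Φ, hΦ, hflow⟩ := exists_geodesic_flow g P (z₀ := (x₀, 0)) hx₀
  -- With this speed-up, time `1` corresponds to flow time `δ / 2`, and times in `(-2, 2)` stay
  -- inside `(-δ, δ)`.
  set k := 2 / δ with hk
  have hkpos : 0 < k := by positivity
  let ι : (𝔼 m) → (𝔼 m) × (𝔼 m) := fun v => (x₀, k • v)
  have hι : ContDiff ℝ ∞ ι := contDiff_const.prodMk (contDiff_id.const_smul k)
  let O := ι ⁻¹' W
  have hO : IsOpen O := hW.preimage hι.continuous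
  have h0O : (0 : 𝔼 m) ∈ O := by simpa [O, ι] using hzW
  have hexp : ∀ v ∈ O, v ∈ expDomain g P ∧
      expMap g P v = coordInv m P (Φ (ι v, k⁻¹)) := by
    intro v hv
    obtain ⟨h0, hd, htar, hgeo⟩ := hflow _ hv
    have hJ : Ioo (-2 : ℝ) 2 ⊆ (fun s => k⁻¹ * s + 0) ⁻¹' Ioo (-δ) δ := by
      intro s hs
      have : k⁻¹ * s + 0 = δ * (s / 2) := by rw [hk]; field_simp; ring
      change k⁻¹ * s + 0 ∈ Ioo (-δ) δ
      rw [this]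
      constructor <;> nlinarith [hs.1, hs.2]
    have hst : IsGeodesicStart g P v (fun s => coordInv m P (Φ (ι v, k⁻¹ * s + 0)))
        (Ioo (-2) 2) := by
      refine ⟨(hgeo.comp_affine isOpen_Ioo k⁻¹ 0).mono hJ, ?_, ?_⟩
      · simp only [mul_zero, add_zero]
        rw [h0]
        exact extChartAt_to_inv P
      · have hev : (fun s => coord m P (coordInv m P (Φ (ι v, k⁻¹ * s + 0)))) =ᶠ[𝓝 0]
            fun s => Φ (ι v, k⁻¹ * s) := by
          filter_upwards [Ioo_mem_nhds (by norm_num : (-2 : ℝ) < 0) (by norm_num : (0 : ℝ) < 2)] with s hs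
          refine ((extChartAt (𝓡 m) P).right_inv (htar _ (hJ hs))).trans ?_
          simp only [add_zero]
        rw [hev.deriv_eq, deriv_comp_mul_left k⁻¹ (fun s => Φ (ι v, s)), mul_zero, hd.deriv]
        simp [ι, smul_smul, hkpos.ne']
    have := hst.expMap_smul isOpen_Ioo ordConnected_Ioo (by norm_num) (t := 1) (by norm_num)
    simpa using this
  have hk1 : k⁻¹ ∈ Ioo (-δ) δ := by
    rw [hk, inv_div]
    constructor <;> linarith
  have hpar := isParam_coordInv (m := m) P
  have hsm : ContMDiffOn (𝓡 m) (𝓡 m) ∞ (expMap g P) O := by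
    have h1 : ContDiffOn ℝ ∞ (fun v => Φ (ι v, k⁻¹)) O :=
      hΦ.comp (hι.prodMk contDiff_const).contDiffOn fun v hv => ⟨hv, hk1⟩
    refine (hpar.contMDiffOn.comp (contMDiffOn_iff_contDiffOn.2 h1)
      fun v hv => (hflow _ hv).2.2.1 _ hk1).congr fun v hv => (hexp v hv).2
  have hsubO : O ⊆ expDomain g P := fun v hv => (hexp v hv).1
  have h0dom := hsubO h0O
  have hsmat : MDifferentiableAt (𝓡 m) (𝓡 m) (expMap g P) 0 :=
    (hsm.contMDiffAt (hO.mem_nhds h0O)).mdifferentiableAt (by simp)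
  have hcsm : DifferentiableAt ℝ (coord m P ∘ expMap g P) 0 := by
    rw [← mdifferentiableAt_iff_differentiableAt]
    refine MDifferentiableAt.comp (0 : 𝔼 m) ?_ hsmat
    rw [expMap_zero h0dom]
    exact mdifferentiableAt_extChartAt (mem_chart_source _ _)
  have hfd := fderiv_coord_expMap_zero hO h0O hsubO hcsm
  have hinj : Function.Injective (dpar (expMap g P) 0) := by
    intro u v huv
    have hmd : MDifferentiableAt (𝓡 m) (𝓡 m) (coord m P) (expMap g P (0 : 𝔼 m)) := by
      rw [expMap_zero h0dom]
      exact mdifferentiableAt_extChartAt (mem_chart_source _ _)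
    have hcomp := mfderiv_comp (0 : 𝔼 m) hmd hsmat
    rw [mfderiv_eq_fderiv, hfd] at hcomp
    have hu : ∀ u : 𝔼 m, u = mfderiv (𝓡 m) (𝓡 m) (coord m P) (expMap g P (0 : 𝔼 m))
      (dpar (expMap g P) 0 u) := fun u => congrArg (fun L : (𝔼 m) →L[ℝ] (𝔼 m) => L u) hcomp
    rw [hu u, hu v, huv]
  have hld := isLocalDiffeomorphAt_of_injective hO hsm h0O hinj
  obtain ⟨u, hu, huinj⟩ := exists_injOn_of_isLocalDiffeomorphAt hld
  have hmem : interior u ∩ O ∩ {x | IsLocalDiffeomorphAt (𝓡 m) (𝓡 m) ∞ (expMap g P) x} ∈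
      𝓝 (0 : 𝔼 m) :=
    Filter.inter_mem (Filter.inter_mem (interior_mem_nhds.2 hu) (hO.mem_nhds h0O))
      ((isOpen_isLocalDiffeomorphAt _).mem_nhds hld)
  obtain ⟨R, hR, hsub⟩ := exists_tangentBall_subset g P
    ((isOpen_interior.inter hO).inter (isOpen_isLocalDiffeomorphAt (expMap g P))) le_rfl (by
      intro v hv
      have hv0 : v = 0 := by
        by_contra hne
        exact absurd (tnorm_pos g P hne) (not_lt.2 hv)
      rw [hv0]
      exact mem_of_mem_nhds hmem)
  have hgood : GoodRadius g P (ENNReal.ofReal R) :=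
    ⟨fun v hv => hsubO (hsub hv).1.2, huinj.mono fun v hv => interior_subset (hsub hv).1.1,
      fun v => (hsub v.2).2⟩
  exact lt_of_lt_of_le (ENNReal.ofReal_pos.2 hR) hgood.le

end Exp

/-! ### The Gauss lemma. -/

section Gauss

variable {m : ℕ} {M : Type*} [TopologicalSpace M]
  [ChartedSpace (EuclideanSpace ℝ (Fin m)) M] [IsManifold (𝓡 m) ∞ M]

local notation "𝔼" m => EuclideanSpace ℝ (Fin m)

theorem smul_mem_tangentBall {g : RiemMetric m M} {P : M} {R : ℝ≥0∞} {v : 𝔼 m}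
    (hv : v ∈ tangentBall g P R) {t : ℝ} (ht : |t| ≤ 1) : t • v ∈ tangentBall g P R := by
  rw [mem_tangentBall, tnorm_smul] at *
  refine lt_of_le_of_lt (ENNReal.ofReal_le_ofReal ?_) hv
  exact mul_le_of_le_one_left (tnorm_nonneg g P v) ht

theorem smul_mem_tangentBall' {g : RiemMetric m M} {P : M} {R : ℝ≥0∞} {v : 𝔼 m}
    (hv : v ∈ tangentBall g P R) {t : ℝ} (ht : t ∈ Icc (0 : ℝ) 1) : t • v ∈ tangentBall g P R :=
  smul_mem_tangentBall hv (by rw [abs_of_nonneg ht.1]; exact ht.2)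

theorem zero_mem_tangentBall {g : RiemMetric m M} {P : M} {R : ℝ≥0∞} {v : 𝔼 m}
    (hv : v ∈ tangentBall g P R) : (0 : 𝔼 m) ∈ tangentBall g P R := by
  simpa using smul_mem_tangentBall hv (t := 0) (by simp)

theorem dpar_eq_fderiv {f : (𝔼 m) → M} {x : 𝔼 m} (h : MDifferentiableAt (𝓡 m) (𝓡 m) f x) :
    dpar f x = fderiv ℝ (coord m (f x) ∘ f) x := by
  have := h.mfderiv
  simp only [writtenInExtChartAt, extChartAt_model_space_eq_id, PartialEquiv.refl_symm,
    PartialEquiv.refl_coe, ModelWithCorners.range_eq_univ, fderivWithin_univ] at this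
  exact this

theorem hasDerivAt_smul_curve (v : 𝔼 m) (t : ℝ) : HasDerivAt (fun t : ℝ => t • v) v t := by
  simpa using (hasDerivAt_id t).smul_const v

theorem deriv_smul_curve (v : 𝔼 m) : (deriv fun t : ℝ => t • v) = fun _ => v :=
  funext fun t => (hasDerivAt_smul_curve v t).deriv

variable [T2Space M] {g : RiemMetric m M} {P : M} {R : ℝ≥0∞}

/-- Straight lines through the origin are geodesics of the pulled-back metric. -/
theorem GoodRadius.chr_ray (h : GoodRadius g P R) {v : 𝔼 m} (hv : v ∈ tangentBall g P R)
    {t : ℝ} (ht : t ∈ Icc (0 : ℝ) 1) (w : 𝔼 m) :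
    chr (pull g (expMap g P)) (t • v) v v w = 0 := by
  obtain ⟨ε, hε, hst, -⟩ := exists_ray (h.subset hv)
  have htJ : t ∈ Ioo (-ε) (1 + ε) := ⟨by linarith [ht.1], by linarith [ht.2]⟩
  have hg := ((isGeodesicOn_iff g _ _).1 hst.1).2 t htJ
  have h1 := (geodAt_iff g h.isParam (c := fun t : ℝ => t • v) (smul_mem_tangentBall' hv ht)
    (by fun_prop) (Filter.EventuallyEq.rfl)).1 hg w
  rw [geodExpr, deriv_smul_curve, deriv_const'] at h1
  simpa using h1

theorem GoodRadius.expMap_zero (h : GoodRadius g P R) {v : 𝔼 m} (hv : v ∈ tangentBall g P R) :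
    expMap g P (0 : 𝔼 m) = P :=
  RiemGeom.expMap_zero (h.subset (zero_mem_tangentBall hv))

theorem GoodRadius.pull_zero (h : GoodRadius g P R) {v : 𝔼 m} (hv : v ∈ tangentBall g P R) :
    pull g (expMap g P) 0 = form g P := by
  have h0 := zero_mem_tangentBall hv
  have hF := h.expMap_zero hv
  have hmd := h.isParam.mdifferentiableAt h0
  have hd : DifferentiableAt ℝ (coord m P ∘ expMap g P) 0 := by
    rw [← mdifferentiableAt_iff_differentiableAt]
    refine MDifferentiableAt.comp (0 : 𝔼 m) ?_ hmd
    rw [hF]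
    exact mdifferentiableAt_extChartAt (mem_chart_source _ _)
  have h1 := dpar_eq_fderiv hmd
  rw [hF, fderiv_coord_expMap_zero (isOpen_tangentBall g P R) h0 h.subset hd] at h1
  ext u w
  rw [pull_apply, h1, hF]
  rfl

theorem hasDerivAt_pull_ray (h : GoodRadius g P R) {v : 𝔼 m} {t : ℝ}
    (hv : t • v ∈ tangentBall g P R) (u w : 𝔼 m) :
    HasDerivAt (fun t : ℝ => pull g (expMap g P) (t • v) u w)
      (fderiv ℝ (pull g (expMap g P)) (t • v) v u w) t := by
  have hd := h.isParam.differentiableAt_pull g hv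
  rw [← fderiv_apply₂ hd]
  have hd2 : DifferentiableAt ℝ (fun z => pull g (expMap g P) z u w) (t • v) :=
    (hd.clm_apply (differentiableAt_const u)).clm_apply (differentiableAt_const w)
  exact HasFDerivAt.comp_hasDerivAt t (l := fun z => pull g (expMap g P) z u w)
    hd2.hasFDerivAt (hasDerivAt_smul_curve v t)

theorem eq_of_hasDerivAt_zero {k : ℝ → ℝ} (hk : ∀ t ∈ Icc (0 : ℝ) 1, HasDerivAt k 0 t) {t : ℝ}
    (ht : t ∈ Icc (0 : ℝ) 1) : k t = k 0 :=
  constant_of_has_deriv_right_zero (fun s hs => (hk s hs).continuousAt.continuousWithinAt)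
    (fun s hs => (hk s (Ico_subset_Icc_self hs)).hasDerivWithinAt) t ht

/-- With three equal arguments `chr` is half the derivative of the squared speed along the ray; so
the speed is constant, and its value is read off at the origin. -/
theorem GoodRadius.pull_ray (h : GoodRadius g P R) {v : 𝔼 m} (hv : v ∈ tangentBall g P R)
    {t : ℝ} (ht : t ∈ Icc (0 : ℝ) 1) : pull g (expMap g P) (t • v) v v = form g P v v := by
  have hk : ∀ t ∈ Icc (0 : ℝ) 1,
      HasDerivAt (fun t : ℝ => pull g (expMap g P) (t • v) v v) 0 t := by
    intro t ht
    have h1 := hasDerivAt_pull_ray h (smul_mem_tangentBall' hv ht) v v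
    have h2 := h.chr_ray hv ht v
    rw [chr] at h2
    have h3 : fderiv ℝ (pull g (expMap g P)) (t • v) v v v = 0 := by linarith
    rwa [h3] at h1
  have := eq_of_hasDerivAt_zero hk ht
  rw [this, zero_smul, h.pull_zero hv]

theorem GoodRadius.pull_self (h : GoodRadius g P R) {v : 𝔼 m} (hv : v ∈ tangentBall g P R) :
    pull g (expMap g P) v v v = form g P v v := by
  simpa using h.pull_ray hv (t := 1) (by simp)

/-- The Gauss lemma. -/
theorem GoodRadius.gauss (h : GoodRadius g P R) {v : 𝔼 m} (hv : v ∈ tangentBall g P R)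
    (w : 𝔼 m) : pull g (expMap g P) v v w = form g P v w := by
  set G := pull g (expMap g P) with hG
  have hB := isOpen_tangentBall g P R
  -- This is the derivative of the identity `G y y y = form g P y y` at `y = t v` in the direction
  -- `w`.
  have hrad : ∀ t ∈ Icc (0 : ℝ) 1,
      t ^ 2 * fderiv ℝ G (t • v) w v v + 2 * t * G (t • v) v w = 2 * t * form g P v w := by
    intro t ht
    have hm := smul_mem_tangentBall' hv ht
    have hd := h.isParam.differentiableAt_pull g hm
    have hev : (fun y => G y y y) =ᶠ[𝓝 (t • v)] fun y => form g P y y := by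
      filter_upwards [hB.mem_nhds hm] with y hy
      exact h.pull_self hy
    have hid := hasFDerivAt_id (𝕜 := ℝ) (t • v)
    have h1 : HasFDerivAt (fun y => G y y y) _ (t • v) :=
      (hd.hasFDerivAt.clm_apply hid).clm_apply hid
    have h2 : HasFDerivAt (fun y => form g P y y) _ (t • v) :=
      ((form g P).hasFDerivAt.clm_apply hid)
    have h3 := congrArg (fun L : (𝔼 m) →L[ℝ] ℝ => L w) ((h1.congr_of_eventuallyEq hev.symm).unique h2)
    simp at h3
    rw [pull_symm g _ _ w, form_symm g P w v] at h3
    linarith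
  -- The geodesic equation gives `D_v G(v, w) = D_w G(v, v) / 2`. Together with `hrad` this makes `t
  -- (G(t v)(v, w) - form g P v w)` constant, and it vanishes at `t = 0`.
  have hk : ∀ t ∈ Icc (0 : ℝ) 1,
      HasDerivAt (fun t : ℝ => t * G (t • v) v w - t * form g P v w) 0 t := by
    intro t ht
    have hm := smul_mem_tangentBall' hv ht
    have h1 := ((hasDerivAt_id t).mul (hasDerivAt_pull_ray h hm v w)).sub
      ((hasDerivAt_id t).mul_const (form g P v w))
    refine h1.congr_deriv ?_
    have h2 := h.chr_ray hv ht w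
    rw [chr] at h2
    rcases eq_or_ne t 0 with rfl | ht0
    · have := h.pull_zero hv
      simp [this]
    · have h3 := hrad t ht
      have h4 : t * fderiv ℝ G (t • v) w v v + 2 * G (t • v) v w = 2 * form g P v w := by
        refine mul_left_cancel₀ ht0 ?_
        linarith
      simp only [id]
      rw [← hG] at *
      have h5 : fderiv ℝ G (t • v) v v w = fderiv ℝ G (t • v) w v v / 2 := by linarith
      rw [h5]
      linarith
  have := eq_of_hasDerivAt_zero hk (t := 1) (by simp)
  simp at this
  linarith

end Gauss

/-! ### Lengths of curves and the distance. -/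

section Length

variable {m : ℕ} {M : Type*} [TopologicalSpace M]
  [ChartedSpace (EuclideanSpace ℝ (Fin m)) M] [IsManifold (𝓡 m) ∞ M]

local notation "𝔼" m => EuclideanSpace ℝ (Fin m)

/-- The velocity of a curve. -/
def velocity (m : ℕ) {M : Type*} [TopologicalSpace M] [ChartedSpace (EuclideanSpace ℝ (Fin m)) M]
    (γ : ℝ → M) (t : ℝ) : 𝔼 m := mfderiv 𝓘(ℝ, ℝ) (𝓡 m) γ t (1 : ℝ)

theorem gEDist_le_lintegral (g : RiemMetric m M) {γ : ℝ → M}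
    (hγ : ContMDiffOn 𝓘(ℝ, ℝ) (𝓡 m) 1 γ (Icc 0 1)) :
    gEDist g (γ 0) (γ 1) ≤
      ∫⁻ t in Icc (0 : ℝ) 1, ENNReal.ofReal (tnorm g (γ t) (velocity m γ t)) := by
  let : RiemannianBundle (fun x : M => TangentSpace (𝓡 m) x) := ⟨g.toRiemannianMetric⟩
  refine (Manifold.riemannianEDist_le_pathELength hγ rfl rfl zero_le_one).trans_eq ?_
  rw [pathELength_eq_lintegral_mfderiv_Icc]
  refine MeasureTheory.lintegral_congr fun t => ?_
  rw [← ofReal_norm, norm_eq_sqrt_real_inner]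
  rfl

theorem exists_path_of_gEDist_lt {g : RiemMetric m M} {P Q : M} {r : ℝ≥0∞}
    (h : gEDist g P Q < r) : ∃ γ : ℝ → M, γ 0 = P ∧ γ 1 = Q ∧ ContMDiff 𝓘(ℝ, ℝ) (𝓡 m) 1 γ ∧
      ∫⁻ t in Icc (0 : ℝ) 1, ENNReal.ofReal (tnorm g (γ t) (velocity m γ t)) < r := by
  let : RiemannianBundle (fun x : M => TangentSpace (𝓡 m) x) := ⟨g.toRiemannianMetric⟩
  obtain ⟨γ, h0, h1, hγ, hlt, -, -⟩ :=
    Manifold.exists_lt_locally_constant_of_riemannianEDist_lt h zero_lt_one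
  refine ⟨γ, h0, h1, hγ, lt_of_eq_of_lt ?_ hlt⟩
  rw [pathELength_eq_lintegral_mfderiv_Icc]
  refine MeasureTheory.lintegral_congr fun t => ?_
  rw [← ofReal_norm, norm_eq_sqrt_real_inner]
  rfl

theorem gEDist_triangle (g : RiemMetric m M) (P Q S : M) :
    gEDist g P S ≤ gEDist g P Q + gEDist g Q S := by
  let : RiemannianBundle (fun x : M => TangentSpace (𝓡 m) x) := ⟨g.toRiemannianMetric⟩
  exact Manifold.riemannianEDist_triangle

theorem gEDist_comm (g : RiemMetric m M) (P Q : M) : gEDist g P Q = gEDist g Q P := by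
  let : RiemannianBundle (fun x : M => TangentSpace (𝓡 m) x) := ⟨g.toRiemannianMetric⟩
  exact Manifold.riemannianEDist_comm

theorem gEDist_self (g : RiemMetric m M) (P : M) : gEDist g P P = 0 := by
  let : RiemannianBundle (fun x : M => TangentSpace (𝓡 m) x) := ⟨g.toRiemannianMetric⟩
  exact Manifold.riemannianEDist_self

theorem velocity_comp {f : (𝔼 m) → M} {c : ℝ → 𝔼 m} {γ : ℝ → M} {t : ℝ}
    (hf : MDifferentiableAt (𝓡 m) (𝓡 m) f (c t)) (hc : DifferentiableAt ℝ c t)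
    (hγ : γ =ᶠ[𝓝 t] f ∘ c) : velocity m γ t = dpar f (c t) (deriv c t) := by
  have h := mfderiv_comp t hf hc.mdifferentiableAt
  rw [mfderiv_eq_fderiv] at h
  have h1 : mfderiv 𝓘(ℝ, ℝ) (𝓡 m) γ t = mfderiv 𝓘(ℝ, ℝ) (𝓡 m) (f ∘ c) t := hγ.mfderiv_eq
  have h2 := h1.trans h
  exact congrArg (fun L : ℝ →L[ℝ] (𝔼 m) => L 1) h2

theorem tnorm_velocity (g : RiemMetric m M) {f : (𝔼 m) → M} {c : ℝ → 𝔼 m} {γ : ℝ → M} {t : ℝ}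
    (hf : MDifferentiableAt (𝓡 m) (𝓡 m) f (c t)) (hc : DifferentiableAt ℝ c t)
    (hγ : γ =ᶠ[𝓝 t] f ∘ c) :
    tnorm g (γ t) (velocity m γ t) = √(pull g f (c t) (deriv c t) (deriv c t)) := by
  rw [velocity_comp hf hc hγ, pull_apply, hγ.eq_of_nhds]
  rfl

theorem abs_form_le (g : RiemMetric m M) (P : M) (u w : 𝔼 m) :
    |form g P u w| ≤ tnorm g P u * tnorm g P w := by
  by_cases hu : u = 0
  · simp [hu]
  have h1 := form_pos g P hu
  have h2 := form_self_nonneg g P (w - (form g P u w / form g P u u) • u)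
  have h3 : form g P (w - (form g P u w / form g P u u) • u)
      (w - (form g P u w / form g P u u) • u) =
      form g P w w - form g P u w ^ 2 / form g P u u := by
    simp only [map_sub, map_smul, sub_apply, smul_apply, smul_eq_mul]
    rw [form_symm g P w u]
    field_simp
    ring
  rw [h3, sub_nonneg, div_le_iff₀ h1] at h2
  refine abs_le_of_sq_le_sq ?_ (mul_nonneg (tnorm_nonneg g P u) (tnorm_nonneg g P w))
  rw [mul_pow, tnorm_sq, tnorm_sq]
  linarith

end Length

/-! ### Smoothness of the inverse of an injective local diffeomorphism. -/

section Inverse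

variable {m : ℕ} {M : Type*} [TopologicalSpace M]
  [ChartedSpace (EuclideanSpace ℝ (Fin m)) M] [IsManifold (𝓡 m) ∞ M]

local notation "𝔼" m => EuclideanSpace ℝ (Fin m)

theorem invFunOn_apply_eq {f : (𝔼 m) → M} {U : Set (𝔼 m)} (hinj : InjOn f U) {x : 𝔼 m}
    (hx : x ∈ U) : Function.invFunOn f U (f x) = x :=
  hinj (Function.invFunOn_mem ⟨x, hx, rfl⟩) hx (Function.invFunOn_eq ⟨x, hx, rfl⟩)

theorem contMDiffAt_invFunOn {f : (𝔼 m) → M} {U : Set (𝔼 m)} (hU : IsOpen U) (hinj : InjOn f U)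
    {x : 𝔼 m} (hx : x ∈ U) (h : IsLocalDiffeomorphAt (𝓡 m) (𝓡 m) ∞ f x) :
    ContMDiffAt (𝓡 m) (𝓡 m) ∞ (Function.invFunOn f U) (f x) ∧ ∀ᶠ q in 𝓝 (f x), q ∈ f '' U := by
  obtain ⟨Φ, hxΦ, heq⟩ := h
  have hfx : f x ∈ Φ.target := by
    rw [heq hxΦ]
    exact Φ.map_source hxΦ
  have hsm : ContMDiffAt (𝓡 m) (𝓡 m) ∞ Φ.invFun (f x) :=
    Φ.contMDiffOn_invFun.contMDiffAt (Φ.open_target.mem_nhds hfx)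
  have hval : Φ.invFun (f x) = x := by
    rw [heq hxΦ]
    exact Φ.left_inv hxΦ
  have hev : ∀ᶠ q in 𝓝 (f x), q ∈ Φ.target ∧ Φ.invFun q ∈ U :=
    Filter.Eventually.and (Φ.open_target.mem_nhds hfx)
      (hsm.continuousAt.eventually_mem (by rw [hval]; exact hU.mem_nhds hx))
  have hf : ∀ q ∈ Φ.target, f (Φ.invFun q) = q := fun q hq => by
    exact (heq (Φ.map_target hq)).trans (Φ.right_inv hq)
  refine ⟨hsm.congr_of_eventuallyEq ?_, ?_⟩
  · filter_upwards [hev] with q hq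
    have := invFunOn_apply_eq hinj hq.2
    rwa [hf q hq.1] at this
  · filter_upwards [hev] with q hq
    exact ⟨_, hq.2, hf q hq.1⟩

end Inverse

/-! ### Distance from `P` inside the injectivity ball. -/

section Distance

variable {m : ℕ} {M : Type*} [TopologicalSpace M]
  [ChartedSpace (EuclideanSpace ℝ (Fin m)) M] [IsManifold (𝓡 m) ∞ M]

local notation "𝔼" m => EuclideanSpace ℝ (Fin m)

variable [T2Space M] {g : RiemMetric m M} {P : M} {R : ℝ≥0∞}

theorem GoodRadius.isOpen_image (h : GoodRadius g P R) {O : Set (𝔼 m)} (hO : IsOpen O)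
    (hsub : O ⊆ tangentBall g P R) : IsOpen (expMap g P '' O) := by
  rw [isOpen_iff_mem_nhds]
  rintro _ ⟨x, hx, rfl⟩
  exact (contMDiffAt_invFunOn hO (h.injOn.mono hsub) hx (h.isLocalDiffeomorphOn ⟨x, hsub hx⟩)).2

theorem GoodRadius.gEDist_le (h : GoodRadius g P R) {v : 𝔼 m} (hv : v ∈ tangentBall g P R) :
    gEDist g P (expMap g P v) ≤ ENNReal.ofReal (tnorm g P v) := by
  have hsm : ContMDiffOn 𝓘(ℝ, ℝ) (𝓡 m) 1 (fun t : ℝ => expMap g P (t • v)) (Icc 0 1) := by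
    refine ContMDiffOn.comp (t := tangentBall g P R) (g := expMap g P) (f := fun t : ℝ => t • v)
      (h.isParam.contMDiffOn.of_le (by simp)) ?_
      fun t ht => smul_mem_tangentBall' hv ht
    rw [contMDiffOn_iff_contDiffOn]
    fun_prop
  have h1 := gEDist_le_lintegral g hsm
  simp only [zero_smul, one_smul, h.expMap_zero hv] at h1
  refine h1.trans ?_
  have h2 : ∫⁻ t in Icc (0 : ℝ) 1, ENNReal.ofReal (tnorm g (expMap g P (t • v))
      (velocity m (fun t : ℝ => expMap g P (t • v)) t)) =
      ∫⁻ _ in Icc (0 : ℝ) 1, ENNReal.ofReal (tnorm g P v) := by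
    refine MeasureTheory.setLIntegral_congr_fun measurableSet_Icc fun t ht => ?_
    have hm := smul_mem_tangentBall' hv ht
    have h3 := tnorm_velocity g (f := expMap g P) (c := fun t : ℝ => t • v)
      (γ := fun t : ℝ => expMap g P (t • v)) (t := t)
      (h.isParam.mdifferentiableAt hm) (hasDerivAt_smul_curve v t).differentiableAt
      Filter.EventuallyEq.rfl
    simp only [deriv_smul_curve, h.pull_ray hv ht] at h3
    change ENNReal.ofReal (tnorm g (expMap g P (t • v)) _) = _
    rw [h3, tnorm]
  rw [h2]
  simp

/-- A path which leaves the image of the ball of radius `s` has length at least `s`. -/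
theorem GoodRadius.le_gEDist (h : GoodRadius g P R) {s : ℝ} (hs : 0 ≤ s)
    (hsR : ENNReal.ofReal s < R) {Q : M}
    (hQ : Q ∉ expMap g P '' {v : 𝔼 m | tnorm g P v < s}) :
    ENNReal.ofReal s ≤ gEDist g P Q := by
  refine le_of_forall_gt fun L hL => ?_
  obtain ⟨γ, h0, h1, hγ, hlt⟩ := exists_path_of_gEDist_lt hL
  refine lt_of_le_of_lt ?_ hlt
  rcases hs.eq_or_lt with rfl | hs
  · simp
  set B := tangentBall g P R with hBdef
  have hBo : IsOpen B := isOpen_tangentBall g P R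
  set F := expMap g P with hF
  have hKB : {v : 𝔼 m | tnorm g P v ≤ s} ⊆ B := fun v hv =>
    lt_of_le_of_lt (ENNReal.ofReal_le_ofReal hv) hsR
  have hO : IsOpen {v : 𝔼 m | tnorm g P v < s} := isOpen_lt (continuous_tnorm g P) continuous_const
  have hOK : {v : 𝔼 m | tnorm g P v < s} ⊆ {v : 𝔼 m | tnorm g P v ≤ s} :=
    fun v hv => mem_ofPred.2 (le_of_lt (mem_ofPred.1 hv))
  have hFO := h.isOpen_image hO (hOK.trans hKB)
  -- A compact image is closed in a Hausdorff space; this keeps the path in the image of the closed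
  -- ball up to and including the exit time.
  have hFK : IsClosed (F '' {v : 𝔼 m | tnorm g P v ≤ s}) :=
    ((isCompact_tnorm_le g P s).image_of_continuousOn
      (h.isParam.contMDiffOn.continuousOn.mono hKB)).isClosed
  have h0B : (0 : 𝔼 m) ∈ B := hKB (by simp [hs.le])
  have hF0 : F 0 = P := h.expMap_zero h0B
  let T := Icc (0 : ℝ) 1 ∩ γ ⁻¹' (F '' {v : 𝔼 m | tnorm g P v < s})ᶜ
  have hT : IsCompact T := isCompact_Icc.inter_right (hFO.isClosed_compl.preimage hγ.continuous)
  -- `t₀` is the first time at which the path is outside the image of the open ball. On `[0, t₀]`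
  -- the path is lifted through `F` to a curve `c` from `0` to the sphere of radius `s`.
  obtain ⟨t₀, ⟨ht₀, hout⟩, hmin⟩ := hT.exists_isLeast ⟨1, by simp, by
    rw [mem_preimage, h1]; exact hQ⟩
  have hin : ∀ t ∈ Ico 0 t₀, γ t ∈ F '' {v : 𝔼 m | tnorm g P v < s} := by
    intro t ht
    by_contra hne
    exact absurd (hmin ⟨⟨ht.1, ht.2.le.trans ht₀.2⟩, hne⟩) (not_le.2 ht.2)
  have hpos : 0 < t₀ := by
    rcases ht₀.1.eq_or_lt with h | h
    · refine absurd ⟨0, by simpa using hs, ?_⟩ hout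
      rw [hF0, ← h0, h]
    · exact h
  have hinK : ∀ t ∈ Icc 0 t₀, γ t ∈ F '' {v : 𝔼 m | tnorm g P v ≤ s} := by
    have hcl : IsClosed (γ ⁻¹' (F '' {v : 𝔼 m | tnorm g P v ≤ s})) := hFK.preimage hγ.continuous
    have hsub : Ico 0 t₀ ⊆ γ ⁻¹' (F '' {v : 𝔼 m | tnorm g P v ≤ s}) := fun t ht =>
      image_mono hOK (hin t ht)
    have := hcl.closure_subset_iff.2 hsub
    rwa [closure_Ico hpos.ne] at this
  let c : ℝ → 𝔼 m := fun t => Function.invFunOn F B (γ t)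
  have hcx : ∀ t ∈ Icc 0 t₀, tnorm g P (c t) ≤ s ∧ F (c t) = γ t := by
    intro t ht
    obtain ⟨x, hx, hxt⟩ := hinK t ht
    have : c t = x := by
      change Function.invFunOn F B (γ t) = x
      rw [← hxt]
      exact invFunOn_apply_eq h.injOn (hKB hx)
    rw [this]
    exact ⟨hx, hxt⟩
  have hcB : ∀ t ∈ Icc 0 t₀, c t ∈ B := fun t ht => hKB (hcx t ht).1
  have hinv : ∀ t ∈ Icc 0 t₀, ContMDiffAt (𝓡 m) (𝓡 m) ∞ (Function.invFunOn F B) (γ t) ∧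
      ∀ᶠ q in 𝓝 (γ t), q ∈ F '' B := fun t ht => by
    rw [← (hcx t ht).2]
    exact contMDiffAt_invFunOn hBo h.injOn (hcB t ht) (h.isLocalDiffeomorphOn ⟨_, hcB t ht⟩)
  have hcsm : ∀ t ∈ Icc 0 t₀, ContDiffAt ℝ 1 c t := fun t ht => by
    rw [← contMDiffAt_iff_contDiffAt]
    exact ((hinv t ht).1.of_le (by simp)).comp t hγ.contMDiffAt
  have hγc : ∀ t ∈ Icc 0 t₀, γ =ᶠ[𝓝 t] F ∘ c := fun t ht => by
    filter_upwards [hγ.continuous.continuousAt.eventually (hinv t ht).2] with τ hτ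
    exact (Function.invFunOn_eq hτ).symm
  have hct₀ : tnorm g P (c t₀) = s := by
    have h2 := hcx t₀ ⟨hpos.le, le_rfl⟩
    refine le_antisymm h2.1 (not_lt.1 fun h3 => hout ⟨c t₀, h3, h2.2⟩)
  have hc0 : c 0 = 0 := by
    change Function.invFunOn F B (γ 0) = 0
    rw [h0, ← hF0]
    exact invFunOn_apply_eq h.injOn h0B
  refine ENNReal.le_of_forall_pos_le_add fun ε hε _ => ?_
  have hε' : (0 : ℝ) < ε := hε
  -- The radius `|c|` need not be differentiable where `c` vanishes; `√(ε² + |c|²)` is. The Gauss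
  -- lemma and Cauchy–Schwarz bound its derivative by the speed of `γ`, and its increment is at
  -- least `s - ε`.
  let φ : ℝ → ℝ := fun t => √((ε : ℝ) ^ 2 + form g P (c t) (c t))
  have harg : ∀ t, 0 < (ε : ℝ) ^ 2 + form g P (c t) (c t) := fun t =>
    add_pos_of_pos_of_nonneg (by positivity) (form_self_nonneg g P _)
  have hform : ∀ t ∈ Icc 0 t₀, ContDiffAt ℝ 1 (fun t => form g P (c t) (c t)) t := fun t ht =>
    (((ContinuousLinearMap.contDiff (form g P)).contDiffAt.comp t (hcsm t ht)).clm_apply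
      (hcsm t ht))
  have hφ : ∀ t ∈ Icc 0 t₀, ContDiffAt ℝ 1 φ t := fun t ht =>
    (contDiffAt_const.add (hform t ht)).sqrt (harg t).ne'
  have hφ' : ∀ t ∈ Icc 0 t₀, |deriv φ t| ≤ tnorm g (γ t) (velocity m γ t) := by
    intro t ht
    have hcd := ((hcsm t ht).differentiableAt (by simp)).hasDerivAt
    have h2 : HasDerivAt (fun t => form g P (c t) (c t)) _ t :=
      (((form g P).hasFDerivAt.comp_hasDerivAt t hcd).clm_apply hcd)
    have h3 := ((h2.const_add ((ε : ℝ) ^ 2)).sqrt (harg t).ne').deriv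
    have h4 : deriv φ t = form g P (c t) (deriv c t) / φ t := by
      refine h3.trans ?_
      change (form g P (deriv c t) (c t) + form g P (c t) (deriv c t)) / (2 * φ t) = _
      rw [form_symm g P (deriv c t)]
      ring
    rw [tnorm_velocity g (h.isParam.mdifferentiableAt (hcB t ht))
      ((hcsm t ht).differentiableAt (by simp)) (hγc t ht), h4, ← h.gauss (hcB t ht), abs_div]
    have hφpos : 0 < φ t := Real.sqrt_pos.2 (harg t)
    rw [abs_of_pos hφpos, div_le_iff₀ hφpos, pull_apply]
    refine (abs_form_le g _ _ _).trans ?_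
    rw [mul_comm]
    refine mul_le_mul_of_nonneg_left ?_ (Real.sqrt_nonneg _)
    rw [tnorm, ← pull_apply, h.pull_self (hcB t ht)]
    exact Real.sqrt_le_sqrt (by nlinarith)
  have h2 := enorm_sub_le_lintegral_derivWithin_Icc_of_contDiffOn_Icc
    (f := φ) (a := 0) (b := t₀) (fun t ht => (hφ t ht).contDiffWithinAt) hpos.le
  have h3 : ∫⁻ t in Icc 0 t₀, ‖derivWithin φ (Icc 0 t₀) t‖ₑ ≤
      ∫⁻ t in Icc (0 : ℝ) 1, ENNReal.ofReal (tnorm g (γ t) (velocity m γ t)) := by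
    refine le_trans (MeasureTheory.setLIntegral_mono' measurableSet_Icc fun t ht => ?_)
      (MeasureTheory.lintegral_mono_set (Icc_subset_Icc_right ht₀.2))
    rw [((hφ t ht).differentiableAt (by simp)).derivWithin (uniqueDiffOn_Icc hpos t ht),
      Real.enorm_eq_ofReal_abs]
    exact ENNReal.ofReal_le_ofReal (hφ' t ht)
  have h4 : s ≤ |φ t₀ - φ 0| + ε := by
    have h5 : φ 0 = ε := by simp [φ, hc0]
    have h6 : s ≤ φ t₀ := by
      rw [← hct₀, tnorm]
      exact Real.sqrt_le_sqrt (by nlinarith)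
    rw [h5]
    linarith [le_abs_self (φ t₀ - ε)]
  calc ENNReal.ofReal s ≤ ENNReal.ofReal (|φ t₀ - φ 0| + ε) := ENNReal.ofReal_le_ofReal h4
    _ = ‖φ t₀ - φ 0‖ₑ + ε := by
      rw [ENNReal.ofReal_add (abs_nonneg _) hε'.le, Real.enorm_eq_ofReal_abs,
        ENNReal.ofReal_coe_nnreal]
    _ ≤ _ := by gcongr; exact h2.trans h3

/-- The ray gives the upper bound. For the lower bound, injectivity keeps `exp_P v` outside the
image of the open ball of radius `|v|`. -/
theorem GoodRadius.gEDist_expMap (h : GoodRadius g P R) {v : 𝔼 m} (hv : v ∈ tangentBall g P R) :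
    gEDist g P (expMap g P v) = ENNReal.ofReal (tnorm g P v) := by
  refine le_antisymm (h.gEDist_le hv) (h.le_gEDist (tnorm_nonneg g P v) hv ?_)
  rintro ⟨w, hw, hwv⟩
  have hwB : w ∈ tangentBall g P R := lt_of_le_of_lt (ENNReal.ofReal_le_ofReal (le_of_lt hw)) hv
  rw [h.injOn hwB hv hwv] at hw
  exact lt_irrefl (tnorm g P v) hw

theorem GoodRadius.mem_image (h : GoodRadius g P R) {Q : M} (hQ : gEDist g P Q < R) :
    Q ∈ expMap g P '' tangentBall g P R := by
  by_contra hne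
  have hfin : gEDist g P Q ≠ ⊤ := (lt_of_lt_of_le hQ le_top).ne
  obtain ⟨s, hs1, hs2⟩ := ENNReal.lt_iff_exists_nnreal_btwn.1 hQ
  have hs : ENNReal.ofReal (s : ℝ) = s := ENNReal.ofReal_coe_nnreal
  refine absurd (h.le_gEDist (s := s) s.2 (by rwa [hs]) (Q := Q) ?_) (by rw [hs]; exact not_le.2 hs1)
  rintro ⟨w, hw, rfl⟩
  refine hne ⟨w, lt_of_le_of_lt (ENNReal.ofReal_le_ofReal (le_of_lt hw)) (by rwa [hs]), rfl⟩

theorem gEDist_expMap {v : 𝔼 m} (hv : v ∈ tangentBall g P (injRadius g P)) :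
    gEDist g P (expMap g P v) = ENNReal.ofReal (tnorm g P v) :=
  (goodRadius_injRadius g P).gEDist_expMap hv

theorem gDist_expMap {v : 𝔼 m} (hv : v ∈ tangentBall g P (injRadius g P)) :
    gDist g P (expMap g P v) = tnorm g P v := by
  rw [gDist, gEDist_expMap hv, ENNReal.toReal_ofReal (tnorm_nonneg g P v)]

theorem injBall_eq (g : RiemMetric m M) (P : M) :
    injBall g P = expMap g P '' tangentBall g P (injRadius g P) := by
  refine Subset.antisymm (fun Q hQ => (goodRadius_injRadius g P).mem_image hQ) ?_
  rintro _ ⟨v, hv, rfl⟩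
  change gEDist g P _ < _
  rw [gEDist_expMap hv]
  exact hv

/-- In a connected manifold the distance is finite. -/
theorem gEDist_lt_top [ConnectedSpace M] (g : RiemMetric m M) (P Q : M) : gEDist g P Q < ⊤ := by
  have hnhds : ∀ S : M, ∀ᶠ T in 𝓝 S, gEDist g S T < ⊤ := by
    intro S
    have h := goodRadius_injRadius g S
    have h0 : (0 : 𝔼 m) ∈ tangentBall g S (injRadius g S) := by
      rw [mem_tangentBall]; simpa using injRadius_pos g S
    have ho := h.isOpen_image (isOpen_tangentBall g S _) subset_rfl
    have hS : S ∈ expMap g S '' tangentBall g S (injRadius g S) := ⟨0, h0, h.expMap_zero h0⟩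
    filter_upwards [ho.mem_nhds hS] with T hT
    obtain ⟨v, hv, rfl⟩ := hT
    rw [gEDist_expMap hv]
    exact ENNReal.ofReal_lt_top
  have hcl : IsClopen {Q | gEDist g P Q < ⊤} := by
    refine ⟨⟨?_⟩, ?_⟩
    · rw [isOpen_iff_mem_nhds]
      intro S hS
      filter_upwards [hnhds S] with T hT hPT
      refine hS ((gEDist_triangle g P T S).trans_lt (ENNReal.add_lt_top.2 ⟨hPT, ?_⟩))
      rwa [gEDist_comm]
    · rw [isOpen_iff_mem_nhds]
      intro S hS
      filter_upwards [hnhds S] with T hT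
      exact (gEDist_triangle g P S T).trans_lt (ENNReal.add_lt_top.2 ⟨hS, hT⟩)
  have := hcl.eq_univ ⟨P, by simp [gEDist_self]⟩
  exact this.symm.subset (mem_univ Q)

end Distance

/-! ### Averages along segments from the origin. -/

section RayAverage

variable {A : Type} [NormedAddCommGroup A] [NormedSpace ℝ A]

/-- The average of a function on the segment from the origin to `v`. -/
def rayAvg (f : A → ℝ) (v : A) : ℝ := ∫ t in (0 : ℝ)..1, f (t • v)

theorem mul_rayAvg_smul (f : A → ℝ) (t : ℝ) (v : A) :
    t * rayAvg f (t • v) = ∫ s in (0 : ℝ)..t, f (s • v) := by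
  have := intervalIntegral.smul_integral_comp_mul_left (a := 0) (b := 1) (fun s => f (s • v)) t
  simp only [mul_zero, mul_one, smul_eq_mul] at this
  rw [← this, rayAvg]
  simp only [smul_smul, mul_comm]

/-- The average is a composition of three smooth maps: the linear map sending `v` to its ray in
`C([0,1], A)`, composition with `f`, and integration. -/
theorem contDiff_rayAvg {f : A → ℝ} (hf : ContDiff ℝ ∞ f) : ContDiff ℝ ∞ (rayAvg f) := by
  let rays : A →L[ℝ] C(Icc (0 : ℝ) 1, A) :=
    LinearMap.mkContinuous
      { toFun := fun v => ⟨fun t => (t : ℝ) • v, by fun_prop⟩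
        map_add' := fun v w => by ext; simp
        map_smul' := fun a v => by ext t; simp [smul_comm (t : ℝ) a v] } 1 (by
      intro v
      refine (ContinuousMap.norm_le _ (by positivity)).2 fun t => ?_
      change ‖(t : ℝ) • v‖ ≤ 1 * ‖v‖
      rw [norm_smul, Real.norm_of_nonneg t.2.1]
      gcongr
      exact t.2.2)
  have h1 := (contDiff_postcomp (K := Icc (0 : ℝ) 1) (⟨f, hf.continuous⟩ : C(A, ℝ)) hf)
  have h2 := h1.comp rays.contDiff
  have h3 := (((primitiveCLM (F := ℝ)).contDiff).comp h2)
  let ev : C(Icc (0 : ℝ) 1, ℝ) →L[ℝ] ℝ := ContinuousMap.evalCLM ℝ ⟨1, by simp⟩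
  have h4 := ev.contDiff.comp h3
  convert h4 using 1
  funext v
  refine intervalIntegral.integral_congr fun t ht => ?_
  rw [uIcc_of_le zero_le_one] at ht
  change f (t • v) = f ((projIcc 0 1 zero_le_one t : ℝ) • v)
  rw [projIcc_of_mem _ ht]

theorem eventually_ray_mem {s : Set A} (hs : IsOpen s) {v : A}
    (h : ∀ t ∈ Icc (0 : ℝ) 1, t • v ∈ s) : ∀ᶠ w in 𝓝 v, ∀ t ∈ Icc (0 : ℝ) 1, t • w ∈ s := by
  refine isCompact_Icc.eventually_forall_of_forall_eventually fun t ht => ?_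
  have : ContinuousAt (fun z : A × ℝ => z.2 • z.1) (v, t) := by fun_prop
  exact this.eventually_mem (hs.mem_nhds (h t ht))

/-- Multiplying `f` by a cut-off equal to `1` near the segment from `0` to `v` gives a globally
smooth function without changing the averages at points near `v`. -/
theorem contDiffOn_rayAvg [FiniteDimensional ℝ A] {f : A → ℝ} {s : Set A} (hs : IsOpen s)
    (hstar : ∀ v ∈ s, ∀ t ∈ Icc (0 : ℝ) 1, t • v ∈ s) (hf : ContDiffOn ℝ ∞ f s) :
    ContDiffOn ℝ ∞ (rayAvg f) s := by
  intro v hv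
  have hK : IsCompact ((fun t : ℝ => t • v) '' Icc 0 1) := isCompact_Icc.image (by fun_prop)
  have hKs : ((fun t : ℝ => t • v) '' Icc 0 1) ⊆ s := by
    rintro _ ⟨t, ht, rfl⟩
    exact hstar v hv t ht
  obtain ⟨u, hu, hKu, hus⟩ := normal_exists_closure_subset hK.isClosed hs hKs
  obtain ⟨χ, hχ1, hχ0, -⟩ := exists_contMDiffMap_one_nhds_of_subset_interior 𝓘(ℝ, A) (n := ⊤)
    hK.isClosed (t := u) (by rwa [hu.interior_eq])
  have hχsm : ContDiff ℝ ∞ χ := contMDiff_iff_contDiff.1 χ.contMDiff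
  have hg : ContDiff ℝ ∞ fun x => χ x * f x := by
    rw [contDiff_iff_contDiffAt]
    intro x
    by_cases hx : x ∈ s
    · exact hχsm.contDiffAt.mul (hf.contDiffAt (hs.mem_nhds hx))
    · have hx' : x ∈ (closure u)ᶜ := fun h => hx (hus h)
      refine (contDiffAt_const (c := (0 : ℝ))).congr_of_eventuallyEq ?_
      filter_upwards [isClosed_closure.isOpen_compl.mem_nhds hx'] with y hy
      rw [hχ0 y fun h => hy (subset_closure h), zero_mul]
  obtain ⟨o, ho, hKo, hoχ⟩ := eventually_nhdsSet_iff_exists.1 hχ1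
  have hev : rayAvg f =ᶠ[𝓝 v] rayAvg fun x => χ x * f x := by
    filter_upwards [eventually_ray_mem ho (v := v) fun t ht => hKo ⟨t, ht, rfl⟩] with w hw
    refine intervalIntegral.integral_congr fun t ht => ?_
    rw [uIcc_of_le zero_le_one] at ht
    change f (t • w) = χ (t • w) * f (t • w)
    rw [hoχ _ (hw t ht), one_mul]
  exact ((contDiff_rayAvg hg).contDiffAt.congr_of_eventuallyEq hev).contDiffWithinAt

/-- Both sides are the derivative at `t = 1` of `t * rayAvg f (t v) = ∫₀ᵗ f(s v) ds`. -/
theorem rayAvg_add_fderiv {f : A → ℝ} {s : Set A} (hs : IsOpen s)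
    (hstar : ∀ v ∈ s, ∀ t ∈ Icc (0 : ℝ) 1, t • v ∈ s) (hf : ContinuousOn f s) {v : A} (hv : v ∈ s)
    (hd : DifferentiableAt ℝ (rayAvg f) v) : rayAvg f v + fderiv ℝ (rayAvg f) v v = f v := by
  have h1 : HasDerivAt (fun t : ℝ => t • v) v 1 := by
    simpa using (hasDerivAt_id (1 : ℝ)).smul_const v
  have hd' : HasFDerivAt (rayAvg f) (fderiv ℝ (rayAvg f) v) ((1 : ℝ) • v) := by
    rw [one_smul]; exact hd.hasFDerivAt
  have h2 := (hasDerivAt_id (1 : ℝ)).mul (hd'.comp_hasDerivAt 1 h1)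
  have hcont : ∀ t ∈ Icc (0 : ℝ) 1, ContinuousAt (fun t : ℝ => f (t • v)) t := fun t ht =>
    ContinuousAt.comp (g := f) (f := fun t : ℝ => t • v)
      (hf.continuousAt (hs.mem_nhds (hstar v hv t ht))) (by fun_prop)
  have hev : ∀ᶠ t in 𝓝 (1 : ℝ), ContinuousAt (fun t : ℝ => f (t • v)) t := by
    have : ContinuousAt (fun t : ℝ => t • v) 1 := by fun_prop
    filter_upwards [this.eventually_mem (hs.mem_nhds (by simpa using hv))] with t ht
    exact ContinuousAt.comp (g := f) (f := fun t : ℝ => t • v)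
      (hf.continuousAt (hs.mem_nhds ht)) (by fun_prop)
  have h3 : HasDerivAt (fun u => ∫ t in (0 : ℝ)..u, f (t • v)) (f ((1 : ℝ) • v)) 1 := by
    refine intervalIntegral.integral_hasDerivAt_right ?_ ?_ (hcont 1 (by simp))
    · refine ContinuousOn.intervalIntegrable fun t ht => ?_
      rw [uIcc_of_le zero_le_one] at ht
      exact (hcont t ht).continuousWithinAt
    · obtain ⟨o, ho, hmo, h1o⟩ := mem_nhds_iff.1 hev
      exact ContinuousOn.stronglyMeasurableAtFilter hmo
        (fun t ht => ContinuousAt.continuousWithinAt (show ContinuousAt _ t from ho ht)) 1 h1o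
  have h4 := h2.unique (h3.congr_of_eventuallyEq (Filter.Eventually.of_forall fun t =>
    mul_rayAvg_smul f t v))
  simpa using h4

theorem rayAvg_pos {f : A → ℝ} {v : A}
    (hf : ∀ t ∈ Icc (0 : ℝ) 1, ContinuousAt f (t • v)) (hpos : ∀ t ∈ Icc (0 : ℝ) 1, 0 < f (t • v)) :
    0 < rayAvg f v := by
  have hcont : ContinuousOn (fun t : ℝ => f (t • v)) (Icc 0 1) := fun t ht =>
    (ContinuousAt.comp (g := f) (f := fun t : ℝ => t • v) (hf t ht)
      (by fun_prop)).continuousWithinAt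
  exact intervalIntegral.intervalIntegral_pos_of_pos_on
    (hcont.mono (by rw [uIcc_of_le zero_le_one])).intervalIntegrable
    (fun t ht => hpos t (Ioo_subset_Icc_self ht)) zero_lt_one

end RayAverage

/-! ### Christoffel symbols of a conformally changed metric. -/

section Bilinear

set_option synthInstance.maxHeartbeats 200000

variable {V : Type*} [NormedAddCommGroup V] [NormedSpace ℝ V]

theorem isInvertible_of_injective [FiniteDimensional ℝ V] {L : V →L[ℝ] V}
    (h : Function.Injective L) : L.IsInvertible :=
  ⟨(LinearEquiv.ofInjectiveEndo (L : V →ₗ[ℝ] V) h).toContinuousLinearEquiv, by ext; rfl⟩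

theorem hasFDerivAt_smul_function {W : Type*} [NormedAddCommGroup W] [NormedSpace ℝ W] {f : V → ℝ}
    {k : V → W} {f' : V →L[ℝ] ℝ} {k' : V →L[ℝ] W} {y : V} (hf : HasFDerivAt f f' y)
    (hk : HasFDerivAt k k' y) :
    HasFDerivAt (fun x => f x • k x) (f y • k' + f'.smulRight (k y)) y := hf.smul hk

/-- The Christoffel symbols of a conformally changed metric. -/
theorem chr_smul_sq {B : V → V →L[ℝ] V →L[ℝ] ℝ} {ρ : V → ℝ} {y : V}
    (hB : DifferentiableAt ℝ B y) (hρ : DifferentiableAt ℝ ρ y) (v w : V) :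
    chr (fun x => ρ x ^ 2 • B x) y v v w = ρ y ^ 2 * chr B y v v w
      + 2 * ρ y * fderiv ℝ ρ y v * B y v w - ρ y * fderiv ℝ ρ y w * B y v v := by
  have h1 : HasFDerivAt (fun x => ρ x ^ 2) _ y := hρ.hasFDerivAt.pow 2
  have h2 : HasFDerivAt (fun x => ρ x ^ 2 • B x) _ y :=
    hasFDerivAt_smul_function (W := V →L[ℝ] V →L[ℝ] ℝ) h1 hB.hasFDerivAt
  simp only [chr]
  rw [h2.fderiv]
  simp
  ring

theorem geodExpr_smul_const (B : V → V →L[ℝ] V →L[ℝ] ℝ) {σ : ℝ → ℝ} {τ : ℝ}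
    (hσ : ContDiffAt ℝ 2 σ τ) (v w : V) :
    geodExpr B (fun s => σ s • v) τ w = deriv (deriv σ) τ * B (σ τ • v) v w
      + deriv σ τ ^ 2 * chr B (σ τ • v) v v w := by
  have h1 : (deriv fun s => σ s • v) =ᶠ[𝓝 τ] fun s => deriv σ s • v := by
    filter_upwards [hσ.eventually (by simp)] with s hs
    exact ((hs.differentiableAt (by simp)).hasDerivAt.smul_const v).deriv
  have h2 : deriv (deriv fun s => σ s • v) τ = deriv (deriv σ) τ • v := by
    rw [h1.deriv_eq]
    exact ((ContDiffAt.hasDerivAt_deriv hσ).smul_const v).deriv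
  simp only [geodExpr, chr]
  rw [h2, h1.eq_of_nhds]
  simp only [map_smul, smul_apply, smul_eq_mul]
  ring

end Bilinear

/-! ### Radial functions and the stretching map `confMap`. -/

section Conformal

variable {m : ℕ} {M : Type*} [TopologicalSpace M]
  [ChartedSpace (EuclideanSpace ℝ (Fin m)) M] [IsManifold (𝓡 m) ∞ M]

local notation "𝔼" m => EuclideanSpace ℝ (Fin m)

variable {g : RiemMetric m M} {P : M} {Ψ : M → ℝ} {hΨ : ContMDiff (𝓡 m) 𝓘(ℝ, ℝ) ∞ Ψ}
  {hpos : ∀ x, 0 < Ψ x} {R : ℝ≥0∞}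

theorem form_conformal (Q : M) (u w : 𝔼 m) :
    form (conformal g Ψ hΨ hpos) Q u w = Ψ Q ^ 2 * form g Q u w := rfl

theorem tnorm_conformal (Q : M) (u : 𝔼 m) :
    tnorm (conformal g Ψ hΨ hpos) Q u = Ψ Q * tnorm g Q u := by
  rw [tnorm, form_conformal, Real.sqrt_mul (sq_nonneg _), Real.sqrt_sq (hpos Q).le, tnorm]

theorem pull_conformal (f : (𝔼 m) → M) :
    pull (conformal g Ψ hΨ hpos) f = fun x => Ψ (f x) ^ 2 • pull g f x := rfl

variable [T2Space M]

-- For `t ≠ 0` this is `chr_ray` for the vector `t v` at time `1`, rescaled; negative `t` and `t >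
-- 1` are thereby included.
set_option synthInstance.maxHeartbeats 200000 in
theorem GoodRadius.chr_line (h : GoodRadius g P R) {v : 𝔼 m} (hv : v ∈ tangentBall g P R)
    {t : ℝ} (ht : t • v ∈ tangentBall g P R) (w : 𝔼 m) :
    chr (pull g (expMap g P)) (t • v) v v w = 0 := by
  rcases eq_or_ne t 0 with rfl | ht0
  · exact h.chr_ray hv (by simp) w
  · have h1 := h.chr_ray ht (t := 1) (by simp) w
    simp only [chr, one_smul, map_smul, smul_apply, smul_eq_mul] at h1 ⊢
    refine mul_left_cancel₀ (pow_ne_zero 2 ht0) ?_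
    linarith

theorem GoodRadius.gauss_line (h : GoodRadius g P R) {v : 𝔼 m} {t : ℝ}
    (ht : t • v ∈ tangentBall g P R) (w : 𝔼 m) :
    pull g (expMap g P) (t • v) v w = form g P v w := by
  rcases eq_or_ne t 0 with rfl | ht0
  · rw [zero_smul] at ht ⊢
    rw [h.pull_zero ht]
  · have h1 := h.gauss ht w
    simp only [map_smul, smul_apply, smul_eq_mul] at h1
    exact mul_left_cancel₀ ht0 h1

theorem GoodRadius.contDiffOn_comp (h : GoodRadius g P R)
    (hΨ : ContMDiff (𝓡 m) 𝓘(ℝ, ℝ) ∞ Ψ) :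
    ContDiffOn ℝ ∞ (Ψ ∘ expMap g P) (tangentBall g P R) :=
  contMDiffOn_iff_contDiffOn.1 (hΨ.comp_contMDiffOn h.isParam.contMDiffOn)

/-- The symmetric interval of the real numbers of absolute value less than the injectivity
radius. -/
def radii (g : RiemMetric m M) (P : M) : Set ℝ := {t | ENNReal.ofReal |t| < injRadius g P}

theorem isOpen_radii (g : RiemMetric m M) (P : M) : IsOpen (radii g P) :=
  isOpen_lt (ENNReal.continuous_ofReal.comp continuous_abs) continuous_const

theorem IsRadialProfile.comp_expMap {ψ : ℝ → ℝ} (hψ : IsRadialProfile g P Ψ ψ) {v : 𝔼 m}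
    (hv : v ∈ tangentBall g P (injRadius g P)) : Ψ (expMap g P v) = ψ (tnorm g P v) := by
  have hmem : expMap g P v ∈ injBall g P := by
    rw [injBall_eq]; exact mem_image_of_mem _ hv
  rw [hψ.2.2 _ hmem, gDist_expMap hv]

theorem neg_mem_tangentBall {v : 𝔼 m} (hv : v ∈ tangentBall g P R) : -v ∈ tangentBall g P R := by
  simpa using smul_mem_tangentBall hv (t := -1) (by simp)

/-- The differential of a radial function is radial. -/
theorem IsRadialProfile.fderiv_mul_form {ψ : ℝ → ℝ} (hψ : IsRadialProfile g P Ψ ψ) {v : 𝔼 m}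
    {t : ℝ} (ht : t • v ∈ tangentBall g P (injRadius g P)) (w : 𝔼 m) :
    fderiv ℝ (Ψ ∘ expMap g P) (t • v) w * form g P v v =
      fderiv ℝ (Ψ ∘ expMap g P) (t • v) v * form g P v w := by
  set B := tangentBall g P (injRadius g P)
  have hB : IsOpen B := isOpen_tangentBall g P _
  -- At the origin the function is invariant under `x ↦ -x`, so its differential vanishes. Elsewhere
  -- it is `ψ` of the norm, whose differential at `t v` is a multiple of `form g P v`.
  rcases eq_or_ne (t • v) 0 with h0 | h0
  · rw [h0] at ht ⊢
    have heven : (Ψ ∘ expMap g P) =ᶠ[𝓝 0] fun x => (Ψ ∘ expMap g P) ((-1 : ℝ) • x) := by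
      filter_upwards [hB.mem_nhds ht] with x hx
      have h1 := tnorm_smul g P (-1) x
      rw [neg_one_smul] at h1
      simp only [Function.comp_apply]
      rw [neg_one_smul, hψ.comp_expMap hx, hψ.comp_expMap (neg_mem_tangentBall hx), h1]
      simp
    have h2 : fderiv ℝ (Ψ ∘ expMap g P) 0 = 0 := by
      have h3 := heven.fderiv_eq (𝕜 := ℝ)
      rw [fderiv_comp_smul, smul_zero, neg_one_smul] at h3
      ext u
      have h4 := congrArg (fun L : (𝔼 m) →L[ℝ] ℝ => L u) h3
      simp only [neg_apply] at h4
      rw [zero_apply]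
      linarith
    simp [h2]
  · have hn := tnorm_pos g P h0
    have hN : HasFDerivAt (tnorm g P) _ (t • v) :=
      (((form g P).hasFDerivAt.clm_apply (hasFDerivAt_id (t • v))).sqrt
        (form_pos g P h0).ne')
    have hmem : tnorm g P (t • v) ∈ {t : ℝ | ENNReal.ofReal |t| < injRadius g P} := by
      change ENNReal.ofReal |_| < _
      rw [abs_of_pos hn]
      exact ht
    have hψd := ((hψ.1.contDiffAt ((isOpen_radii g P).mem_nhds hmem)).differentiableAt
      (by simp)).hasDerivAt
    have hev : (Ψ ∘ expMap g P) =ᶠ[𝓝 (t • v)] fun x => ψ (tnorm g P x) := by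
      filter_upwards [hB.mem_nhds ht] with x hx
      exact hψ.comp_expMap hx
    have h1 := (hψd.comp_hasFDerivAt (t • v) hN)
    rw [hev.fderiv_eq]
    have h2 : fderiv ℝ (fun x => ψ (tnorm g P x)) (t • v) = _ := h1.fderiv
    rw [h2]
    simp
    rw [form_symm g P w v]
    ring

/-- The factor by which the conformal change stretches the rays of the exponential map. -/
def stretch (g : RiemMetric m M) (P : M) (Ψ : M → ℝ) (v : 𝔼 m) : ℝ :=
  rayAvg (Ψ ∘ expMap g P) v / Ψ P

/-- The change of the exponential map under a conformal change of the metric. -/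
def confMap (g : RiemMetric m M) (P : M) (Ψ : M → ℝ) (v : 𝔼 m) : 𝔼 m := stretch g P Ψ v • v

section Stretch

theorem contDiffOn_stretch (h : GoodRadius g P R) (hΨ : ContMDiff (𝓡 m) 𝓘(ℝ, ℝ) ∞ Ψ) :
    ContDiffOn ℝ ∞ (stretch g P Ψ) (tangentBall g P R) :=
  (contDiffOn_rayAvg (isOpen_tangentBall g P R)
    (fun _ hv _ ht => smul_mem_tangentBall' hv ht) (h.contDiffOn_comp hΨ)).div_const _

theorem differentiableAt_stretch (h : GoodRadius g P R) (hΨ : ContMDiff (𝓡 m) 𝓘(ℝ, ℝ) ∞ Ψ)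
    {v : 𝔼 m} (hv : v ∈ tangentBall g P R) : DifferentiableAt ℝ (stretch g P Ψ) v :=
  ((contDiffOn_stretch h hΨ).contDiffAt ((isOpen_tangentBall g P R).mem_nhds hv)).differentiableAt
    (by simp)

/-- The left-hand side is the factor by which the differential of `confMap` at `v` multiplies the
radial vector `v`. -/
theorem stretch_add_fderiv (h : GoodRadius g P R) (hΨ : ContMDiff (𝓡 m) 𝓘(ℝ, ℝ) ∞ Ψ)
    {v : 𝔼 m} (hv : v ∈ tangentBall g P R) :
    stretch g P Ψ v + fderiv ℝ (stretch g P Ψ) v v = Ψ (expMap g P v) / Ψ P := by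
  have hB := isOpen_tangentBall g P R
  have hstar : ∀ v ∈ tangentBall g P R, ∀ t ∈ Icc (0 : ℝ) 1, t • v ∈ tangentBall g P R :=
    fun _ hv _ ht => smul_mem_tangentBall' hv ht
  have hd : DifferentiableAt ℝ (rayAvg (Ψ ∘ expMap g P)) v :=
    ((contDiffOn_rayAvg hB hstar (h.contDiffOn_comp hΨ)).contDiffAt
      (hB.mem_nhds hv)).differentiableAt (by simp)
  have h1 := rayAvg_add_fderiv hB hstar (h.contDiffOn_comp hΨ).continuousOn hv hd
  have h2 : HasFDerivAt (stretch g P Ψ) ((Ψ P)⁻¹ • fderiv ℝ (rayAvg (Ψ ∘ expMap g P)) v) v := by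
    have := hd.hasFDerivAt.mul_const (Ψ P)⁻¹
    exact this
  rw [h2.fderiv, stretch]
  simp only [smul_apply, smul_eq_mul, Function.comp_apply] at h1 ⊢
  rw [← h1]
  ring

theorem stretch_pos (h : GoodRadius g P R) (hΨ : ContMDiff (𝓡 m) 𝓘(ℝ, ℝ) ∞ Ψ)
    (hpos : ∀ x, 0 < Ψ x) {v : 𝔼 m} (hv : v ∈ tangentBall g P R) : 0 < stretch g P Ψ v := by
  refine div_pos (rayAvg_pos (fun t ht => ?_) fun t _ => hpos _) (hpos P)
  exact (h.contDiffOn_comp hΨ).continuousOn.continuousAt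
    ((isOpen_tangentBall g P R).mem_nhds (smul_mem_tangentBall' hv ht))

theorem contDiffOn_confMap (h : GoodRadius g P R) (hΨ : ContMDiff (𝓡 m) 𝓘(ℝ, ℝ) ∞ Ψ) :
    ContDiffOn ℝ ∞ (confMap g P Ψ) (tangentBall g P R) :=
  (contDiffOn_stretch h hΨ).smul contDiffOn_id

theorem fderiv_confMap (h : GoodRadius g P R) (hΨ : ContMDiff (𝓡 m) 𝓘(ℝ, ℝ) ∞ Ψ)
    {v : 𝔼 m} (hv : v ∈ tangentBall g P R) (w : 𝔼 m) :
    fderiv ℝ (confMap g P Ψ) v w =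
      stretch g P Ψ v • w + fderiv ℝ (stretch g P Ψ) v w • v := by
  have h1 : HasFDerivAt (confMap g P Ψ) _ v :=
    (differentiableAt_stretch h hΨ hv).hasFDerivAt.smul (hasFDerivAt_id v)
  rw [h1.fderiv]
  simp

/-- Applying `ds` to `s w + ds(w) v = 0` gives `ds(w) (s + ds(v)) = 0`. The second factor is
positive, so `ds(w) = 0`, and then `w = 0`. -/
theorem injective_fderiv_confMap (h : GoodRadius g P R) (hΨ : ContMDiff (𝓡 m) 𝓘(ℝ, ℝ) ∞ Ψ)
    (hpos : ∀ x, 0 < Ψ x) {v : 𝔼 m} (hv : v ∈ tangentBall g P R) :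
    Function.Injective (fderiv ℝ (confMap g P Ψ) v) := by
  rw [injective_iff_map_eq_zero]
  intro w hw
  rw [fderiv_confMap h hΨ hv] at hw
  have hs := stretch_pos h hΨ hpos hv
  have h1 := stretch_add_fderiv h hΨ hv
  have h2 : fderiv ℝ (stretch g P Ψ) v w * (Ψ (expMap g P v) / Ψ P) = 0 := by
    have h3 := congrArg (fderiv ℝ (stretch g P Ψ) v) hw
    simp only [map_add, map_smul, smul_eq_mul, map_zero] at h3
    rw [← h1]
    linarith
  have h4 : 0 < Ψ (expMap g P v) / Ψ P := div_pos (hpos _) (hpos _)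
  have h5 := (mul_eq_zero.1 h2).resolve_right h4.ne'
  rw [h5, zero_smul, add_zero] at hw
  exact (smul_eq_zero.1 hw).resolve_left hs.ne'

end Stretch

end Conformal

/-! ### Inverses of increasing real functions. -/

section InverseReal

/-- The inverse of a real function with positive derivative. -/
theorem exists_inverse_of_deriv_pos {a : ℝ → ℝ} {I : Set ℝ} (hI : IsOpen I)
    (hconn : I.OrdConnected) (ha : ContDiffOn ℝ ∞ a I) (hpos : ∀ t ∈ I, 0 < deriv a t) :
    IsOpen (a '' I) ∧ (a '' I).OrdConnected ∧ InjOn a I ∧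
      ContDiffOn ℝ ∞ (Function.invFunOn a I) (a '' I) ∧
      ∀ t ∈ I, Function.invFunOn a I (a t) = t ∧
        HasDerivAt (Function.invFunOn a I) (deriv a t)⁻¹ (a t) := by
  have hmono : StrictMonoOn a I := strictMonoOn_of_deriv_pos hconn.convex ha.continuousOn
    (by rwa [hI.interior_eq])
  have hinv : ∀ t ∈ I, (fderiv ℝ a t).IsInvertible := fun t ht => by
    refine isInvertible_of_injective ((injective_iff_map_eq_zero _).2 fun x hx => ?_)
    have h1 : fderiv ℝ a t x = x * deriv a t := by
      rw [← fderiv_apply_one_eq_deriv, ← smul_eq_mul, ← map_smul, smul_eq_mul, mul_one]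
    rw [h1] at hx
    exact (mul_eq_zero.1 hx).resolve_right (hpos t ht).ne'
  obtain ⟨ho, hsm⟩ := smooth_inverse_of_injOn hI ha hmono.injOn hinv
  have hleft : ∀ t ∈ I, Function.invFunOn a I (a t) = t := fun t ht =>
    hmono.injOn (Function.invFunOn_mem ⟨t, ht, rfl⟩) ht (Function.invFunOn_eq ⟨t, ht, rfl⟩)
  refine ⟨ho, (hconn.isPreconnected.image a ha.continuousOn).ordConnected, hmono.injOn, hsm,
    fun t ht => ⟨hleft t ht, ?_⟩⟩
  have hmem : a t ∈ a '' I := mem_image_of_mem _ ht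
  have hc := (hsm.contDiffAt (ho.mem_nhds hmem)).continuousAt
  refine HasDerivAt.of_local_left_inverse (f := a) hc ?_ (hpos t ht).ne' ?_
  · rw [hleft t ht]
    exact ((ha.contDiffAt (hI.mem_nhds ht)).differentiableAt (by simp)).hasDerivAt
  · filter_upwards [ho.mem_nhds hmem] with y hy
    exact Function.invFunOn_eq hy

end InverseReal

/-! ### Rays as reparametrized geodesics of the conformal metric. -/

section ConformalExp

variable {m : ℕ} {M : Type*} [TopologicalSpace M]
  [ChartedSpace (EuclideanSpace ℝ (Fin m)) M] [IsManifold (𝓡 m) ∞ M] [T2Space M]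

local notation "𝔼" m => EuclideanSpace ℝ (Fin m)

variable {g : RiemMetric m M} {P : M} {Ψ : M → ℝ} {hΨ : ContMDiff (𝓡 m) 𝓘(ℝ, ℝ) ∞ Ψ}
  {hpos : ∀ x, 0 < Ψ x} {ψ : ℝ → ℝ}

theorem hasDerivAt_comp_smul {f : (𝔼 m) → ℝ} {σ : ℝ → ℝ} {σ' τ : ℝ} {v : 𝔼 m}
    (hf : DifferentiableAt ℝ f (σ τ • v)) (hσ : HasDerivAt σ σ' τ) :
    HasDerivAt (fun s => f (σ s • v)) (σ' * fderiv ℝ f (σ τ • v) v) τ := by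
  have h : HasDerivAt (f ∘ fun s => σ s • v) _ τ :=
    hf.hasFDerivAt.comp_hasDerivAt τ (hσ.smul_const v)
  rwa [map_smul, smul_eq_mul] at h

theorem ordConnected_ray (g : RiemMetric m M) (P : M) (R : ℝ≥0∞) (v : 𝔼 m) :
    {t : ℝ | t • v ∈ tangentBall g P R}.OrdConnected := by
  constructor
  intro x hx y hy z hz
  have h1 : |z| ≤ max |x| |y| := abs_le_max_abs_abs hz.1 hz.2
  rcases le_max_iff.1 h1 with h | h
  · refine lt_of_le_of_lt (ENNReal.ofReal_le_ofReal ?_) hx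
    change tnorm g P (z • v) ≤ tnorm g P (x • v)
    rw [tnorm_smul, tnorm_smul]
    exact mul_le_mul_of_nonneg_right h (tnorm_nonneg g P v)
  · refine lt_of_le_of_lt (ENNReal.ofReal_le_ofReal ?_) hy
    change tnorm g P (z • v) ≤ tnorm g P (y • v)
    rw [tnorm_smul, tnorm_smul]
    exact mul_le_mul_of_nonneg_right h (tnorm_nonneg g P v)

/-- The conformal geodesic equation on a ray, with the reparametrization `σ' = k / Ψ`. -/
theorem geodExpr_conformal_ray (hψ : IsRadialProfile g P Ψ ψ) {v : 𝔼 m}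
    (hv : v ∈ tangentBall g P (injRadius g P)) {σ : ℝ → ℝ} {τ k : ℝ}
    (hσv : σ τ • v ∈ tangentBall g P (injRadius g P)) (hσ : ContDiffAt ℝ 2 σ τ)
    (hσ' : ∀ᶠ s in 𝓝 τ, deriv σ s = k * (Ψ (expMap g P (σ s • v)))⁻¹) (w : 𝔼 m) :
    geodExpr (pull (conformal g Ψ hΨ hpos) (expMap g P)) (fun s => σ s • v) τ w = 0 := by
  have h := goodRadius_injRadius g P
  set ρ := Ψ ∘ expMap g P with hρ
  have hρd : DifferentiableAt ℝ ρ (σ τ • v) := ((h.contDiffOn_comp hΨ).contDiffAt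
    ((isOpen_tangentBall g P _).mem_nhds hσv)).differentiableAt (by simp)
  have hGd := h.isParam.differentiableAt_pull g hσv
  have hρpos : 0 < ρ (σ τ • v) := hpos _
  -- Differentiating `σ' = k / Ψ`, that is, the constancy of the `g'`-speed, expresses `σ''` through
  -- the radial derivative of `Ψ`.
  have h1 : deriv (deriv σ) τ = -(deriv σ τ ^ 2 * fderiv ℝ ρ (σ τ • v) v) / ρ (σ τ • v) := by
    have hc := hasDerivAt_comp_smul hρd (hσ.differentiableAt (by simp)).hasDerivAt
    have hd : HasDerivAt (fun s => k * (ρ (σ s • v))⁻¹) _ τ := (hc.fun_inv hρpos.ne').const_mul k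
    have h2 : deriv (deriv σ) τ = _ := (Filter.EventuallyEq.deriv_eq hσ').trans hd.deriv
    rw [h2]
    have h3 := hσ'.self_of_nhds
    change deriv σ τ = k * (ρ (σ τ • v))⁻¹ at h3
    rw [h3]
    field_simp
  have h4 : pull (conformal g Ψ hΨ hpos) (expMap g P) =
      fun x => ρ x ^ 2 • pull g (expMap g P) x := pull_conformal _
  rw [h4, geodExpr_smul_const _ hσ, chr_smul_sq hGd hρd, h.chr_line hv hσv, h1]
  simp only [smul_apply, smul_eq_mul]
  have h5 := hψ.fderiv_mul_form hσv w
  rw [h.gauss_line hσv, h.gauss_line hσv]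
  rw [← hρ] at h5
  -- Radiality of `dρ` turns the gradient term into a multiple of `form g P v w`; the three
  -- remaining terms then carry the coefficients `-1`, `2`, `-1` and cancel.
  have h6 : ρ (σ τ • v) * fderiv ℝ ρ (σ τ • v) w * form g P v v =
      ρ (σ τ • v) * fderiv ℝ ρ (σ τ • v) v * form g P v w := by
    rw [mul_assoc, h5, mul_assoc]
  rw [h6]
  field_simp
  ring

/-- The exponential map of the conformally changed metric. -/
theorem expMap_confMap (hψ : IsRadialProfile g P Ψ ψ) {v : 𝔼 m}
    (hv : v ∈ tangentBall g P (injRadius g P)) :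
    confMap g P Ψ v ∈ expDomain (conformal g Ψ hΨ hpos) P ∧
      expMap (conformal g Ψ hΨ hpos) P (confMap g P Ψ v) = expMap g P v := by
  have h := goodRadius_injRadius g P
  set B := tangentBall g P (injRadius g P) with hB
  have hBo : IsOpen B := isOpen_tangentBall g P _
  let I : Set ℝ := {t | t • v ∈ B}
  have hI : IsOpen I := hBo.preimage (by fun_prop : Continuous fun t : ℝ => t • v)
  have hIc : I.OrdConnected := ordConnected_ray g P _ v
  -- `a t` is the signed `g'`-arc length of the ray from `0` to `t`, in units of the `g'`-norm of
  -- `v` when `v ≠ 0`.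
  let a : ℝ → ℝ := fun t => t * stretch g P Ψ (t • v)
  have ha : ContDiffOn ℝ ∞ a I :=
    contDiffOn_id.mul ((contDiffOn_stretch h hΨ).comp
      (by fun_prop : ContDiff ℝ ∞ fun t : ℝ => t • v).contDiffOn fun t ht => ht)
  have ha' : ∀ t ∈ I, deriv a t = Ψ (expMap g P (t • v)) / Ψ P := by
    intro t ht
    have hc := hasDerivAt_comp_smul (differentiableAt_stretch h hΨ ht) (hasDerivAt_id t)
    have h1 : HasDerivAt a _ t := (hasDerivAt_id t).mul hc
    rw [h1.deriv, ← stretch_add_fderiv h hΨ ht]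
    simp
  obtain ⟨hao, hac, hainj, hasm, hainv⟩ := exists_inverse_of_deriv_pos hI hIc ha fun t ht => by
    rw [ha' t ht]; exact div_pos (hpos _) (hpos _)
  set k := stretch g P Ψ v with hk
  have hkpos : 0 < k := stretch_pos h hΨ hpos hv
  have h0I : (0 : ℝ) ∈ I := by
    change (0 : ℝ) • v ∈ B
    rw [zero_smul]; exact zero_mem_tangentBall hv
  have h1I : (1 : ℝ) ∈ I := by
    change (1 : ℝ) • v ∈ B
    rwa [one_smul]
  have ha0 : a 0 = 0 := by simp [a]
  have ha1 : a 1 = k := by simp [a, hk]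
  let J : Set ℝ := {τ | k * τ ∈ a '' I}
  have hJ : IsOpen J := hao.preimage (by fun_prop : Continuous fun τ : ℝ => k * τ)
  have hJc : J.OrdConnected := by
    constructor
    intro x hx y hy z hz
    exact hac.out hx hy ⟨mul_le_mul_of_nonneg_left hz.1 hkpos.le,
      mul_le_mul_of_nonneg_left hz.2 hkpos.le⟩
  have h0J : (0 : ℝ) ∈ J := ⟨0, h0I, by rw [ha0, mul_zero]⟩
  have h1J : (1 : ℝ) ∈ J := ⟨1, h1I, by rw [ha1, mul_one]⟩
  -- Inverting `a` gives constant `g'`-speed. The factor `k = a 1` makes `σ 1 = 1` and `σ' 0 = k`,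
  -- so the reparametrized ray starts with velocity `k v = confMap g P Ψ v` and ends at `exp_P v`.
  let σ : ℝ → ℝ := fun τ => Function.invFunOn a I (k * τ)
  have hσ0 : σ 0 = 0 := by
    change Function.invFunOn a I (k * 0) = 0
    rw [mul_zero]
    have := (hainv 0 h0I).1
    rwa [ha0] at this
  have hσ1 : σ 1 = 1 := by
    change Function.invFunOn a I (k * 1) = 1
    rw [mul_one]
    have := (hainv 1 h1I).1
    rwa [ha1] at this
  have hσI : ∀ τ ∈ J, σ τ ∈ I := fun τ hτ => Function.invFunOn_mem hτ
  have hσsm : ContDiffOn ℝ ∞ σ J :=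
    hasm.comp (by fun_prop : ContDiff ℝ ∞ fun τ : ℝ => k * τ).contDiffOn fun τ hτ => hτ
  have hσ' : ∀ τ ∈ J, HasDerivAt σ (k * Ψ P * (Ψ (expMap g P (σ τ • v)))⁻¹) τ := by
    intro τ hτ
    have h1 := (hainv (σ τ) (hσI τ hτ)).2
    have h2 : a (σ τ) = k * τ := Function.invFunOn_eq hτ
    rw [h2, ha' _ (hσI τ hτ)] at h1
    have h3 := h1.comp τ ((hasDerivAt_id τ).const_mul k)
    refine h3.congr_deriv ?_
    rw [inv_div]
    field_simp
  have hgeo : IsGeodesicOn (conformal g Ψ hΨ hpos) (fun τ => expMap g P (σ τ • v)) J := by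
    refine isGeodesicOn_of_param _ fun τ hτ => ⟨expMap g P, B, fun τ => σ τ • v, h.isParam,
      hσI τ hτ, ?_, Filter.EventuallyEq.rfl, fun w => ?_⟩
    · exact ((hσsm.contDiffAt (hJ.mem_nhds hτ)).of_le two_le_infty).smul contDiffAt_const
    · refine geodExpr_conformal_ray (k := k * Ψ P) hψ hv (hσI τ hτ)
        ((hσsm.contDiffAt (hJ.mem_nhds hτ)).of_le two_le_infty) ?_ w
      filter_upwards [hJ.mem_nhds hτ] with s hs
      exact (hσ' s hs).deriv
  have hF0 : expMap g P (0 : 𝔼 m) = P := h.expMap_zero hv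
  have hst : IsGeodesicStart (conformal g Ψ hΨ hpos) P (confMap g P Ψ v)
      (fun τ => expMap g P (σ τ • v)) J := by
    refine ⟨hgeo, by rw [hσ0, zero_smul, hF0], ?_⟩
    obtain ⟨ε, hε, hray, -⟩ := exists_ray (h.subset hv)
    have hmem : (0 : ℝ) ∈ Ioo (-ε) (1 + ε) := by constructor <;> linarith
    have h1 : HasDerivAt (fun t => coord m P (expMap g P (t • v))) v (σ 0) := by
      rw [hσ0]
      have h2 := ((hray.1.contDiffAt_coord isOpen_Ioo hmem (p := P) (by
        simp only [zero_smul, hF0]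
        exact mem_chart_source _ _)).differentiableAt (by simp)).hasDerivAt
      rwa [hray.velocity] at h2
    have h3 := (h1.scomp (0 : ℝ) (hσ' 0 h0J)).deriv
    refine h3.trans ?_
    rw [hσ0, zero_smul, hF0, mul_assoc, mul_inv_cancel₀ (hpos P).ne', mul_one]
    rfl
  have := hst.expMap_smul hJ hJc h0J h1J
  rw [one_smul] at this
  refine ⟨this.1, this.2.trans ?_⟩
  rw [hσ1, one_smul]

end ConformalExp

/-! ### The profile `ψ`, its primitive, and the image of `confMap`. -/

section Profile

variable {m : ℕ} {M : Type*} [TopologicalSpace M]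
  [ChartedSpace (EuclideanSpace ℝ (Fin m)) M] [IsManifold (𝓡 m) ∞ M] [T2Space M]

local notation "𝔼" m => EuclideanSpace ℝ (Fin m)

variable {g : RiemMetric m M} {P : M} {Ψ : M → ℝ} {hΨ : ContMDiff (𝓡 m) 𝓘(ℝ, ℝ) ∞ Ψ}
  {hpos : ∀ x, 0 < Ψ x} {ψ : ℝ → ℝ}

theorem ordConnected_radii (g : RiemMetric m M) (P : M) : (radii g P).OrdConnected := by
  constructor
  intro x hx y hy z hz
  rcases le_max_iff.1 (abs_le_max_abs_abs hz.1 hz.2) with h | h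
  · exact lt_of_le_of_lt (ENNReal.ofReal_le_ofReal h) hx
  · exact lt_of_le_of_lt (ENNReal.ofReal_le_ofReal h) hy

theorem zero_mem_radii (g : RiemMetric m M) (P : M) : (0 : ℝ) ∈ radii g P := by
  simpa [radii] using injRadius_pos g P

theorem neg_mem_radii {t : ℝ} (ht : t ∈ radii g P) : -t ∈ radii g P := by
  change ENNReal.ofReal |-t| < _
  rwa [abs_neg]

theorem tnorm_mem_radii {v : 𝔼 m} (hv : v ∈ tangentBall g P (injRadius g P)) :
    tnorm g P v ∈ radii g P := by
  change ENNReal.ofReal |_| < _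
  rw [abs_of_nonneg (tnorm_nonneg g P v)]
  exact hv

theorem exists_tnorm_eq_one (hm : 1 ≤ m) (g : RiemMetric m M) (P : M) :
    ∃ v : 𝔼 m, tnorm g P v = 1 := by
  have : Nonempty (Fin m) := ⟨⟨0, hm⟩⟩
  obtain ⟨v, hv⟩ := exists_ne (0 : 𝔼 m)
  have := tnorm_pos g P hv
  refine ⟨(tnorm g P v)⁻¹ • v, ?_⟩
  rw [tnorm_smul, abs_of_pos (by positivity), inv_mul_cancel₀ this.ne']

theorem exists_tnorm_eq (hm : 1 ≤ m) (g : RiemMetric m M) (P : M) {t : ℝ} (ht : 0 ≤ t) :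
    ∃ v : 𝔼 m, tnorm g P v = t := by
  obtain ⟨v, hv⟩ := exists_tnorm_eq_one hm g P
  exact ⟨t • v, by rw [tnorm_smul, hv, mul_one, abs_of_nonneg ht]⟩

namespace IsRadialProfile

theorem even (hψ : IsRadialProfile g P Ψ ψ) {t : ℝ} (ht : t ∈ radii g P) : ψ (-t) = ψ t :=
  hψ.2.1 t ht

theorem contDiffOn (hψ : IsRadialProfile g P Ψ ψ) : ContDiffOn ℝ ∞ ψ (radii g P) := hψ.1

/-- As `m ≥ 1`, every nonnegative radius is the norm of some vector, so there `ψ` is a value of `Ψ`;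
evenness covers the negative radii. -/
theorem pos (hm : 1 ≤ m) (hψ : IsRadialProfile g P Ψ ψ) (hpos : ∀ x, 0 < Ψ x) {t : ℝ}
    (ht : t ∈ radii g P) : 0 < ψ t := by
  have key : ∀ t, 0 ≤ t → t ∈ radii g P → 0 < ψ t := by
    intro t h0 ht
    obtain ⟨v, hv⟩ := exists_tnorm_eq hm g P h0
    have hvB : v ∈ tangentBall g P (injRadius g P) := by
      rw [mem_tangentBall, hv, ← abs_of_nonneg h0]
      exact ht
    rw [← hv, ← hψ.comp_expMap hvB]
    exact hpos _
  rcases le_total 0 t with h | h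
  · exact key t h ht
  · rw [← hψ.even ht]
    exact key (-t) (by linarith) (neg_mem_radii ht)

theorem intervalIntegrable (hψ : IsRadialProfile g P Ψ ψ) {t : ℝ} (ht : t ∈ radii g P) :
    IntervalIntegrable ψ MeasureTheory.volume 0 t :=
  (hψ.contDiffOn.continuousOn.mono
    ((ordConnected_radii g P).uIcc_subset (zero_mem_radii g P) ht)).intervalIntegrable

theorem hasDerivAt_primitive (hψ : IsRadialProfile g P Ψ ψ) {t : ℝ} (ht : t ∈ radii g P) :
    HasDerivAt (fun s => ∫ t in (0 : ℝ)..s, ψ t) (ψ t) t :=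
  intervalIntegral.integral_hasDerivAt_right (hψ.intervalIntegrable ht)
    (hψ.contDiffOn.continuousOn.stronglyMeasurableAtFilter (isOpen_radii g P) t ht)
    (hψ.contDiffOn.continuousOn.continuousAt ((isOpen_radii g P).mem_nhds ht))

theorem contDiffOn_primitive (hψ : IsRadialProfile g P Ψ ψ) :
    ContDiffOn ℝ ∞ (fun s => ∫ t in (0 : ℝ)..s, ψ t) (radii g P) := by
  rw [contDiffOn_infty_iff_deriv_of_isOpen (isOpen_radii g P)]
  exact ⟨fun t ht => (hψ.hasDerivAt_primitive ht).differentiableAt.differentiableWithinAt,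
    hψ.contDiffOn.congr fun t ht => (hψ.hasDerivAt_primitive ht).deriv⟩

theorem strictMonoOn_primitive (hm : 1 ≤ m) (hψ : IsRadialProfile g P Ψ ψ)
    (hpos : ∀ x, 0 < Ψ x) : StrictMonoOn (fun s => ∫ t in (0 : ℝ)..s, ψ t) (radii g P) :=
  strictMonoOn_of_deriv_pos (ordConnected_radii g P).convex hψ.contDiffOn_primitive.continuousOn
    fun t ht => by
      rw [(isOpen_radii g P).interior_eq] at ht
      rw [(hψ.hasDerivAt_primitive ht).deriv]
      exact hψ.pos hm hpos ht

theorem primitive_neg (hψ : IsRadialProfile g P Ψ ψ) {s : ℝ} (hs : s ∈ radii g P) :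
    ∫ t in (0 : ℝ)..(-s), ψ t = -∫ t in (0 : ℝ)..s, ψ t := by
  have h1 := intervalIntegral.integral_comp_neg (a := 0) (b := s) ψ
  rw [neg_zero] at h1
  have h2 : ∫ t in (0 : ℝ)..s, ψ (-t) = ∫ t in (0 : ℝ)..s, ψ t :=
    intervalIntegral.integral_congr fun t ht => hψ.even
      ((ordConnected_radii g P).uIcc_subset (zero_mem_radii g P) hs ht)
  rw [intervalIntegral.integral_symm, ← h1, h2]

theorem rayAvg_comp_expMap (hψ : IsRadialProfile g P Ψ ψ) {v : 𝔼 m}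
    (hv : v ∈ tangentBall g P (injRadius g P)) :
    rayAvg (Ψ ∘ expMap g P) v = rayAvg ψ (tnorm g P v) := by
  refine intervalIntegral.integral_congr fun t ht => ?_
  rw [uIcc_of_le zero_le_one] at ht
  change Ψ (expMap g P (t • v)) = ψ (t • tnorm g P v)
  rw [hψ.comp_expMap (smul_mem_tangentBall' hv ht), tnorm_smul, abs_of_nonneg ht.1, smul_eq_mul]

theorem tnorm_mul_rayAvg (hψ : IsRadialProfile g P Ψ ψ) {v : 𝔼 m}
    (hv : v ∈ tangentBall g P (injRadius g P)) :
    tnorm g P v * rayAvg (Ψ ∘ expMap g P) v = ∫ t in (0 : ℝ)..tnorm g P v, ψ t := by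
  have h2 := mul_rayAvg_smul ψ (tnorm g P v) 1
  simp only [smul_eq_mul, mul_one] at h2
  rw [hψ.rayAvg_comp_expMap hv, h2]

/-- The factor `Ψ P` of the new norm cancels the one in `stretch`, which leaves `|v|` times the mean
of `ψ` on `[0, |v|]`. -/
theorem tnorm_confMap (hψ : IsRadialProfile g P Ψ ψ) {v : 𝔼 m}
    (hv : v ∈ tangentBall g P (injRadius g P)) :
    tnorm (conformal g Ψ hΨ hpos) P (confMap g P Ψ v) = ∫ t in (0 : ℝ)..tnorm g P v, ψ t := by
  have hs := stretch_pos (goodRadius_injRadius g P) hΨ hpos hv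
  rw [tnorm_conformal, confMap, tnorm_smul, abs_of_pos hs, ← hψ.tnorm_mul_rayAvg hv, stretch]
  have := (hpos P).ne'
  field_simp

end IsRadialProfile

/-- The length, for the conformally changed metric, of the radial geodesics of the injectivity
ball. -/
def confRadius (g : RiemMetric m M) (P : M) (ψ : ℝ → ℝ) : ℝ≥0∞ :=
  ⨆ (s : ℝ) (_ : 0 ≤ s ∧ s ∈ radii g P), ENNReal.ofReal (∫ t in (0 : ℝ)..s, ψ t)

theorem exists_mem_radii_gt {s : ℝ} (hs : s ∈ radii g P) : ∃ t ∈ radii g P, s < t := by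
  obtain ⟨ε, hε, hb⟩ := Metric.isOpen_iff.1 (isOpen_radii g P) s hs
  refine ⟨s + ε / 2, hb ?_, by linarith⟩
  rw [Metric.mem_ball, Real.dist_eq, add_sub_cancel_left, abs_of_pos (by positivity)]
  linarith

theorem primitive_lt_confRadius (hm : 1 ≤ m) (hψ : IsRadialProfile g P Ψ ψ)
    (hpos : ∀ x, 0 < Ψ x) {s : ℝ} (hs0 : 0 ≤ s) (hs : s ∈ radii g P) :
    ENNReal.ofReal (∫ t in (0 : ℝ)..s, ψ t) < confRadius g P ψ := by
  obtain ⟨t, ht, hst⟩ := exists_mem_radii_gt hs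
  have hmono := hψ.strictMonoOn_primitive hm hpos
  have h1 : (0 : ℝ) ≤ ∫ t in (0 : ℝ)..s, ψ t := by
    have := hmono.monotoneOn (zero_mem_radii g P) hs hs0
    simpa using this
  have h2 := hmono hs ht hst
  refine lt_of_lt_of_le ((ENNReal.ofReal_lt_ofReal_iff (lt_of_le_of_lt h1 h2)).2 h2) ?_
  exact le_iSup₂_of_le t ⟨hs0.trans hst.le, ht⟩ le_rfl

theorem exists_primitive_eq (hψ : IsRadialProfile g P Ψ ψ) {r : ℝ} (hr0 : 0 ≤ r)
    (hr : ENNReal.ofReal r < confRadius g P ψ) :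
    ∃ s, 0 ≤ s ∧ s ∈ radii g P ∧ ∫ t in (0 : ℝ)..s, ψ t = r := by
  obtain ⟨s, hs⟩ := lt_iSup_iff.1 hr
  obtain ⟨⟨hs0, hsJ⟩, hlt⟩ := lt_iSup_iff.1 hs
  have hlt' : r < ∫ t in (0 : ℝ)..s, ψ t := ((ENNReal.ofReal_lt_ofReal_iff_of_nonneg hr0).1 hlt)
  have hsub : Icc 0 s ⊆ radii g P := (ordConnected_radii g P).out (zero_mem_radii g P) hsJ
  have hivt := intermediate_value_Icc hs0 (hψ.contDiffOn_primitive.continuousOn.mono hsub)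
  obtain ⟨u, hu, hur⟩ := hivt ⟨by simpa using hr0, hlt'.le⟩
  exact ⟨u, hu.1, hsub hu, hur⟩

theorem confMap_mem (hm : 1 ≤ m) (hψ : IsRadialProfile g P Ψ ψ) {v : 𝔼 m}
    (hv : v ∈ tangentBall g P (injRadius g P)) :
    confMap g P Ψ v ∈ tangentBall (conformal g Ψ hΨ hpos) P (confRadius g P ψ) := by
  rw [mem_tangentBall, hψ.tnorm_confMap hv]
  exact primitive_lt_confRadius hm hψ hpos (tnorm_nonneg g P v) (tnorm_mem_radii hv)

/-- The preimage of a vector under `confMap`, with the radius prescribed. -/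
theorem exists_confMap_eq (hψ : IsRadialProfile g P Ψ ψ) {w : 𝔼 m} {s : ℝ} (hs0 : 0 ≤ s)
    (hs : s ∈ radii g P) (hw : tnorm (conformal g Ψ hΨ hpos) P w = ∫ t in (0 : ℝ)..s, ψ t) :
    ∃ v ∈ tangentBall g P (injRadius g P), confMap g P Ψ v = w := by
  by_cases hw0 : w = 0
  · refine ⟨0, ?_, by simp [confMap, hw0]⟩
    rw [mem_tangentBall]
    simpa using injRadius_pos g P
  have hn := tnorm_pos g P hw0
  set v : 𝔼 m := (s / tnorm g P w) • w with hvdef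
  have hvn : tnorm g P v = s := by
    rw [hvdef, tnorm_smul, abs_of_nonneg (by positivity), div_mul_cancel₀ _ hn.ne']
  have hv : v ∈ tangentBall g P (injRadius g P) := by
    rw [mem_tangentBall, hvn, ← abs_of_nonneg hs0]
    exact hs
  refine ⟨v, hv, ?_⟩
  have h1 := hψ.tnorm_confMap (hΨ := hΨ) (hpos := hpos) hv
  have hst := stretch_pos (goodRadius_injRadius g P) hΨ hpos hv
  -- `confMap` preserves each ray, so `confMap g P Ψ v` and `w` are positive multiples of each
  -- other; equality of their norms makes them equal.
  rw [hvn, ← hw, tnorm_conformal, tnorm_conformal] at h1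
  have h2 := mul_left_cancel₀ (hpos P).ne' h1
  rw [confMap, tnorm_smul, hvn, abs_of_pos hst] at h2
  rw [confMap, hvdef, smul_smul, ← hvdef, mul_div_assoc', h2, div_self hn.ne', one_smul]

theorem image_confMap (hm : 1 ≤ m) (hψ : IsRadialProfile g P Ψ ψ) :
    confMap g P Ψ '' tangentBall g P (injRadius g P) =
      tangentBall (conformal g Ψ hΨ hpos) P (confRadius g P ψ) := by
  refine Subset.antisymm ?_ fun w hw => ?_
  · rintro _ ⟨v, hv, rfl⟩
    exact confMap_mem hm hψ hv
  · obtain ⟨s, hs0, hs, hsr⟩ := exists_primitive_eq hψ (tnorm_nonneg _ P w) hw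
    obtain ⟨v, hv, hvw⟩ := exists_confMap_eq hψ hs0 hs hsr.symm
    exact ⟨v, hv, hvw⟩

/-- `confMap` is a right factor of the injective map `exp_P`. -/
theorem injOn_confMap (hψ : IsRadialProfile g P Ψ ψ)
    (hΨ : ContMDiff (𝓡 m) 𝓘(ℝ, ℝ) ∞ Ψ) (hpos : ∀ x, 0 < Ψ x) :
    InjOn (confMap g P Ψ) (tangentBall g P (injRadius g P)) := by
  intro v hv w hw hvw
  refine (goodRadius_injRadius g P).injOn hv hw ?_
  rw [← (expMap_confMap (hΨ := hΨ) (hpos := hpos) hψ hv).2, hvw, (expMap_confMap hψ hw).2]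

/-- On this ball the new exponential map is `exp_P ∘ confMap⁻¹`, a composition of injective local
diffeomorphisms. This yields the lower bound for the new injectivity radius. -/
theorem goodRadius_confRadius (hm : 1 ≤ m) (hψ : IsRadialProfile g P Ψ ψ) :
    GoodRadius (conformal g Ψ hΨ hpos) P (confRadius g P ψ) := by
  have h := goodRadius_injRadius g P
  set g' := conformal g Ψ hΨ hpos with hg'
  set B := tangentBall g P (injRadius g P) with hB
  have hBo : IsOpen B := isOpen_tangentBall g P _
  have himg : confMap g P Ψ '' B = tangentBall g' P (confRadius g P ψ) := image_confMap hm hψ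
  have hinj := injOn_confMap hψ hΨ hpos
  obtain ⟨ho, hsm⟩ := smooth_inverse_of_injOn hBo (contDiffOn_confMap h hΨ) hinj fun v hv =>
    isInvertible_of_injective (injective_fderiv_confMap h hΨ hpos hv)
  have hleft : ∀ v ∈ B, Function.invFunOn (confMap g P Ψ) B (confMap g P Ψ v) = v := fun v hv =>
    hinj (Function.invFunOn_mem ⟨v, hv, rfl⟩) hv (Function.invFunOn_eq ⟨v, hv, rfl⟩)
  have hexp : ∀ v ∈ B, expMap g' P (confMap g P Ψ v) = expMap g P v := fun v hv =>
    (expMap_confMap hψ hv).2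
  have hsm' : ContMDiffOn (𝓡 m) (𝓡 m) ∞ (expMap g' P) (confMap g P Ψ '' B) := by
    refine (h.isParam.contMDiffOn.comp (contMDiffOn_iff_contDiffOn.2 hsm)
      fun w hw => Function.invFunOn_mem hw).congr ?_
    rintro _ ⟨v, hv, rfl⟩
    rw [hexp v hv, Function.comp_apply, hleft v hv]
  refine ⟨?_, ?_, ?_⟩
  · rw [← himg]
    rintro _ ⟨v, hv, rfl⟩
    exact (expMap_confMap hψ hv).1
  · rw [← himg]
    rintro _ ⟨v, hv, rfl⟩ _ ⟨w, hw, rfl⟩ hvw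
    rw [hexp v hv, hexp w hw] at hvw
    rw [h.injOn hv hw hvw]
  · rw [← himg]
    rintro ⟨_, v, hv, rfl⟩
    refine isLocalDiffeomorphAt_of_injective ho hsm' (mem_image_of_mem _ hv) ?_
    have hd : DifferentiableAt ℝ (confMap g P Ψ) v := ((contDiffOn_confMap h hΨ).contDiffAt
      (hBo.mem_nhds hv)).differentiableAt (by simp)
    have hmd : MDifferentiableAt (𝓡 m) (𝓡 m) (expMap g' P) (confMap g P Ψ v) :=
      (hsm'.contMDiffAt (ho.mem_nhds (mem_image_of_mem _ hv))).mdifferentiableAt (by simp)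
    have hev : expMap g P =ᶠ[𝓝 v] expMap g' P ∘ confMap g P Ψ := by
      filter_upwards [hBo.mem_nhds hv] with w hw
      exact (hexp w hw).symm
    have hcomp := dpar_comp hmd hd
    rw [← dpar_congr hev] at hcomp
    intro u₁ u₂ hu
    have hsurj : Function.Surjective (fderiv ℝ (confMap g P Ψ) v) :=
      LinearMap.injective_iff_surjective.1 (injective_fderiv_confMap h hΨ hpos hv)
    obtain ⟨x₁, rfl⟩ := hsurj u₁
    obtain ⟨x₂, rfl⟩ := hsurj u₂
    have h1 : dpar (expMap g P) v x₁ = dpar (expMap g P) v x₂ := by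
      rw [hcomp]; exact hu
    rw [h.isParam.injective v hv h1]

end Profile

/-! ### Extending the exponential map past the boundary of a ball. -/

section Extension

variable {m : ℕ} {M : Type*} [TopologicalSpace M]
  [ChartedSpace (EuclideanSpace ℝ (Fin m)) M] [IsManifold (𝓡 m) ∞ M] [T2Space M]

local notation "𝔼" m => EuclideanSpace ℝ (Fin m)

open Classical in
/-- Two geodesics which agree to first order at `t₀` can be glued. -/
theorem IsGeodesicOn.glue {g : RiemMetric m M} {γ₁ γ₂ : ℝ → M} {J₁ J₂ : Set ℝ}
    (h₁ : IsGeodesicOn g γ₁ J₁) (h₂ : IsGeodesicOn g γ₂ J₂) (ho₁ : IsOpen J₁) (ho₂ : IsOpen J₂)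
    (hc₁ : J₁.OrdConnected) (hc₂ : J₂.OrdConnected) {t₀ : ℝ} (ht₁ : t₀ ∈ J₁) (ht₂ : t₀ ∈ J₂)
    {p : M} (hp : γ₁ t₀ ∈ (chartAt (𝔼 m) p).source) (h0 : γ₁ t₀ = γ₂ t₀)
    (h0' : deriv (fun τ => coord m p (γ₁ τ)) t₀ = deriv (fun τ => coord m p (γ₂ τ)) t₀) :
    ∃ γ : ℝ → M, IsGeodesicOn g γ (J₁ ∪ J₂) ∧ EqOn γ γ₁ J₁ ∧ EqOn γ γ₂ J₂ := by
  have heq : EqOn γ₁ γ₂ (J₁ ∩ J₂) :=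
    (h₁.mono inter_subset_left).eqOn (h₂.mono inter_subset_right) (ho₁.inter ho₂)
      (hc₁.inter hc₂).isPreconnected ⟨ht₁, ht₂⟩ hp h0 h0'
  have e₁ : EqOn (J₁.piecewise γ₁ γ₂) γ₁ J₁ := piecewise_eqOn J₁ γ₁ γ₂
  have e₂ : EqOn (J₁.piecewise γ₁ γ₂) γ₂ J₂ := by
    intro t ht
    by_cases h : t ∈ J₁
    · rw [e₁ h, heq ⟨h, ht⟩]
    · exact piecewise_eq_of_notMem J₁ γ₁ γ₂ h
  exact ⟨J₁.piecewise γ₁ γ₂, (h₁.congr ho₁ e₁).union (h₂.congr ho₂ e₂) ho₁ ho₂, e₁, e₂⟩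

/-- If the geodesic `t ↦ exp(t v₀)` and its velocity have a limit for `t → 1`, then the exponential
map is defined and smooth near `v₀`. -/
theorem GoodRadius.exists_extension {g : RiemMetric m M} {P : M} {R : ℝ≥0∞}
    (h : GoodRadius g P R) {v₀ : 𝔼 m}
    (hv₀ : ∀ t ∈ Ico (0 : ℝ) 1, t • v₀ ∈ tangentBall g P R) {p : M} {ξ : 𝔼 m}
    (hp : Filter.Tendsto (fun t : ℝ => expMap g P (t • v₀)) (𝓝[<] 1) (𝓝 p))
    (hξ : Filter.Tendsto (fun t : ℝ => deriv (fun s : ℝ => coord m p (expMap g P (s • v₀))) t)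
      (𝓝[<] 1) (𝓝 ξ)) :
    ∃ O, IsOpen O ∧ v₀ ∈ O ∧ O ⊆ expDomain g P ∧ ContMDiffOn (𝓡 m) (𝓡 m) ∞ (expMap g P) O := by
  set B := tangentBall g P R with hB
  set F := expMap g P with hF
  have hBo : IsOpen B := isOpen_tangentBall g P R
  have hsrc := (chartAt (𝔼 m) p).open_source
  have hps : p ∈ (chartAt (𝔼 m) p).source := mem_chart_source _ p
  obtain ⟨W, hW, hzW, δ, hδ, Φ, hΦ, hflow⟩ := exists_geodesic_flow g p (z₀ := (coord m p p, ξ))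
    (mem_extChartAt_target p)
  have hco : ContinuousAt (coord m p) p := continuousAt_extChartAt p
  have hstate : Filter.Tendsto (fun t : ℝ => (coord m p (F (t • v₀)),
      deriv (fun s : ℝ => coord m p (F (s • v₀))) t)) (𝓝[<] 1) (𝓝 (coord m p p, ξ)) :=
    (hco.tendsto.comp hp).prodMk_nhds hξ
  -- `t₁ < 1` is so close to `1` that the state of the geodesic lies in the domain `W` of the local
  -- flow at the limit state, and the remaining time `1 - t₁` is less than `δ`.
  obtain ⟨t₁, ⟨⟨hst₁, hsrc₁⟩, ht₁lo⟩, ht₁hi⟩ := (((hstate.eventually (hW.mem_nhds hzW)).and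
    (hp.eventually (hsrc.mem_nhds hps))).and (mem_nhdsWithin_of_mem_nhds (Ioi_mem_nhds
      (show max (1 - δ) 0 < 1 from max_lt (by linarith) one_pos)))).and self_mem_nhdsWithin |>.exists
  have ht₁0 : 0 < t₁ := lt_of_le_of_lt (le_max_right _ _) ht₁lo
  have ht₁δ : 1 - δ < t₁ := lt_of_le_of_lt (le_max_left _ _) ht₁lo
  have ht₁1 : t₁ < 1 := ht₁hi
  let U := B ∩ F ⁻¹' (chartAt (𝔼 m) p).source
  have hU : IsOpen U := h.isParam.contMDiffOn.continuousOn.isOpen_inter_preimage hBo hsrc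
  have hcF : ContDiffOn ℝ ∞ (coord m p ∘ F) U := by
    rw [← contMDiffOn_iff_contDiffOn]
    exact (contMDiffOn_coord p).comp (h.isParam.contMDiffOn.mono inter_subset_left) fun z hz => hz.2
  have hdF : ContDiffOn ℝ ∞ (fderiv ℝ (coord m p ∘ F)) U := hcF.fderiv_of_isOpen hU (by simp)
  let U₁ : Set (𝔼 m) := {v | t₁ • v ∈ U}
  have hsmul : ContDiff ℝ ∞ fun v : 𝔼 m => t₁ • v := contDiff_const_smul t₁
  have hU₁ : IsOpen U₁ := hU.preimage hsmul.continuous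
  -- `Z v` is the position and velocity at time `t₁` of the geodesic with initial velocity `v`. It
  -- is smooth in `v` because `F` is smooth on the ball; flowing for time `1 - t₁` from `Z v` then
  -- defines `F v` for `v` near `v₀`.
  let Z : (𝔼 m) → (𝔼 m) × (𝔼 m) := fun v =>
    (coord m p (F (t₁ • v)), fderiv ℝ (coord m p ∘ F) (t₁ • v) v)
  have hZ : ContDiffOn ℝ ∞ Z U₁ := by
    refine ContDiffOn.prodMk (hcF.comp hsmul.contDiffOn fun v hv => hv) ?_
    exact (hdF.comp hsmul.contDiffOn fun v hv => hv).clm_apply contDiffOn_id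
  have hderiv : ∀ v ∈ U₁, deriv (fun s : ℝ => coord m p (F (s • v))) t₁ = (Z v).2 := by
    intro v hv
    have hd : HasFDerivAt (coord m p ∘ F) (fderiv ℝ (coord m p ∘ F) (t₁ • v)) (t₁ • v) :=
      ((hcF.contDiffAt (hU.mem_nhds hv)).differentiableAt (by simp)).hasFDerivAt
    exact (hd.comp_hasDerivAt t₁ (hasDerivAt_smul_curve v t₁)).deriv
  have hv₀U : v₀ ∈ U₁ := ⟨hv₀ t₁ ⟨ht₁0.le, ht₁1⟩, hsrc₁⟩
  let O := U₁ ∩ Z ⁻¹' W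
  have hO : IsOpen O := hZ.continuousOn.isOpen_inter_preimage hU₁ hW
  have hv₀O : v₀ ∈ O := by
    refine ⟨hv₀U, ?_⟩
    have h1 := hderiv v₀ hv₀U
    have h2 : Z v₀ = (coord m p (F (t₁ • v₀)),
      deriv (fun s : ℝ => coord m p (F (s • v₀))) t₁) := by rw [h1]
    rw [mem_preimage, h2]
    exact hst₁
  have hτ : 1 - t₁ ∈ Ioo (-δ) δ := ⟨by linarith, by linarith⟩
  have hkey : ∀ v ∈ O, v ∈ expDomain g P ∧ F v = coordInv m p (Φ (Z v, 1 - t₁)) := by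
    rintro v ⟨hvU, hvW⟩
    obtain ⟨hΦ0, hΦd, hΦt, hΦg⟩ := hflow _ hvW
    obtain ⟨ε, hε, hray, -⟩ := exists_ray (h.subset hvU.1)
    set J₁ : Set ℝ := (fun t => t₁⁻¹ * t + 0) ⁻¹' Ioo (-ε) (1 + ε) with hJ₁
    set J₂ : Set ℝ := (fun t => 1 * t + -t₁) ⁻¹' Ioo (-δ) δ with hJ₂
    have ho₁ : IsOpen J₁ := isOpen_Ioo.preimage (by fun_prop)
    have ho₂ : IsOpen J₂ := isOpen_Ioo.preimage (by fun_prop)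
    have hmono₁ : Monotone fun t : ℝ => t₁⁻¹ * t + 0 := fun a b hab => by
      have := inv_pos.2 ht₁0
      simp only [add_zero]
      gcongr
    have hmono₂ : Monotone fun t : ℝ => 1 * t + -t₁ := fun a b hab => by simpa using hab
    have hc₁ : J₁.OrdConnected := ordConnected_Ioo.preimage_mono hmono₁
    have hc₂ : J₂.OrdConnected := ordConnected_Ioo.preimage_mono hmono₂
    have h0J₁ : (0 : ℝ) ∈ J₁ := by
      rw [hJ₁, mem_preimage]
      constructor <;> linarith
    have htJ₁ : t₁ ∈ J₁ := by
      rw [hJ₁, mem_preimage, inv_mul_cancel₀ ht₁0.ne']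
      constructor <;> linarith
    have htJ₂ : t₁ ∈ J₂ := by
      rw [hJ₂, mem_preimage]
      constructor <;> linarith
    have h1J₂ : (1 : ℝ) ∈ J₂ := by
      rw [hJ₂, mem_preimage]
      constructor <;> linarith
    have hγ₁ : IsGeodesicOn g (fun t : ℝ => F (t • v)) J₁ := by
      refine (hray.1.comp_affine isOpen_Ioo t₁⁻¹ 0).congr ho₁ fun t _ => ?_
      simp only [add_zero, smul_smul]
      rw [mul_assoc, mul_comm t, ← mul_assoc, inv_mul_cancel₀ ht₁0.ne', one_mul]
    have hγ₂ := hΦg.comp_affine isOpen_Ioo 1 (-t₁)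
    have hright : ∀ t ∈ J₂, coord m p (coordInv m p (Φ (Z v, 1 * t + -t₁))) =
        Φ (Z v, 1 * t + -t₁) := fun t ht => (extChartAt (𝓡 m) p).right_inv (hΦt _ ht)
    have hval : F (t₁ • v) = coordInv m p (Φ (Z v, 1 * t₁ + -t₁)) := by
      rw [one_mul, add_neg_cancel, hΦ0]
      exact ((extChartAt (𝓡 m) p).left_inv (by rw [extChartAt_source]; exact hvU.2)).symm
    have hvel : deriv (fun t : ℝ => coord m p (F (t • v))) t₁ =
        deriv (fun t => coord m p (coordInv m p (Φ (Z v, 1 * t + -t₁)))) t₁ := by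
      have hev : (fun t => coord m p (coordInv m p (Φ (Z v, 1 * t + -t₁)))) =ᶠ[𝓝 t₁]
          fun t => Φ (Z v, t + -t₁) := by
        filter_upwards [ho₂.mem_nhds htJ₂] with t ht
        rw [hright t ht, one_mul]
      rw [hev.deriv_eq, deriv_comp_add_const (fun s => Φ (Z v, s)) (-t₁) t₁, add_neg_cancel,
        hΦd.deriv, hderiv v hvU]
    obtain ⟨γ, hγ, e₁, e₂⟩ := hγ₁.glue hγ₂ ho₁ ho₂ hc₁ hc₂ htJ₁ htJ₂ (p := p) hvU.2 hval hvel
    have hγ0 : γ 0 = P := by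
      rw [e₁ h0J₁]
      simpa using hray.map_zero
    have hst : IsGeodesicStart g P v γ (J₁ ∪ J₂) := by
      refine ⟨hγ, hγ0, ?_⟩
      have hev : (fun s => coord m P (γ s)) =ᶠ[𝓝 0]
          fun s => (fun τ : ℝ => coord m P (F (τ • t₁ • v))) (t₁⁻¹ * s) := by
        filter_upwards [ho₁.mem_nhds h0J₁] with s hs
        rw [e₁ hs, smul_smul, mul_assoc, mul_comm s, ← mul_assoc, inv_mul_cancel₀ ht₁0.ne', one_mul]
      have hcm := deriv_comp_mul_left t₁⁻¹ (fun τ : ℝ => coord m P (F (τ • t₁ • v))) 0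
      rw [hev.deriv_eq, hcm, mul_zero, hray.velocity, smul_smul,
        inv_mul_cancel₀ ht₁0.ne', one_smul]
    have hconn : (J₁ ∪ J₂).OrdConnected :=
      (hc₁.isPreconnected.union t₁ htJ₁ htJ₂ hc₂.isPreconnected).ordConnected
    have := hst.expMap_smul (ho₁.union ho₂) hconn (Or.inl h0J₁) (t := 1) (Or.inr h1J₂)
    rw [one_smul] at this
    refine ⟨this.1, this.2.trans ?_⟩
    rw [e₂ h1J₂]
    simp only [one_mul, ← sub_eq_add_neg]
  refine ⟨O, hO, hv₀O, fun v hv => (hkey v hv).1, ?_⟩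
  have hpar := isParam_coordInv (m := m) p
  have h1 : ContDiffOn ℝ ∞ (fun v => Φ (Z v, 1 - t₁)) O :=
    hΦ.comp ((hZ.mono inter_subset_left).prodMk contDiffOn_const) fun v hv => ⟨hv.2, hτ⟩
  exact (hpar.contMDiffOn.comp (contMDiffOn_iff_contDiffOn.2 h1)
    fun v hv => (hflow _ hv.2).2.2.1 _ hτ).congr fun v hv => (hkey v hv).2

end Extension

/-! ### The injectivity radius of the conformal metric. -/

section ConformalRadius

variable {m : ℕ} {M : Type*} [TopologicalSpace M]
  [ChartedSpace (EuclideanSpace ℝ (Fin m)) M] [IsManifold (𝓡 m) ∞ M] [T2Space M]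

local notation "𝔼" m => EuclideanSpace ℝ (Fin m)

variable {g : RiemMetric m M} {P : M} {Ψ : M → ℝ} {hΨ : ContMDiff (𝓡 m) 𝓘(ℝ, ℝ) ∞ Ψ}
  {hpos : ∀ x, 0 < Ψ x} {ψ : ℝ → ℝ}

theorem tendsto_primitive_confRadius (hm : 1 ≤ m) (hψ : IsRadialProfile g P Ψ ψ)
    (hpos : ∀ x, 0 < Ψ x) {ι r : ℝ} (hι0 : 0 < ι) (hι : ENNReal.ofReal ι = injRadius g P)
    (hr : ENNReal.ofReal r = confRadius g P ψ) :
    Filter.Tendsto (fun t : ℝ => ∫ s in (0 : ℝ)..(t * ι), ψ s) (𝓝[<] 1) (𝓝 r) := by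
  have hmem : ∀ t ∈ Ioo (0 : ℝ) 1, 0 ≤ t * ι ∧ t * ι ∈ radii g P := by
    intro t ht
    have h0 : 0 ≤ t * ι := mul_nonneg ht.1.le hι0.le
    refine ⟨h0, ?_⟩
    change ENNReal.ofReal |_| < _
    rw [abs_of_nonneg h0, ← hι, ENNReal.ofReal_lt_ofReal_iff hι0]
    nlinarith [ht.2]
  have hIoo : Ioo (0 : ℝ) 1 ∈ 𝓝[<] (1 : ℝ) := Ioo_mem_nhdsLT one_pos
  have hmono := hψ.strictMonoOn_primitive hm hpos
  rw [tendsto_order]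
  constructor
  · intro x hx
    rcases lt_or_ge x 0 with hx0 | hx0
    · filter_upwards [hIoo] with t ht
      have := hmono.monotoneOn (zero_mem_radii g P) (hmem t ht).2 (hmem t ht).1
      simp only [intervalIntegral.integral_same] at this
      linarith
    · have hxr : ENNReal.ofReal x < confRadius g P ψ := by
        rw [← hr]; exact (ENNReal.ofReal_lt_ofReal_iff_of_nonneg hx0).2 hx
      obtain ⟨s, hs0, hs, hsx⟩ := exists_primitive_eq hψ hx0 hxr
      have hsι : s < ι := by
        have : ENNReal.ofReal |s| < _ := hs
        rwa [abs_of_nonneg hs0, ← hι, ENNReal.ofReal_lt_ofReal_iff hι0] at this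
      have hlt : s / ι < 1 := (div_lt_one hι0).2 hsι
      filter_upwards [hIoo, Ioo_mem_nhdsLT hlt] with t ht ht'
      rw [← hsx]
      exact hmono hs (hmem t ht).2 ((div_lt_iff₀ hι0).1 ht'.1)
  · intro x hx
    filter_upwards [hIoo] with t ht
    have := primitive_lt_confRadius hm hψ hpos (hmem t ht).1 (hmem t ht).2
    rw [← hr] at this
    exact (ENNReal.ofReal_lt_ofReal_iff'.1 this).1.trans hx

/-- If the injectivity radius is finite, and the one of the conformally changed metric exceeds
the expected value, then the exponential map extends beyond the boundary of the ball. -/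
theorem exists_extension_of_confRadius_lt (hm : 1 ≤ m) (hψ : IsRadialProfile g P Ψ ψ)
    {ι r : ℝ} (hι0 : 0 < ι) (hι : ENNReal.ofReal ι = injRadius g P)
    (hr0 : 0 ≤ r) (hr : ENNReal.ofReal r = confRadius g P ψ)
    (hlt : confRadius g P ψ < injRadius (conformal g Ψ hΨ hpos) P) {v₀ : 𝔼 m}
    (hv₀ : tnorm g P v₀ = ι) :
    (r / (Ψ P * ι)) • v₀ ∈ tangentBall (conformal g Ψ hΨ hpos) P
      (injRadius (conformal g Ψ hΨ hpos) P) ∧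
    expMap g P v₀ = expMap (conformal g Ψ hΨ hpos) P ((r / (Ψ P * ι)) • v₀) ∧
    ∃ O, IsOpen O ∧ v₀ ∈ O ∧ O ⊆ expDomain g P ∧ ContMDiffOn (𝓡 m) (𝓡 m) ∞ (expMap g P) O := by
  set g' := conformal g Ψ hΨ hpos with hg'
  have h := goodRadius_injRadius g P
  have h' := goodRadius_injRadius g' P
  set F := expMap g P with hF
  set F' := expMap g' P with hF'
  set B := tangentBall g P (injRadius g P) with hB
  set B' := tangentBall g' P (injRadius g' P) with hB'
  have hB'o : IsOpen B' := isOpen_tangentBall g' P _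
  have hΨP := hpos P
  have hIoo : Ioo (0 : ℝ) 1 ∈ 𝓝[<] (1 : ℝ) := Ioo_mem_nhdsLT one_pos
  have htv : ∀ t ∈ Ico (0 : ℝ) 1, t • v₀ ∈ B := by
    intro t ht
    rw [hB, mem_tangentBall, tnorm_smul, hv₀, ← hι, ENNReal.ofReal_lt_ofReal_iff hι0,
      abs_of_nonneg ht.1]
    nlinarith [ht.2]
  have hmem : ∀ t ∈ Ioo (0 : ℝ) 1, t * ι ∈ radii g P := fun t ht => by
    have := tnorm_mem_radii (htv t ⟨ht.1.le, ht.2⟩)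
    rwa [tnorm_smul, hv₀, abs_of_pos ht.1] at this
  -- On the ray through `v₀`, `confMap` multiplies by a scalar: it sends `t v₀` to `b t v₀`. As `t →
  -- 1` these vectors tend to `b₁ v₀`, of `g'`-norm `r`, which by assumption is interior to the
  -- injectivity ball of `g'`.
  let b : ℝ → ℝ := fun t => (∫ s in (0 : ℝ)..(t * ι), ψ s) / (Ψ P * ι)
  set b₁ := r / (Ψ P * ι) with hb₁
  have hb : Filter.Tendsto b (𝓝[<] 1) (𝓝 b₁) :=
    (tendsto_primitive_confRadius hm hψ hpos hι0 hι hr).div_const _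
  have hFb : ∀ t ∈ Ioo (0 : ℝ) 1, F (t • v₀) = F' (b t • v₀) := by
    intro t ht
    have ht' := htv t ⟨ht.1.le, ht.2⟩
    have h1 := (expMap_confMap (hΨ := hΨ) (hpos := hpos) hψ ht').2
    have h2 := hψ.tnorm_mul_rayAvg ht'
    rw [tnorm_smul, hv₀, abs_of_pos ht.1] at h2
    have h3 : confMap g P Ψ (t • v₀) = b t • v₀ := by
      rw [confMap, smul_smul, stretch]
      congr 1
      change _ = (∫ s in (0 : ℝ)..(t * ι), ψ s) / (Ψ P * ι)
      rw [← h2]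
      field_simp
    rw [h3] at h1
    exact h1.symm
  have hbd : ∀ t ∈ Ioo (0 : ℝ) 1, HasDerivAt b (Ψ (F (t • v₀)) / Ψ P) t := by
    intro t ht
    have h1 := (hψ.hasDerivAt_primitive (hmem t ht)).comp t ((hasDerivAt_id t).mul_const ι)
    have h2 := h1.div_const (Ψ P * ι)
    refine h2.congr_deriv ?_
    have h3 := hψ.comp_expMap (htv t ⟨ht.1.le, ht.2⟩)
    rw [tnorm_smul, hv₀, abs_of_pos ht.1] at h3
    rw [hF, h3]
    field_simp
  have hw₀ : b₁ • v₀ ∈ B' := by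
    rw [hB', mem_tangentBall, tnorm_conformal, tnorm_smul, hv₀, abs_of_nonneg (by positivity)]
    have : Ψ P * (b₁ * ι) = r := by rw [hb₁]; field_simp
    rw [this, hr]
    exact hlt
  set p := F' (b₁ • v₀) with hp
  have hbv : Filter.Tendsto (fun t => b t • v₀) (𝓝[<] 1) (𝓝 (b₁ • v₀)) := hb.smul_const v₀
  have hFp : Filter.Tendsto (fun t : ℝ => F (t • v₀)) (𝓝[<] 1) (𝓝 p) := by
    refine ((h'.isParam.continuousAt hw₀).tendsto.comp hbv).congr' ?_
    filter_upwards [hIoo] with t ht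
    exact (hFb t ht).symm
  let U' := B' ∩ F' ⁻¹' (chartAt (𝔼 m) p).source
  have hU' : IsOpen U' := h'.isParam.contMDiffOn.continuousOn.isOpen_inter_preimage hB'o
    (chartAt (𝔼 m) p).open_source
  have hw₀U : b₁ • v₀ ∈ U' := ⟨hw₀, mem_chart_source _ p⟩
  have hcF : ContDiffOn ℝ ∞ (coord m p ∘ F') U' := by
    rw [← contMDiffOn_iff_contDiffOn]
    exact (contMDiffOn_coord p).comp (h'.isParam.contMDiffOn.mono inter_subset_left)
      fun z hz => hz.2
  -- The velocity has a limit because near `t = 1` the ray is the smooth map `F'` along `b t v₀`,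
  -- and `b'` converges.
  have hξ : Filter.Tendsto (fun t : ℝ => deriv (fun s : ℝ => coord m p (F (s • v₀))) t)
      (𝓝[<] 1) (𝓝 ((Ψ p / Ψ P) • fderiv ℝ (coord m p ∘ F') (b₁ • v₀) v₀)) := by
    have hdc : ContinuousAt (fderiv ℝ (coord m p ∘ F')) (b₁ • v₀) :=
      (hcF.continuousOn_fderiv_of_isOpen hU' (by simp)).continuousAt (hU'.mem_nhds hw₀U)
    have h1 : Filter.Tendsto (fun t : ℝ => (Ψ (F (t • v₀)) / Ψ P) •
        fderiv ℝ (coord m p ∘ F') (b t • v₀) v₀) (𝓝[<] 1)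
        (𝓝 ((Ψ p / Ψ P) • fderiv ℝ (coord m p ∘ F') (b₁ • v₀) v₀)) := by
      refine (((hΨ.continuous.tendsto p).comp hFp).div_const _).smul ?_
      have h2 : ContinuousAt (fun x => fderiv ℝ (coord m p ∘ F') x v₀) (b₁ • v₀) :=
        hdc.clm_apply continuousAt_const
      exact h2.tendsto.comp hbv
    refine h1.congr' ?_
    filter_upwards [hIoo, hbv.eventually (hU'.mem_nhds hw₀U)] with t ht htU
    have hd : HasFDerivAt (coord m p ∘ F') (fderiv ℝ (coord m p ∘ F') (b t • v₀)) (b t • v₀) :=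
      ((hcF.contDiffAt (hU'.mem_nhds htU)).differentiableAt (by simp)).hasFDerivAt
    have h2 := hd.comp_hasDerivAt t ((hbd t ht).smul_const v₀)
    have hev : (fun s : ℝ => coord m p (F (s • v₀))) =ᶠ[𝓝 t]
        (coord m p ∘ F') ∘ fun s => b s • v₀ := by
      filter_upwards [isOpen_Ioo.mem_nhds ht] with s hs
      simp only [Function.comp_apply, hFb s hs]
    rw [hev.deriv_eq, h2.deriv, map_smul]
  obtain ⟨O, hO, hvO, hOd, hOs⟩ := h.exists_extension htv hFp hξ
  refine ⟨hw₀, ?_, O, hO, hvO, hOd, hOs⟩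
  have hc : Filter.Tendsto (fun t : ℝ => F (t • v₀)) (𝓝[<] 1) (𝓝 (F v₀)) := by
    have h1 : ContinuousAt F v₀ := (hOs.contMDiffAt (hO.mem_nhds hvO)).continuousAt
    have h2 : Filter.Tendsto (fun t : ℝ => t • v₀) (𝓝[<] 1) (𝓝 v₀) := by
      have : ContinuousAt (fun t : ℝ => t • v₀) 1 := by fun_prop
      rw [ContinuousAt, one_smul] at this
      exact this.mono_left nhdsWithin_le_nhds
    exact h1.tendsto.comp h2
  exact tendsto_nhds_unique hc hFp

/-- The exponential map is a local diffeomorphism at the boundary of the ball. -/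
theorem isLocalDiffeomorphAt_of_confRadius_lt (hm : 1 ≤ m) (hψ : IsRadialProfile g P Ψ ψ)
    {ι r : ℝ} (hι0 : 0 < ι) (hι : ENNReal.ofReal ι = injRadius g P)
    (hr0 : 0 < r) (hr : ENNReal.ofReal r = confRadius g P ψ)
    (hlt : confRadius g P ψ < injRadius (conformal g Ψ hΨ hpos) P) {v₀ : 𝔼 m}
    (hv₀ : tnorm g P v₀ = ι) :
    IsLocalDiffeomorphAt (𝓡 m) (𝓡 m) ∞ (expMap g P) v₀ := by
  have h := goodRadius_injRadius g P
  have h' := goodRadius_injRadius (conformal g Ψ hΨ hpos) P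
  have key := fun {v : 𝔼 m} (hv : tnorm g P v = ι) =>
    exists_extension_of_confRadius_lt hm hψ hι0 hι hr0.le hr hlt hv
  obtain ⟨hw₀, -, O, hO, hvO, hOd, hOs⟩ := key hv₀
  set b₁ := r / (Ψ P * ι) with hb₁
  have hb₁0 : b₁ ≠ 0 := (div_pos hr0 (mul_pos (hpos P) hι0)).ne'
  refine isLocalDiffeomorphAt_of_injective hO hOs hvO ?_
  have hmd : MDifferentiableAt (𝓡 m) (𝓡 m) (expMap g P) v₀ :=
    (hOs.contMDiffAt (hO.mem_nhds hvO)).mdifferentiableAt (by simp)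
  rw [injective_iff_map_eq_zero]
  intro w hw
  -- The Gauss lemma extends to the sphere by continuity. Hence a kernel vector `w` of the
  -- differential is orthogonal to `v₀`, that is, tangent to the sphere.
  have hgauss : pull g (expMap g P) v₀ v₀ w = form g P v₀ w := by
    have h1 : ContinuousAt (fun v => pull g (expMap g P) v v₀ w) v₀ :=
      (contDiffAt_pull_apply g (hOs.contMDiffAt (hO.mem_nhds hvO)) v₀ w).continuousAt
    have h2 : Filter.Tendsto (fun t : ℝ => t • v₀) (𝓝[<] 1) (𝓝 v₀) := by
      have : ContinuousAt (fun t : ℝ => t • v₀) 1 := by fun_prop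
      rw [ContinuousAt, one_smul] at this
      exact this.mono_left nhdsWithin_le_nhds
    refine tendsto_nhds_unique (h1.tendsto.comp h2) (tendsto_const_nhds.congr' ?_)
    filter_upwards [Ioo_mem_nhdsLT one_pos] with t ht
    refine (h.gauss_line ?_ w).symm
    rw [mem_tangentBall, tnorm_smul, hv₀, ← hι, ENNReal.ofReal_lt_ofReal_iff hι0,
      abs_of_pos ht.1]
    nlinarith [ht.2]
  rw [pull_apply, hw, map_zero] at hgauss
  let D : ℝ → ℝ := fun θ => ι ^ 2 + θ ^ 2 * form g P w w
  have hD : ∀ θ, 0 < D θ := fun θ =>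
    add_pos_of_pos_of_nonneg (by positivity) (mul_nonneg (sq_nonneg θ) (form_self_nonneg g P w))
  -- `exp_P v` is known to equal the new exponential of `b₁ v` only for `v` on the sphere. The curve
  -- `k` therefore stays on the sphere; its velocity at `0` is `w`, so the injective differential of
  -- the new exponential map kills `b₁ w`.
  let k : ℝ → 𝔼 m := fun θ => (ι / √(D θ)) • (v₀ + θ • w)
  have hkn : ∀ θ, tnorm g P (k θ) = ι := by
    intro θ
    have h1 : tnorm g P (v₀ + θ • w) = √(D θ) := by
      rw [tnorm]
      congr 1
      simp only [map_add, map_smul, add_apply, smul_apply, smul_eq_mul]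
      rw [form_symm g P w v₀, ← hgauss, ← tnorm_sq g P v₀, hv₀]
      ring
    have h2 : 0 < √(D θ) := Real.sqrt_pos.2 (hD θ)
    rw [tnorm_smul, h1, abs_of_pos (by positivity)]
    field_simp
  have hk0 : k 0 = v₀ := by
    have : √(D 0) = ι := by simp [D, Real.sqrt_sq hι0.le]
    simp [k, this, hι0.ne']
  have hkd : HasDerivAt k w 0 := by
    have h1 : HasDerivAt D 0 0 := by
      refine (((hasDerivAt_pow 2 (0 : ℝ)).mul_const (form g P w w)).const_add (ι ^ 2)).congr_deriv ?_
      simp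
    have h2 : HasDerivAt (fun θ => ι / √(D θ)) 0 0 := by
      have := (h1.sqrt (hD 0).ne').inv (Real.sqrt_pos.2 (hD 0)).ne' |>.const_mul ι
      simpa [div_eq_mul_inv] using this
    have h3 : HasDerivAt (fun θ : ℝ => v₀ + θ • w) w 0 := (hasDerivAt_smul_curve w 0).const_add v₀
    have h4 : HasDerivAt k _ 0 := h2.smul h3
    have h5 : ι / √(D 0) = 1 := by simp [D, Real.sqrt_sq hι0.le, hι0.ne']
    simpa [h5] using h4
  have hv1 := velocity_comp (m := m) (f := expMap g P) (c := k) (γ := expMap g P ∘ k) (t := 0)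
    (by rwa [hk0]) hkd.differentiableAt Filter.EventuallyEq.rfl
  have hv2 := velocity_comp (m := m) (f := expMap (conformal g Ψ hΨ hpos) P)
    (c := fun θ => b₁ • k θ) (γ := expMap g P ∘ k) (t := 0)
    (by rw [hk0]; exact h'.isParam.mdifferentiableAt hw₀)
    (hkd.differentiableAt.const_smul b₁)
    (Filter.Eventually.of_forall fun θ => (key (hkn θ)).2.1)
  rw [hv1, hk0, hkd.deriv, hw, (hkd.fun_const_smul b₁).deriv] at hv2
  have := h'.isParam.injective _ hw₀ ((map_zero _).trans hv2)
  exact (smul_eq_zero.1 this.symm).resolve_left hb₁0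

/-- The injectivity radius of the conformally changed metric. -/
theorem injRadius_conformal [ConnectedSpace M] (hm : 1 ≤ m) (hψ : IsRadialProfile g P Ψ ψ) :
    injRadius (conformal g Ψ hΨ hpos) P = confRadius g P ψ := by
  refine le_antisymm (not_lt.1 fun hlt => ?_) (goodRadius_confRadius hm hψ).le
  have h := goodRadius_injRadius g P
  have h' := goodRadius_injRadius (conformal g Ψ hΨ hpos) P
  have hrtop : confRadius g P ψ ≠ ⊤ := (lt_of_lt_of_le hlt le_top).ne
  set r := (confRadius g P ψ).toReal with hrdef
  have hr : ENNReal.ofReal r = confRadius g P ψ := ENNReal.ofReal_toReal hrtop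
  have hr0 : 0 < r := by
    have := primitive_lt_confRadius hm hψ hpos le_rfl (zero_mem_radii g P)
    rw [← hr] at this
    simpa using this
  by_cases htop : injRadius g P = ⊤
  -- Infinite radius: finite distances make the injectivity ball of `g` all of `M`, so the new
  -- exponential of a vector `w` of norm `r` is also attained at some `confMap g P Ψ v`, whose norm
  -- is less than `r`. This contradicts injectivity.
  · obtain ⟨w, hw⟩ := exists_tnorm_eq hm (conformal g Ψ hΨ hpos) P hr0.le
    have hwB : w ∈ tangentBall (conformal g Ψ hΨ hpos) P (injRadius (conformal g Ψ hΨ hpos) P) := by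
      rw [mem_tangentBall, hw, hr]
      exact hlt
    have hmem : expMap (conformal g Ψ hΨ hpos) P w ∈ injBall g P := by
      change gEDist g P _ < injRadius g P
      rw [htop]
      exact gEDist_lt_top g P _
    rw [injBall_eq] at hmem
    obtain ⟨v, hv, hvw⟩ := hmem
    rw [← (expMap_confMap (hΨ := hΨ) (hpos := hpos) hψ hv).2] at hvw
    have hmem' := confMap_mem (hΨ := hΨ) (hpos := hpos) hm hψ hv
    have := h'.injOn (tangentBall_mono _ P hlt.le hmem') hwB hvw
    rw [this, mem_tangentBall, hw, hr] at hmem'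
    exact lt_irrefl _ hmem'
  · set ι := (injRadius g P).toReal with hιdef
    have hι : ENNReal.ofReal ι = injRadius g P := ENNReal.ofReal_toReal htop
    have hι0 : 0 < ι := ENNReal.toReal_pos (injRadius_pos g P).ne' htop
    have hmemB : ∀ v : 𝔼 m, v ∈ tangentBall g P (injRadius g P) ↔ tnorm g P v < ι := fun v => by
      rw [mem_tangentBall, ← hι, ENNReal.ofReal_lt_ofReal_iff hι0]
    have key := fun {v : 𝔼 m} (hv : tnorm g P v = ι) =>
      exists_extension_of_confRadius_lt hm hψ hι0 hι hr0.le hr hlt hv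
    have hld : ∀ v : 𝔼 m, tnorm g P v ≤ ι →
        IsLocalDiffeomorphAt (𝓡 m) (𝓡 m) ∞ (expMap g P) v := by
      intro v hv
      rcases hv.lt_or_eq with hv | hv
      · exact h.isLocalDiffeomorphOn ⟨v, (hmemB v).2 hv⟩
      · exact isLocalDiffeomorphAt_of_confRadius_lt hm hψ hι0 hι hr0 hr hlt hv
    have hdom : ∀ v : 𝔼 m, tnorm g P v ≤ ι → expDomain g P ∈ 𝓝 v := by
      intro v hv
      rcases hv.lt_or_eq with hv | hv
      · exact Filter.mem_of_superset ((isOpen_tangentBall g P _).mem_nhds ((hmemB v).2 hv)) h.subset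
      · obtain ⟨-, -, O, hO, hvO, hOd, -⟩ := key hv
        exact Filter.mem_of_superset (hO.mem_nhds hvO) hOd
    -- On the closed ball, `exp_P v` is the new exponential of a positive multiple of `v`, of norm
    -- less than `r` inside and equal to `r` on the sphere. Injectivity of the new exponential map
    -- therefore passes to `exp_P` on the closed ball.
    have hext : ∀ v : 𝔼 m, tnorm g P v ≤ ι → ∃ a : ℝ, 0 < a ∧
        a • v ∈ tangentBall (conformal g Ψ hΨ hpos) P (injRadius (conformal g Ψ hΨ hpos) P) ∧
        expMap g P v = expMap (conformal g Ψ hΨ hpos) P (a • v) ∧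
        (tnorm g P v < ι → a • v = confMap g P Ψ v ∧
          tnorm (conformal g Ψ hΨ hpos) P (a • v) < r) ∧
        (tnorm g P v = ι → a = r / (Ψ P * ι) ∧
          tnorm (conformal g Ψ hΨ hpos) P (a • v) = r) := by
      intro v hv
      rcases hv.lt_or_eq with hv | hv
      · have hvB := (hmemB v).2 hv
        have hmem' := confMap_mem (hΨ := hΨ) (hpos := hpos) hm hψ hvB
        refine ⟨stretch g P Ψ v, stretch_pos h hΨ hpos hvB, tangentBall_mono _ P hlt.le hmem',
          (expMap_confMap hψ hvB).2.symm, fun _ => ⟨rfl, ?_⟩, fun h => absurd h hv.ne⟩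
        rw [mem_tangentBall, ← hr, ENNReal.ofReal_lt_ofReal_iff hr0] at hmem'
        exact hmem'
      · refine ⟨r / (Ψ P * ι), div_pos hr0 (mul_pos (hpos P) hι0), (key hv).1, (key hv).2.1,
          fun h => absurd hv h.ne, fun _ => ⟨rfl, ?_⟩⟩
        have := hpos P
        rw [tnorm_conformal, tnorm_smul, hv, abs_of_pos (by positivity)]
        field_simp
    have hinjK : InjOn (expMap g P) {v : 𝔼 m | tnorm g P v ≤ ι} := by
      intro v hv w hw hvw
      obtain ⟨a, ha0, haB, haF, ha1, ha2⟩ := hext v hv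
      obtain ⟨b, hb0, hbB, hbF, hb1, hb2⟩ := hext w hw
      have hab : a • v = b • w := h'.injOn haB hbB (by rw [← haF, hvw, hbF])
      rcases (show tnorm g P v ≤ ι from hv).lt_or_eq with hv' | hv' <;>
        rcases (show tnorm g P w ≤ ι from hw).lt_or_eq with hw' | hw'
      · exact h.injOn ((hmemB v).2 hv') ((hmemB w).2 hw') hvw
      · have h1 := (ha1 hv').2
        rw [hab, (hb2 hw').2] at h1
        exact absurd h1 (lt_irrefl r)
      · have h1 := (hb1 hw').2
        rw [← hab, (ha2 hv').2] at h1
        exact absurd h1 (lt_irrefl r)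
      · rw [(ha2 hv').1, ← (hb2 hw').1] at hab
        exact smul_right_injective _ hb0.ne' hab
    -- Injectivity on a compact set together with local injectivity at its points gives injectivity
    -- on a neighbourhood, hence a good radius `R > ι`.
    obtain ⟨T, hT, hTinj⟩ := hinjK.exists_mem_nhdsSet (isCompact_tnorm_le g P ι)
      (fun v hv => (hld v hv).contMDiffAt.continuousAt)
      fun v hv => exists_injOn_of_isLocalDiffeomorphAt (hld v hv)
    obtain ⟨R, hR, hsub⟩ := exists_tangentBall_subset g P
      ((isOpen_interior (s := T ∩ expDomain g P)).inter (isOpen_isLocalDiffeomorphAt (expMap g P)))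
      hι0.le (by
        intro v hv
        refine ⟨mem_interior_iff_mem_nhds.2 (Filter.inter_mem ?_ (hdom v hv)), hld v hv⟩
        exact mem_nhdsSet_iff_forall.1 hT v hv)
    have hgood : GoodRadius g P (ENNReal.ofReal R) :=
      ⟨fun v hv => (interior_subset (hsub hv).1).2,
        hTinj.mono fun v hv => (interior_subset (hsub hv).1).1, fun v => (hsub v.2).2⟩
    have hle := hgood.le
    rw [← hι] at hle
    exact absurd ((ENNReal.ofReal_le_ofReal_iff hι0.le).1 hle) (not_le.2 hR)

end ConformalRadius

/-! ### Gram determinants and rank one perturbations. -/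

section GramDet

local notation "𝔼" m => EuclideanSpace ℝ (Fin m)

variable {m : ℕ}

/-- The Gram determinant of a bilinear form with respect to the standard basis. -/
def gramDet (B : (𝔼 m) →L[ℝ] (𝔼 m) →L[ℝ] ℝ) : ℝ :=
  (Matrix.of fun i j : Fin m =>
    B (EuclideanSpace.single i (1 : ℝ)) (EuclideanSpace.single j (1 : ℝ))).det

theorem gramDet_comp (B : (𝔼 m) →L[ℝ] (𝔼 m) →L[ℝ] ℝ) (T : (𝔼 m) →L[ℝ] (𝔼 m)) :
    (Matrix.of fun i j : Fin m => B (T (EuclideanSpace.single i (1 : ℝ)))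
      (T (EuclideanSpace.single j (1 : ℝ)))).det =
      LinearMap.det (T : (𝔼 m) →ₗ[ℝ] (𝔼 m)) ^ 2 * gramDet B := by
  let b : Module.Basis (Fin m) ℝ (𝔼 m) := (EuclideanSpace.basisFun (Fin m) ℝ).toBasis
  let β : LinearMap.BilinForm ℝ (𝔼 m) :=
    LinearMap.mk₂ ℝ (fun x y => B x y) (by simp) (by simp) (by simp) (by simp)
  have hb : ∀ i, b i = EuclideanSpace.single i (1 : ℝ) := fun i => by simp [b]
  have h := LinearMap.BilinForm.toMatrix_comp b b β (T : (𝔼 m) →ₗ[ℝ] (𝔼 m)) T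
  have h1 : LinearMap.BilinForm.toMatrix b (β.comp (T : (𝔼 m) →ₗ[ℝ] (𝔼 m)) T) =
      Matrix.of fun i j : Fin m => B (T (EuclideanSpace.single i (1 : ℝ)))
        (T (EuclideanSpace.single j (1 : ℝ))) := by
    ext i j
    simp [LinearMap.BilinForm.toMatrix_apply, hb, β]
  have h2 : LinearMap.BilinForm.toMatrix b β = Matrix.of fun i j : Fin m =>
      B (EuclideanSpace.single i (1 : ℝ)) (EuclideanSpace.single j (1 : ℝ)) := by
    ext i j
    simp [LinearMap.BilinForm.toMatrix_apply, hb, β]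
  rw [← h1, h, h2, Matrix.det_mul, Matrix.det_mul, Matrix.det_transpose, LinearMap.det_toMatrix,
    gramDet]
  ring

theorem gramDet_smul (c : ℝ) (B : (𝔼 m) →L[ℝ] (𝔼 m) →L[ℝ] ℝ) :
    gramDet (c • B) = c ^ m * gramDet B := by
  have h : (Matrix.of fun i j : Fin m =>
      (c • B) (EuclideanSpace.single i (1 : ℝ)) (EuclideanSpace.single j (1 : ℝ))) =
      c • Matrix.of fun i j : Fin m =>
        B (EuclideanSpace.single i (1 : ℝ)) (EuclideanSpace.single j (1 : ℝ)) := by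
    ext i j
    simp
  rw [gramDet, h, Matrix.det_smul, Fintype.card_fin, gramDet]

/-- The determinant of a rank one perturbation of a nonzero multiple of the identity. -/
theorem det_smul_add_smulRight {V : Type*} [NormedAddCommGroup V] [NormedSpace ℝ V]
    [FiniteDimensional ℝ V] {a : ℝ} (ha : a ≠ 0) (f : V →L[ℝ] ℝ) (v : V) {T : V →L[ℝ] V}
    (hT : ∀ w, T w = a • w + f w • v) :
    a * LinearMap.det (T : V →ₗ[ℝ] V) = a ^ Module.finrank ℝ V * (a + f v) := by
  have h : (T : V →ₗ[ℝ] V) = a • LinearMap.transvection (a⁻¹ • (f : V →ₗ[ℝ] ℝ)) v := by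
    ext w
    simp [LinearMap.transvection.apply, hT, smul_smul, ha]
  rw [h, LinearMap.det_smul, LinearMap.transvection.det]
  simp
  field_simp

/-- The linear map sending the standard basis to `e`. -/
def frameMap (e : Fin m → 𝔼 m) : (𝔼 m) →L[ℝ] (𝔼 m) :=
  ∑ i, (EuclideanSpace.proj i : (𝔼 m) →L[ℝ] ℝ).smulRight (e i)

theorem frameMap_apply (e : Fin m → 𝔼 m) (x : 𝔼 m) : frameMap e x = ∑ i, x i • e i := by
  simp [frameMap]

theorem frameMap_single (e : Fin m → 𝔼 m) (i : Fin m) :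
    frameMap e (EuclideanSpace.single i (1 : ℝ)) = e i := by
  rw [frameMap_apply, Finset.sum_eq_single i] <;> simp +contextual [eq_comm]

end GramDet

/-! ### The volume density through the exponential map. -/

section Density

variable {m : ℕ} {M : Type*} [TopologicalSpace M]
  [ChartedSpace (EuclideanSpace ℝ (Fin m)) M] [IsManifold (𝓡 m) ∞ M] [T2Space M]

local notation "𝔼" m => EuclideanSpace ℝ (Fin m)

variable {g : RiemMetric m M} {P : M} {Ψ : M → ℝ} {hΨ : ContMDiff (𝓡 m) 𝓘(ℝ, ℝ) ∞ Ψ}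
  {hpos : ∀ x, 0 < Ψ x} {ψ : ℝ → ℝ}

/-- The determinant of the linear map sending the standard basis to `e`. -/
def frameDet (e : Fin m → 𝔼 m) : ℝ := LinearMap.det (frameMap e : (𝔼 m) →ₗ[ℝ] (𝔼 m))

/-- `frameDet e ^ 2` is thus determined by the metric at `P` alone, which is why the density does
not depend on the frame. -/
theorem IsOrthonormalFrame.frameDet_sq {e : Fin m → 𝔼 m} (he : IsOrthonormalFrame g P e) :
    frameDet e ^ 2 * gramDet (form g P) = 1 := by
  rw [frameDet, ← gramDet_comp]
  refine Eq.trans (congrArg Matrix.det ?_) (Matrix.det_one (n := Fin m) (R := ℝ))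
  ext i j
  rw [Matrix.of_apply, frameMap_single, frameMap_single, Matrix.one_apply]
  exact he i j

theorem IsOrthonormalFrame.tnorm_frameMap {e : Fin m → 𝔼 m} (he : IsOrthonormalFrame g P e)
    (x : 𝔼 m) : tnorm g P (frameMap e x) = ‖x‖ := by
  have h : form g P (frameMap e x) (frameMap e x) = ‖x‖ ^ 2 := by
    have he' : ∀ i j, form g P (e i) (e j) = if i = j then 1 else 0 := he
    rw [frameMap_apply, EuclideanSpace.norm_sq_eq]
    simp [he', pow_two]
  rw [← tnorm_sq] at h
  exact (sq_eq_sq₀ (tnorm_nonneg _ _ _) (norm_nonneg _)).1 h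

theorem IsOrthonormalFrame.frameMap_surjective {e : Fin m → 𝔼 m}
    (he : IsOrthonormalFrame g P e) : Function.Surjective (frameMap e) := by
  have hinj : Function.Injective (frameMap e : (𝔼 m) →ₗ[ℝ] (𝔼 m)) := by
    rw [injective_iff_map_eq_zero]
    intro x hx
    have h := he.tnorm_frameMap x
    rw [show frameMap e x = 0 from hx, tnorm_zero] at h
    exact norm_eq_zero.1 h.symm
  exact LinearMap.injective_iff_surjective.1 hinj

theorem geodParam_eq (g : RiemMetric m M) (P : M) (e : Fin m → 𝔼 m) :
    geodParam g P e = expMap g P ∘ frameMap e := by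
  ext x
  rw [Function.comp_apply, frameMap_apply]
  rfl

theorem IsOrthonormalFrame.frameMap_mem_iff {e : Fin m → 𝔼 m} (he : IsOrthonormalFrame g P e)
    {x : 𝔼 m} {R : ℝ≥0∞} : frameMap e x ∈ tangentBall g P R ↔ ENNReal.ofReal ‖x‖ < R := by
  rw [mem_tangentBall, he.tnorm_frameMap]

theorem det_geodMetric {e : Fin m → 𝔼 m} {x : 𝔼 m}
    (hx : frameMap e x ∈ tangentBall g P (injRadius g P)) :
    (geodMetric g P e x).det =
      frameDet e ^ 2 * gramDet (pull g (expMap g P) (frameMap e x)) := by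
  rw [frameDet, ← gramDet_comp]
  congr 1
  ext i j
  change pull g (geodParam g P e) x _ _ = _
  rw [geodParam_eq, pull_comp g ((goodRadius_injRadius g P).isParam.mdifferentiableAt hx)
    (frameMap e).differentiableAt, pullForm_apply, ContinuousLinearMap.fderiv]
  rfl

/-- The volume density in terms of the pull-back of the metric by the exponential map. -/
theorem volDensity_expMap {e : Fin m → 𝔼 m} (he : IsOrthonormalFrame g P e) {v : 𝔼 m}
    (hv : v ∈ tangentBall g P (injRadius g P)) :
    volDensity g P e (expMap g P v) =
      √(frameDet e ^ 2 * gramDet (pull g (expMap g P) v)) := by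
  obtain ⟨x, rfl⟩ := he.frameMap_surjective v
  have hinj : InjOn (geodParam g P e) {x | ENNReal.ofReal ‖x‖ < injRadius g P} := by
    intro a ha b hb hab
    rw [geodParam_eq] at hab
    have h := (goodRadius_injRadius g P).injOn (he.frameMap_mem_iff.2 ha)
      (he.frameMap_mem_iff.2 hb) hab
    exact LinearMap.injective_iff_surjective.2
      (show Function.Surjective (frameMap e : (𝔼 m) →ₗ[ℝ] (𝔼 m)) from he.frameMap_surjective) h
  have hc : geodCoord g P e (expMap g P (frameMap e x)) = x := by
    have h := invFunOn_apply_eq hinj (he.frameMap_mem_iff.1 hv)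
    rw [geodParam_eq] at h
    unfold geodCoord
    rw [geodParam_eq]
    exact h
  unfold volDensity
  rw [hc, det_geodMetric hv]

theorem IsOrthonormalFrame.smul {e' : Fin m → 𝔼 m}
    (he' : IsOrthonormalFrame (conformal g Ψ hΨ hpos) P e') :
    IsOrthonormalFrame g P fun i => Ψ P • e' i := by
  intro i j
  rw [← he' i j]
  change form g P (Ψ P • e' i) (Ψ P • e' j) = form (conformal g Ψ hΨ hpos) P (e' i) (e' j)
  rw [form_conformal]
  simp
  ring

end Density

/-! ### The density and the radial profile of the conformal metric. -/

section ConformalDensity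

variable {m : ℕ} {M : Type*} [TopologicalSpace M]
  [ChartedSpace (EuclideanSpace ℝ (Fin m)) M] [IsManifold (𝓡 m) ∞ M] [T2Space M]

local notation "𝔼" m => EuclideanSpace ℝ (Fin m)

variable {g : RiemMetric m M} {P : M} {Ψ : M → ℝ} {hΨ : ContMDiff (𝓡 m) 𝓘(ℝ, ℝ) ∞ Ψ}
  {hpos : ∀ x, 0 < Ψ x} {ψ : ℝ → ℝ}

theorem frameDet_sq_conformal {e e' : Fin m → 𝔼 m} (he : IsOrthonormalFrame g P e)
    (he' : IsOrthonormalFrame (conformal g Ψ hΨ hpos) P e') :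
    frameDet e ^ 2 = frameDet e' ^ 2 * (Ψ P ^ 2) ^ m := by
  have h := he.frameDet_sq
  have h' := he'.frameDet_sq
  have hf : form (conformal g Ψ hΨ hpos) P = Ψ P ^ 2 • form g P := rfl
  rw [hf, gramDet_smul] at h'
  have hD : gramDet (form g P) ≠ 0 := right_ne_zero_of_mul_eq_one h
  refine mul_right_cancel₀ hD ?_
  rw [h, ← h']
  ring

/-- The pull-back of `g'` by `exp_P` is computed in two ways: as `Ψ²` times the pull-back of `g`,
and through the factorization of `exp_P` by `confMap`. -/
theorem gramDet_pull_conformal (hψ : IsRadialProfile g P Ψ ψ) {v : 𝔼 m}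
    (hv : v ∈ tangentBall g P (injRadius g P))
    (hv' : confMap g P Ψ v ∈ tangentBall (conformal g Ψ hΨ hpos) P
      (injRadius (conformal g Ψ hΨ hpos) P)) :
    (Ψ (expMap g P v) ^ 2) ^ m * gramDet (pull g (expMap g P) v) =
      LinearMap.det (fderiv ℝ (confMap g P Ψ) v : (𝔼 m) →ₗ[ℝ] (𝔼 m)) ^ 2 *
        gramDet (pull (conformal g Ψ hΨ hpos) (expMap (conformal g Ψ hΨ hpos) P)
          (confMap g P Ψ v)) := by
  have hB := isOpen_tangentBall g P (injRadius g P)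
  have hd : DifferentiableAt ℝ (confMap g P Ψ) v := ((contDiffOn_confMap
    (goodRadius_injRadius g P) hΨ).contDiffAt (hB.mem_nhds hv)).differentiableAt (by simp)
  have hev : expMap g P =ᶠ[𝓝 v] expMap (conformal g Ψ hΨ hpos) P ∘ confMap g P Ψ := by
    filter_upwards [hB.mem_nhds hv] with w hw
    exact (expMap_confMap hψ hw).2.symm
  have h1 := pull_comp (conformal g Ψ hΨ hpos)
    ((goodRadius_injRadius (conformal g Ψ hΨ hpos) P).isParam.mdifferentiableAt hv') hd
  rw [← pull_congr _ hev, pull_conformal] at h1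
  replace h1 : Ψ (expMap g P v) ^ 2 • pull g (expMap g P) v = _ := h1
  rw [← gramDet_smul, ← gramDet_comp, h1]
  rfl

/-- The volume densities of two conformal metrics. -/
theorem volDensity_conformal_expMap [ConnectedSpace M] (hm : 1 ≤ m)
    (hψ : IsRadialProfile g P Ψ ψ) {e e' : Fin m → 𝔼 m} (he : IsOrthonormalFrame g P e)
    (he' : IsOrthonormalFrame (conformal g Ψ hΨ hpos) P e') {v : 𝔼 m}
    (hv : v ∈ tangentBall g P (injRadius g P)) :
    volDensity (conformal g Ψ hΨ hpos) P e' (expMap g P v) =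
      (Ψ (expMap g P v) / rayAvg (Ψ ∘ expMap g P) v) ^ (m - 1) *
        volDensity g P e (expMap g P v) := by
  have hgood := goodRadius_injRadius g P
  have hv' : confMap g P Ψ v ∈ tangentBall (conformal g Ψ hΨ hpos) P
      (injRadius (conformal g Ψ hΨ hpos) P) := by
    rw [injRadius_conformal hm hψ]
    exact confMap_mem hm hψ hv
  have hs := stretch_pos hgood hΨ hpos hv
  have hdet := det_smul_add_smulRight hs.ne' (fderiv ℝ (stretch g P Ψ) v) v
    (fderiv_confMap hgood hΨ hv)
  rw [stretch_add_fderiv hgood hΨ hv, finrank_euclideanSpace_fin] at hdet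
  have hgram := gramDet_pull_conformal (hΨ := hΨ) (hpos := hpos) hψ hv hv'
  have hfr := frameDet_sq_conformal he he'
  have hvol := volDensity_expMap he' hv'
  rw [(expMap_confMap hψ hv).2] at hvol
  -- The mean replaces `η(r) / r` because it also makes sense at `r = 0`, so one formula covers `P`
  -- and the punctured ball.
  have hκ : rayAvg (Ψ ∘ expMap g P) v = Ψ P * stretch g P Ψ v := by
    rw [stretch, mul_div_cancel₀ _ (hpos P).ne']
  rw [hvol, volDensity_expMap he hv, hκ]
  have hP := hpos P
  have hF := hpos (expMap g P v)
  obtain ⟨n, rfl⟩ : ∃ n, m = n + 1 := ⟨m - 1, by omega⟩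
  rw [Nat.add_sub_cancel]
  set s := stretch g P Ψ v
  set d := LinearMap.det (fderiv ℝ (confMap g P Ψ) v : (𝔼 (n + 1)) →ₗ[ℝ] (𝔼 (n + 1)))
  set γ' := gramDet (pull (conformal g Ψ hΨ hpos) (expMap (conformal g Ψ hΨ hpos) P)
    (confMap g P Ψ v))
  set γ := gramDet (pull g (expMap g P) v)
  set p := Ψ P
  set q := Ψ (expMap g P v)
  -- The differential of `confMap` is a rank one perturbation of `s·id`: the radial factor is `q /
  -- p`, and the other `n = m - 1` factors are `s`.
  have hd : d = s ^ n * (q / p) := by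
    refine mul_left_cancel₀ hs.ne' ?_
    rw [hdet]
    ring
  have hγ : γ' = (q ^ 2) ^ (n + 1) * γ / d ^ 2 := by
    have : d ≠ 0 := by rw [hd]; positivity
    rw [hgram]
    field_simp
  have key : frameDet e' ^ 2 * γ' = ((q / (p * s)) ^ n) ^ 2 * (frameDet e ^ 2 * γ) := by
    rw [hγ, hd, hfr, div_pow, div_pow, mul_pow, mul_pow, div_pow]
    field_simp
    ring
  rw [key, Real.sqrt_mul (sq_nonneg _), Real.sqrt_sq (by positivity)]

theorem smul_mem_radii {s t : ℝ} (hs : s ∈ radii g P) (ht : t ∈ Icc (0 : ℝ) 1) :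
    t • s ∈ radii g P := by
  refine lt_of_le_of_lt (ENNReal.ofReal_le_ofReal ?_) hs
  rw [smul_eq_mul, abs_mul, abs_of_nonneg ht.1]
  exact mul_le_of_le_one_left (abs_nonneg s) ht.2

theorem IsRadialProfile.rayAvg_neg (hψ : IsRadialProfile g P Ψ ψ) {s : ℝ}
    (hs : s ∈ radii g P) : rayAvg ψ (-s) = rayAvg ψ s := by
  refine intervalIntegral.integral_congr fun t ht => ?_
  rw [uIcc_of_le zero_le_one] at ht
  change ψ (t • -s) = ψ (t • s)
  rw [smul_neg, hψ.even (smul_mem_radii hs ht)]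

theorem IsRadialProfile.rayAvg_pos (hm : 1 ≤ m) (hψ : IsRadialProfile g P Ψ ψ)
    (hpos : ∀ x, 0 < Ψ x) {s : ℝ} (hs : s ∈ radii g P) : 0 < rayAvg ψ s :=
  RiemGeom.rayAvg_pos (fun _ ht => hψ.contDiffOn.continuousOn.continuousAt
    ((isOpen_radii g P).mem_nhds (smul_mem_radii hs ht)))
    fun _ ht => hψ.pos hm hpos (smul_mem_radii hs ht)

theorem IsRadialProfile.contDiffOn_rayAvg (hψ : IsRadialProfile g P Ψ ψ) :
    ContDiffOn ℝ ∞ (rayAvg ψ) (radii g P) :=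
  RiemGeom.contDiffOn_rayAvg (isOpen_radii g P) (fun _ hs _ ht => smul_mem_radii hs ht)
    hψ.contDiffOn

variable [ConnectedSpace M]

theorem injBall_conformal (hm : 1 ≤ m) (hψ : IsRadialProfile g P Ψ ψ) :
    injBall (conformal g Ψ hΨ hpos) P = injBall g P := by
  rw [injBall_eq, injBall_eq, injRadius_conformal hm hψ, ← image_confMap hm hψ, image_image]
  exact image_congr fun v hv => (expMap_confMap hψ hv).2

theorem gDist_conformal_expMap (hm : 1 ≤ m) (hψ : IsRadialProfile g P Ψ ψ) {v : 𝔼 m}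
    (hv : v ∈ tangentBall g P (injRadius g P)) :
    gDist (conformal g Ψ hΨ hpos) P (expMap g P v) = ∫ t in (0 : ℝ)..tnorm g P v, ψ t := by
  have hv' : confMap g P Ψ v ∈ tangentBall (conformal g Ψ hΨ hpos) P
      (injRadius (conformal g Ψ hΨ hpos) P) := by
    rw [injRadius_conformal hm hψ]
    exact confMap_mem hm hψ hv
  rw [← hψ.tnorm_confMap (hΨ := hΨ) (hpos := hpos) hv, ← gDist_expMap hv',
    (expMap_confMap hψ hv).2]

/-- The primitive of `ψ` is odd and increasing, so it maps the symmetric interval of `g` onto that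
of `g'`. -/
theorem radii_conformal (hm : 1 ≤ m) (hψ : IsRadialProfile g P Ψ ψ) :
    radii (conformal g Ψ hΨ hpos) P = (fun s => ∫ t in (0 : ℝ)..s, ψ t) '' radii g P := by
  have hr : ∀ τ, τ ∈ radii (conformal g Ψ hΨ hpos) P ↔
      ENNReal.ofReal |τ| < confRadius g P ψ := fun τ => by
    rw [← injRadius_conformal (hΨ := hΨ) (hpos := hpos) hm hψ]; rfl
  ext τ
  constructor
  · intro hτ
    obtain ⟨s, -, hs, hsτ⟩ := exists_primitive_eq hψ (abs_nonneg τ) ((hr τ).1 hτ)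
    rcases le_total 0 τ with h | h
    · exact ⟨s, hs, by rw [← abs_of_nonneg h]; exact hsτ⟩
    · refine ⟨-s, neg_mem_radii hs, ?_⟩
      simp only [hψ.primitive_neg hs, hsτ, abs_of_nonpos h, neg_neg]
  · rintro ⟨s, hs, rfl⟩
    rw [hr]
    have key : ∀ s, 0 ≤ s → s ∈ radii g P →
        ENNReal.ofReal |∫ t in (0 : ℝ)..s, ψ t| < confRadius g P ψ := by
      intro s hs0 hs
      have h := (hψ.strictMonoOn_primitive hm hpos).monotoneOn (zero_mem_radii g P) hs hs0
      rw [abs_of_nonneg (by simpa using h)]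
      exact primitive_lt_confRadius hm hψ hpos hs0 hs
    rcases le_total 0 s with h | h
    · exact key s h hs
    · have h2 := key (-s) (by linarith) (neg_mem_radii hs)
      rwa [hψ.primitive_neg hs, abs_neg] at h2

/-- The new profile is `(ψ / κ)^(m-1) φ` composed with the inverse of `η`, where `κ` is the mean of
`ψ`. The functions `ψ`, `κ`, `φ` are smooth and even and `κ` is positive, while `η` is odd with
smooth inverse. -/
theorem centralHarmonic_conformal (hm : 1 ≤ m) (hg : CentralHarmonic g P)
    (hψ : IsRadialProfile g P Ψ ψ) : CentralHarmonic (conformal g Ψ hΨ hpos) P := by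
  intro e' he'
  -- A `g'`-orthonormal frame becomes `g`-orthonormal after scaling by `Ψ P`, so the hypothesis on
  -- `g` applies to it.
  have he : IsOrthonormalFrame g P fun i => Ψ P • e' i := IsOrthonormalFrame.smul he'
  obtain ⟨φ, hφ⟩ := hg _ he
  obtain ⟨-, -, -, hsm, hinv⟩ := exists_inverse_of_deriv_pos (isOpen_radii g P)
    (ordConnected_radii g P) hψ.contDiffOn_primitive fun t ht => by
      rw [(hψ.hasDerivAt_primitive ht).deriv]
      exact hψ.pos hm hpos ht
  set η : ℝ → ℝ := fun s => ∫ t in (0 : ℝ)..s, ψ t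
  set σ : ℝ → ℝ := Function.invFunOn η (radii g P)
  have hσ : ∀ s ∈ radii g P, σ (η s) = s := fun s hs => (hinv s hs).1
  have hrad : {t : ℝ | ENNReal.ofReal |t| < injRadius (conformal g Ψ hΨ hpos) P} =
      η '' radii g P := radii_conformal hm hψ
  have hmem : ∀ τ : ℝ, ENNReal.ofReal |τ| < injRadius (conformal g Ψ hΨ hpos) P →
      ∃ s ∈ radii g P, η s = τ := fun τ hτ => by
    have h : τ ∈ η '' radii g P := hrad ▸ hτ
    exact h
  have hsmooth : ContDiffOn ℝ ∞ (fun s => (ψ s / rayAvg ψ s) ^ (m - 1) * φ s) (radii g P) :=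
    ((hψ.contDiffOn.div hψ.contDiffOn_rayAvg
      fun s hs => (hψ.rayAvg_pos hm hpos hs).ne').pow _).mul hφ.contDiffOn
  refine ⟨fun τ => (ψ (σ τ) / rayAvg ψ (σ τ)) ^ (m - 1) * φ (σ τ), ?_, ?_, ?_⟩
  · rw [hrad]
    refine hsmooth.comp hsm ?_
    rintro _ ⟨s, hs, rfl⟩
    rw [hσ s hs]
    exact hs
  · intro τ hτ
    obtain ⟨s, hs, rfl⟩ := hmem τ hτ
    have hneg : -η s = η (-s) := (hψ.primitive_neg hs).symm
    simp only [hneg]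
    rw [hσ s hs, hσ _ (neg_mem_radii hs), hψ.even hs, hφ.even hs, hψ.rayAvg_neg hs]
  · rw [injBall_conformal hm hψ, injBall_eq]
    rintro _ ⟨v, hv, rfl⟩
    rw [gDist_conformal_expMap hm hψ hv]
    change _ = (ψ (σ (η (tnorm g P v))) / rayAvg ψ (σ (η (tnorm g P v)))) ^ (m - 1) *
      φ (σ (η (tnorm g P v)))
    rw [hσ _ (tnorm_mem_radii hv), volDensity_conformal_expMap hm hψ he he' hv,
      hψ.rayAvg_comp_expMap hv, hψ.comp_expMap hv, hφ.comp_expMap hv]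

/-- Substituting `η(r) = r κ` cancels the powers of `r`, which is nonzero away from `P`. -/
theorem volDensity_conformal_of_ne (hm : 1 ≤ m) (hψ : IsRadialProfile g P Ψ ψ)
    {e e' : Fin m → 𝔼 m} (he : IsOrthonormalFrame g P e)
    (he' : IsOrthonormalFrame (conformal g Ψ hΨ hpos) P e') {Q : M} (hQ : Q ∈ injBall g P)
    (hQP : Q ≠ P) :
    volDensity (conformal g Ψ hΨ hpos) P e' Q =
      (∫ t in (0 : ℝ)..gDist g P Q, ψ t) ^ (1 - (m : ℤ)) * gDist g P Q ^ ((m : ℤ) - 1) *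
        ψ (gDist g P Q) ^ ((m : ℤ) - 1) * volDensity g P e Q := by
  rw [injBall_eq] at hQ
  obtain ⟨v, hv, rfl⟩ := hQ
  have hgood := goodRadius_injRadius g P
  have hv0 : v ≠ 0 := fun h => hQP (by rw [h]; exact hgood.expMap_zero hv)
  have hn := tnorm_pos g P hv0
  have hκ := hψ.rayAvg_pos hm hpos (tnorm_mem_radii hv)
  obtain ⟨n, rfl⟩ : ∃ n, m = n + 1 := ⟨m - 1, by omega⟩
  have h1 : (1 : ℤ) - ((n + 1 : ℕ) : ℤ) = -(n : ℤ) := by push_cast; ring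
  have h2 : ((n + 1 : ℕ) : ℤ) - 1 = (n : ℤ) := by push_cast; ring
  rw [gDist_expMap hv, ← hψ.tnorm_mul_rayAvg hv, volDensity_conformal_expMap hm hψ he he' hv,
    hψ.rayAvg_comp_expMap hv, hψ.comp_expMap hv, h1, h2, zpow_neg, zpow_natCast, zpow_natCast,
    zpow_natCast, Nat.add_sub_cancel, div_pow, mul_pow]
  field_simp

theorem volDensity_conformal_self (hm : 1 ≤ m) (hψ : IsRadialProfile g P Ψ ψ)
    {e e' : Fin m → 𝔼 m} (he : IsOrthonormalFrame g P e)
    (he' : IsOrthonormalFrame (conformal g Ψ hΨ hpos) P e') :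
    volDensity (conformal g Ψ hΨ hpos) P e' P = volDensity g P e P := by
  have hv : (0 : 𝔼 m) ∈ tangentBall g P (injRadius g P) := by
    rw [mem_tangentBall]
    simpa using injRadius_pos g P
  have h := volDensity_conformal_expMap hm hψ he he' hv
  have h0 : rayAvg (Ψ ∘ expMap g P) (0 : 𝔼 m) = Ψ P := by
    simp [rayAvg, (goodRadius_injRadius g P).expMap_zero hv]
  rwa [h0, (goodRadius_injRadius g P).expMap_zero hv, div_self (hpos P).ne', one_pow,
    one_mul] at h

end ConformalDensity

end RiemGeom

end

theorem corollary2p2 {m : ℕ} (hm : 1 ≤ m) {M : Type*} [TopologicalSpace M] [T2Space M]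
    [ConnectedSpace M] [ChartedSpace (EuclideanSpace ℝ (Fin m)) M] [IsManifold (𝓡 m) ∞ M]
    (g : RiemGeom.RiemMetric m M) (P : M) (hg : RiemGeom.CentralHarmonic g P)
    (Ψ : M → ℝ) (hΨ : ContMDiff (𝓡 m) 𝓘(ℝ, ℝ) ∞ Ψ) (hpos : ∀ x, 0 < Ψ x)
    (hrad : RiemGeom.IsRadial g P Ψ) :
    let g' : RiemGeom.RiemMetric m M := RiemGeom.conformal g Ψ hΨ hpos
    RiemGeom.CentralHarmonic g' P ∧
    ∀ ψ : ℝ → ℝ, RiemGeom.IsRadialProfile g P Ψ ψ →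
      let r : M → ℝ := RiemGeom.gDist g P
      let η : ℝ → ℝ := fun s => ∫ t in (0 : ℝ)..s, ψ t
      RiemGeom.injBall g' P = RiemGeom.injBall g P ∧
      (∀ Q ∈ RiemGeom.injBall g P, RiemGeom.gDist g' P Q = η (r Q)) ∧
      ∀ e e' : Fin m → TangentSpace (𝓡 m) P, RiemGeom.IsOrthonormalFrame g P e →
        RiemGeom.IsOrthonormalFrame g' P e' →
        (∀ Q ∈ RiemGeom.injBall g P, Q ≠ P →
          RiemGeom.volDensity g' P e' Q =
            η (r Q) ^ (1 - (m : ℤ)) * r Q ^ ((m : ℤ) - 1) * ψ (r Q) ^ ((m : ℤ) - 1) *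
              RiemGeom.volDensity g P e Q) ∧
        RiemGeom.volDensity g' P e' P = RiemGeom.volDensity g P e P := by
  obtain ⟨ψ₀, hψ₀⟩ := hrad
  refine ⟨RiemGeom.centralHarmonic_conformal hm hg hψ₀, fun ψ hψ =>
    ⟨RiemGeom.injBall_conformal hm hψ, fun Q hQ => ?_, fun e e' he he' =>
      ⟨fun Q hQ hQP => RiemGeom.volDensity_conformal_of_ne hm hψ he he' hQ hQP,
        RiemGeom.volDensity_conformal_self hm hψ he he'⟩⟩⟩
  rw [RiemGeom.injBall_eq] at hQ
  obtain ⟨v, hv, rfl⟩ := hQ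
  rw [RiemGeom.gDist_expMap hv]
  exact RiemGeom.gDist_conformal_expMap hm hψ hv
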